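/- Let $0<\gamma<1$, $\delta>0$, $r=\sqrt{(1-\gamma)/(\gamma+\delta)}$. For $V=(\zeta_1,\zeta_2,u_s,m)\in\mathbb R^4$ put $h_1=1+r\zeta_1-\zeta_2$, $h_2=\delta^{-1}+\zeta_2$ and \[F(V)=(\zeta_1,\zeta_2,u_1,u_2),\qquad u_1=\frac{m-h_2u_s}{\gamma(h_1+h_2)},\qquad u_2=\frac{m+h_1u_s}{h_1+h_2},\] with Jacobian matrix ${\rm d}F[V]$. For $U=(\zeta_1,\zeta_2,u_1,u_2)$ let \[A[U]=\begin{pmatrix}u_1&\frac{u_2-u_1}{r}&\frac{h_1}{r}&\frac{h_2}{r}\\0&u_2&0&h_2\\\frac1r&0&u_1&0\\\frac\gamma r&\delta+\gamma&0&u_2\end{pmatrix},\qquad L_r=\begin{pmatrix}0&0&\frac{\gamma-1}{\gamma(\delta+1)}&\frac{\gamma+\delta}{\gamma(\delta+1)}\\0&0&\frac r{1+\delta}&\frac r{1+\delta}\\0&r(\gamma+\delta)&0&0\\\gamma(1+\delta^{-1})&r\frac{\delta+\gamma}\delta&0&0\end{pmatrix},\] and define $B[V]$ by $\frac1rL_r+B[V]=({\rm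 d}F[V])^{-1}A[F(V)]\,{\rm d}F[V]$. For $U:\mathbb R\to\mathbb R^4$ let $|U|_{X^s}^2=\gamma|U_1|_{H^s}^2+|U_2|_{H^s}^2+\gamma|U_3|_{H^s}^2+|U_4|_{H^s}^2$, where $|f|_{H^s}=|(1-\partial_x^2)^{s/2}f|_{L^2(\mathbb R)}$ (and $|f|_{H^s}=\infty$ if $f\notin H^s(\mathbb R)$). Let $s_0>1/2$ and $s\ge s_0+1$. There is a nonnegative function $C$ of five real variables, nondecreasing in each of them, such that the following holds. Let $\delta_{\min},\delta_{\max},\gamma_{\min},M,T,h_0>0$, $\delta_{\min}\le\delta\le\delta_{\max}$, $\gamma_{\min}\le\gamma<1$. Let $V$ and $\partial_tV$ belong to $L^\infty([0,T];X^s)$ and $L^\infty([0,T];X^{s-1})$ respectively, with \[\|V\|_{L^\infty([0,T];X^s)}+\|\partial_tV\|_{L^\infty([0,T];X^{s-1})}\le M,\] and suppose that, for every $t\in[0,T]$, $F(V(t,\cdot))=(\zeta_1,\zeta_2,u_1,u_2)$ satisfies, for all $x\in\mathbb R$, \[h_1(x)\ge h_0,\qquad h_2(x)-\frac{|u_2(x)-u_1(x)|^2}{\gamma+\delta}\ge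 h_0 .\] Let $W\in C([0,T];X^s)\cap C^1([0,T];X^{s-1})$ be a strong solution on $[0,T]$ of \[\partial_tW+\Big(\frac1rL_r+B[V]\Big)\partial_xW=\mathcal R .\] Then, with $C_0=C(M,h_0^{-1},\delta_{\min}^{-1},\delta_{\max},\gamma_{\min}^{-1})$ (which depends neither on $r$ nor on $T$), for all $t\in[0,T]$, \[|W(t,\cdot)|_{X^s}\le C_0\,|W(0,\cdot)|_{X^s}\,e^{C_0Mt}+C_0\int_0^te^{C_0M(t-t')}\,|\mathcal R(t',\cdot)|_{X^s}\,dt' ,\] where the integral is allowed to be $+\infty$. -/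

import Mathlib

open MeasureTheory Filter Topology Matrix FourierTransform
open scoped ENNReal NNReal

noncomputable section

namespace TwoLayer

/-! ### Sobolev norms

Vector fields are functions `ℝ → Fin 4 → ℝ` of the space variable; time-dependent ones are functions
`ℝ → ℝ → Fin 4 → ℝ` of `(t, x)`. -/

open Classical in
/-- The norm `|f|_{H^s} = |Λ^s f|_{L²}` of a real function, `s ≥ 0`, with values in `[0, ∞]`; it is finite
exactly when `f ∈ H^s(ℝ)`. By Plancherel it is the `L²` norm of `(1 + (2πξ)²)^{s/2} 𝓕f(ξ)`: with Mathlib's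
normalisation `𝓕f(ξ) = ∫ e^{-2πixξ} f(x) dx`, the symbol of `Λ = (1 - ∂ₓ²)^{1/2}` is
`(1 + (2πξ)²)^{1/2}`. -/
def hsNorm (s : ℝ) (f : ℝ → ℝ) : ℝ≥0∞ :=
  if hf : MemLp (fun x => (f x : ℂ)) 2 (volume : Measure ℝ) then
    eLpNorm (fun ξ : ℝ => (((1 + (2 * Real.pi * ξ) ^ 2) ^ (s / 2) : ℝ) : ℂ) *
      (𝓕 (hf.toLp (fun x => (f x : ℂ))) : Lp ℂ 2 (volume : Measure ℝ)) ξ) 2 (volume : Measure ℝ)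
  else ∞

/-- The norm of `X^s`:
`|U|²_{X^s} = γ |U₁|²_{H^s} + |U₂|²_{H^s} + γ |U₃|²_{H^s} + |U₄|²_{H^s}`, with values in `[0, ∞]`. -/
def xsNorm (γ s : ℝ) (U : ℝ → Fin 4 → ℝ) : ℝ≥0∞ :=
  (ENNReal.ofReal γ * hsNorm s (fun x => U x 0) ^ 2 + hsNorm s (fun x => U x 1) ^ 2 +
    ENNReal.ofReal γ * hsNorm s (fun x => U x 2) ^ 2 + hsNorm s (fun x => U x 3) ^ 2) ^ (1 / 2 : ℝ)

/-- The norm of `L^∞([0,T]; X^s)`. -/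
def linftyXsNorm (γ s T : ℝ) (V : ℝ → ℝ → Fin 4 → ℝ) : ℝ≥0∞ :=
  essSup (fun t => xsNorm γ s (V t)) (volume.restrict (Set.Icc 0 T))

/-- `W ∈ C([0,T]; X^s)`. -/
def IsContinuousInXs (γ s T : ℝ) (W : ℝ → ℝ → Fin 4 → ℝ) : Prop :=
  (∀ t ∈ Set.Icc 0 T, xsNorm γ s (W t) < ∞) ∧
  ∀ t ∈ Set.Icc 0 T,
    Tendsto (fun τ => xsNorm γ s (W τ - W t)) (𝓝[Set.Icc 0 T] t) (𝓝 0)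

/-- `D` is the derivative at time `t`, in `X^s`, of `W : [0,T] → X^s` (one-sided at the endpoints). -/
def HasTimeDerivAt (γ s T : ℝ) (W : ℝ → ℝ → Fin 4 → ℝ) (D : ℝ → Fin 4 → ℝ) (t : ℝ) : Prop :=
  Tendsto (fun τ => xsNorm γ s ((τ - t)⁻¹ • (W τ - W t) - D)) (𝓝[Set.Icc 0 T \ {t}] t) (𝓝 0)

/-- `V` is Lipschitz in time with values in `X^s`, with almost everywhere derivative `V'`. As `X^s` is a
Hilbert space, this says that `∂ₜV = V' ∈ L^∞([0,T]; X^s)`, i.e. that `V` belongs to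
`W^{1,∞}([0,T]; X^s)` up to a function that does not depend on time. -/
structure HasBoundedTimeDeriv (γ s T : ℝ) (V V' : ℝ → ℝ → Fin 4 → ℝ) : Prop where
  lipschitz : ∃ K : ℝ≥0, ∀ t ∈ Set.Icc 0 T, ∀ τ ∈ Set.Icc 0 T,
    xsNorm γ s (V τ - V t) ≤ K * ENNReal.ofReal |τ - t|
  hasDeriv : ∀ᵐ t ∂(volume.restrict (Set.Icc 0 T)), HasTimeDerivAt γ s T V (V' t) t

/-! ### The free-surface system

`U = (ζ₁, ζ₂, u₁, u₂)` are the original unknowns and `V = (ζ₁, ζ₂, u_s, m)` the new ones, where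
`u_s = u₂ - γ u₁` and `m = γ h₁ u₁ + h₂ u₂`. -/

/-- The parameter `r = √((1 - γ) / (γ + δ))`. -/
def rho (γ δ : ℝ) : ℝ := Real.sqrt ((1 - γ) / (γ + δ))

/-- The depth of the upper layer, `h₁ = 1 + r ζ₁ - ζ₂`. -/
def depth₁ (γ δ : ℝ) (U : Fin 4 → ℝ) : ℝ := 1 + rho γ δ * U 0 - U 1

/-- The depth of the lower layer, `h₂ = δ⁻¹ + ζ₂`. -/
def depth₂ (δ : ℝ) (U : Fin 4 → ℝ) : ℝ := δ⁻¹ + U 1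

/-- The matrix `A[U]` of the free-surface system `∂ₜU + A[U] ∂ₓU = 0`. -/
def matA (γ δ : ℝ) (U : Fin 4 → ℝ) : Matrix (Fin 4) (Fin 4) ℝ :=
  !![U 2, (U 3 - U 2) / rho γ δ, depth₁ γ δ U / rho γ δ, depth₂ δ U / rho γ δ;
     0, U 3, 0, depth₂ δ U;
     1 / rho γ δ, 0, U 2, 0;
     γ / rho γ δ, δ + γ, 0, U 3]

/-- The change of unknowns `F : (ζ₁, ζ₂, u_s, m) ↦ (ζ₁, ζ₂, u₁, u₂)`. -/
def chgF (γ δ : ℝ) (V : Fin 4 → ℝ) : Fin 4 → ℝ :=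
  ![V 0, V 1,
    (V 3 - depth₂ δ V * V 2) / (γ * (depth₁ γ δ V + depth₂ δ V)),
    (V 3 + depth₁ γ δ V * V 2) / (depth₁ γ δ V + depth₂ δ V)]

/-- The Jacobian matrix `dF[V]` of `F`. -/
def jacF (γ δ : ℝ) (V : Fin 4 → ℝ) : Matrix (Fin 4) (Fin 4) ℝ :=
  let h₁ := depth₁ γ δ V
  let h₂ := depth₂ δ V
  let r := rho γ δ
  !![1, 0, 0, 0;
     0, 1, 0, 0;
     -(r * (V 3 - h₂ * V 2)) / (γ * (h₁ + h₂) ^ 2), -(V 2) / (γ * (h₁ + h₂)),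
       -h₂ / (γ * (h₁ + h₂)), 1 / (γ * (h₁ + h₂));
     r * V 2 / (h₁ + h₂) - r * (V 3 + h₁ * V 2) / (h₁ + h₂) ^ 2, -(V 2) / (h₁ + h₂),
       h₁ / (h₁ + h₂), 1 / (h₁ + h₂)]

/-- `jacF` is the Jacobian matrix of `chgF` wherever the total depth does not vanish. -/
theorem hasFDerivAt_chgF {γ δ : ℝ} (hγ : γ ≠ 0) {V : Fin 4 → ℝ}
    (hV : depth₁ γ δ V + depth₂ δ V ≠ 0) :
    HasFDerivAt (chgF γ δ) (LinearMap.toContinuousLinearMap (Matrix.toLin' (jacF γ δ V))) V := by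
  have hp : ∀ i : Fin 4, HasFDerivAt (fun v : Fin 4 → ℝ => v i)
      (ContinuousLinearMap.proj (R := ℝ) (φ := fun _ : Fin 4 => ℝ) i) V :=
    fun i => (ContinuousLinearMap.proj (R := ℝ) (φ := fun _ : Fin 4 => ℝ) i).hasFDerivAt
  have h1 : HasFDerivAt (fun v : Fin 4 → ℝ => depth₁ γ δ v) _ V :=
    (((hp 0).const_mul (rho γ δ)).const_add 1).sub (hp 1)
  have h2 : HasFDerivAt (fun v : Fin 4 → ℝ => depth₂ δ v) _ V := (hp 1).const_add δ⁻¹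
  have hH := h1.add h2
  have hu1 := ((hp 3).sub (h2.mul (hp 2))).mul
    ((hasDerivAt_inv (mul_ne_zero hγ hV)).comp_hasFDerivAt V (hH.const_mul γ))
  have hu2 := ((hp 3).add (h1.mul (hp 2))).mul
    ((hasDerivAt_inv hV).comp_hasFDerivAt V hH)
  rw [hasFDerivAt_pi']
  intro i
  fin_cases i
  · refine (hp 0).congr_fderiv ?_
    ext w
    simp [jacF, dotProduct, Fin.sum_univ_four]
  · refine (hp 1).congr_fderiv ?_
    ext w
    simp [jacF, dotProduct, Fin.sum_univ_four]
  · refine hu1.congr_fderiv ?_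
    ext w
    simp [jacF, dotProduct, Fin.sum_univ_four]
    field_simp
    ring
  · refine hu2.congr_fderiv ?_
    ext w
    simp [jacF, dotProduct, Fin.sum_univ_four]
    field_simp
    ring

/-- The constant matrix `L_r`. -/
def matL (γ δ : ℝ) : Matrix (Fin 4) (Fin 4) ℝ :=
  !![0, 0, (γ - 1) / (γ * (δ + 1)), (γ + δ) / (γ * (δ + 1));
     0, 0, rho γ δ / (1 + δ), rho γ δ / (1 + δ);
     0, rho γ δ * (γ + δ), 0, 0;
     γ * (1 + δ⁻¹), rho γ δ * ((δ + γ) / δ), 0, 0]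

/-- The nonlinear part `B[V]`, determined by `r⁻¹ L_r + B[V] = (dF[V])⁻¹ A[F(V)] dF[V]`. -/
def matB (γ δ : ℝ) (V : Fin 4 → ℝ) : Matrix (Fin 4) (Fin 4) ℝ :=
  (jacF γ δ V)⁻¹ * matA γ δ (chgF γ δ V) * jacF γ δ V - (rho γ δ)⁻¹ • matL γ δ

/-- The hyperbolicity condition on `U = (ζ₁, ζ₂, u₁, u₂)`, with constant `h₀`: everywhere on `ℝ`,
`h₁ ≥ h₀` and `h₂ - |u₂ - u₁|² / (γ + δ) ≥ h₀`. -/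
def IsHyperbolic (γ δ h₀ : ℝ) (U : ℝ → Fin 4 → ℝ) : Prop :=
  ∀ x, h₀ ≤ depth₁ γ δ (U x) ∧ h₀ ≤ depth₂ δ (U x) - |U x 3 - U x 2| ^ 2 / (γ + δ)

/-- The space derivative, component by component. -/
def dx (U : ℝ → Fin 4 → ℝ) : ℝ → Fin 4 → ℝ := fun x i => deriv (fun y => U y i) x

/-- `W` is a strong solution on `[0,T]`, in `C([0,T]; X^s) ∩ C¹([0,T]; X^{s-1})`, of
`∂ₜW + (r⁻¹ L_r + B[V]) ∂ₓW = R`. Each `W t` is the continuous representative of its class; when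
`s > 3/2` it is thus of class `C¹`, so that `dx (W t)` is its derivative. -/
def IsStrongSolution (γ δ s T : ℝ) (V W R : ℝ → ℝ → Fin 4 → ℝ) : Prop :=
  (∀ t ∈ Set.Icc 0 T, Continuous (W t)) ∧
  IsContinuousInXs γ s T W ∧
  ∃ W' : ℝ → ℝ → Fin 4 → ℝ,
    IsContinuousInXs γ (s - 1) T W' ∧
    (∀ t ∈ Set.Icc 0 T, HasTimeDerivAt γ (s - 1) T W (W' t) t) ∧
    ∀ t ∈ Set.Icc 0 T, ∀ᵐ x : ℝ,
      W' t x + ((rho γ δ)⁻¹ • matL γ δ + matB γ δ (V t x)) *ᵥ dx (W t) x = R t x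

end TwoLayer

end

/-! The estimate is an energy estimate with a symmetrizer that stays bounded and coercive as `r →
0`, and for which the terms of size `1/r` have constant coefficients. The system matrix is `dF⁻¹ A
dF`. The matrix `matS` symmetrizes `A`: the `1/r` part of `S A` is `(γ/r) (e₁ ⊗ w + w ⊗ e₁)` with `w
= (0, u₂ - u₁, h₁, h₂)`. Since `m = γ h₁ u₁ + h₂ u₂` and `1 - γ = r² (γ + δ)`, one finds `w ⬝ dF =
e₄ + r p` with `p` bounded (`vecW_vecMul_jacF`). Hence with `T = dFᵀ S dF` both the system and its
product with `T` are `r⁻¹` times a constant matrix plus a part bounded uniformly in `r`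
(`sysM_eq_sing_add_reg`, `symT_mul_sysM`). A constant matrix commutes with `Λ^s`, and a constant
symmetric one contributes nothing after integration by parts, so `1/r` never enters the estimate.
Coercivity of `T` is the hyperbolicity condition, by completing a square (`exists_symT_coercive`).

Uniformity in the parameters is tracked by `Tame`: such functions of `V` are bounded and Lipschitz,
and differ from their value at `0` by an `H^s` function of norm at most a constant times
`|V|_{H^s}`. Commutators and `x`-derivatives see only this difference, which produces the factor `M`
in the exponent. The analytic inputs are commutator estimates, proved by Young's inequality in
Fourier variables; the algebra property and the stability of `H^s` under `f ↦ f / (c + f)` follow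
from them.

The solution is differentiable in time only in `X^{s-1}`, so `Λ^s` is replaced by the bounded
operators `Lam s N`, with commutator bounds independent of `N`. These bounds involve the full `H^s`
norm of `W`; by compactness of `[0,T]` it exceeds the truncated one by at most `ε`, uniformly in
time, once `N` is large (`IsContinuousInXs.eventually_hsBdd`). The coefficients are only Lipschitz
in time, so the energy is Lipschitz and its derivative is estimated almost everywhere. A Gronwall
argument for the regularized square root of the energy (`sqrt_le_of_ae_deriv_le`) and `ε → 0`
conclude. -/

noncomputable section

namespace TwoLayer

/-! ### The Japanese bracket and truncated Bessel weights -/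

/-- The symbol of `Λ = (1 - ∂ₓ²)^{1/2}`. -/
def jb (ξ : ℝ) : ℝ := Real.sqrt (1 + (2 * Real.pi * ξ) ^ 2)

theorem one_le_jb (ξ : ℝ) : 1 ≤ jb ξ := by
  rw [jb, Real.one_le_sqrt]
  nlinarith [sq_nonneg (2 * Real.pi * ξ)]

theorem jb_pos (ξ : ℝ) : 0 < jb ξ := lt_of_lt_of_le one_pos (one_le_jb ξ)

theorem abs_le_jb (ξ : ℝ) : |2 * Real.pi * ξ| ≤ jb ξ :=
  Real.abs_le_sqrt (by linarith)

theorem continuous_jb : Continuous jb := by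
  unfold jb
  fun_prop

theorem jb_rpow (s ξ : ℝ) : (1 + (2 * Real.pi * ξ) ^ 2) ^ (s / 2) = jb ξ ^ s := by
  rw [jb, Real.sqrt_eq_rpow, ← Real.rpow_mul (by positivity)]
  congr 1
  ring

/-- Difference of squares: `jb ξ + jb η` dominates `|2πξ + 2πη|`, so it can be divided out. -/
theorem abs_jb_sub_le (ξ η : ℝ) : |jb ξ - jb η| ≤ |2 * Real.pi * (ξ - η)| := by
  have h1 : jb ξ ^ 2 = 1 + (2 * Real.pi * ξ) ^ 2 := Real.sq_sqrt (by positivity)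
  have h2 : jb η ^ 2 = 1 + (2 * Real.pi * η) ^ 2 := Real.sq_sqrt (by positivity)
  have hp : 0 < jb ξ + jb η := add_pos (jb_pos _) (jb_pos _)
  have h3 : |jb ξ - jb η| * (jb ξ + jb η)
      = |2 * Real.pi * (ξ - η)| * |2 * Real.pi * ξ + 2 * Real.pi * η| := by
    rw [← abs_of_pos hp, ← abs_mul, ← abs_mul]
    congr 1
    nlinarith
  have h4 : |2 * Real.pi * ξ + 2 * Real.pi * η| ≤ jb ξ + jb η :=
    (abs_add_le _ _).trans (add_le_add (abs_le_jb _) (abs_le_jb _))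
  by_contra! h
  have := mul_lt_mul_of_pos_right h hp
  rw [h3] at this
  exact absurd this (not_lt.2 (mul_le_mul_of_nonneg_left h4 (abs_nonneg _)))

theorem abs_jb_sub_le_jb (ξ η : ℝ) : |jb ξ - jb η| ≤ jb (ξ - η) :=
  (abs_jb_sub_le ξ η).trans (abs_le_jb _)

/-- The truncated weight `min(⟨ξ⟩, N)^σ`. -/
def lam (σ : ℝ) (N : ℕ) (ξ : ℝ) : ℝ := min (jb ξ) (N + 1) ^ σ

/-- The cap is `N + 1` rather than `N` so that this holds for `N = 0` too, which keeps every real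
power away from the base `0`. -/
theorem one_le_min_jb (N : ℕ) (ξ : ℝ) : 1 ≤ min (jb ξ) (N + 1) :=
  le_min (one_le_jb ξ) (by have := N.cast_nonneg (α := ℝ); linarith)

theorem continuous_lam (σ : ℝ) (N : ℕ) : Continuous (lam σ N) := by
  unfold lam
  refine Continuous.rpow_const (continuous_jb.min continuous_const) fun x => Or.inl ?_
  have := one_le_min_jb N x
  linarith

theorem lam_pos (σ : ℝ) (N : ℕ) (ξ : ℝ) : 0 < lam σ N ξ :=
  Real.rpow_pos_of_pos (lt_of_lt_of_le one_pos (one_le_min_jb N ξ)) _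

theorem lam_le_jb {σ : ℝ} (hσ : 0 ≤ σ) (N : ℕ) (ξ : ℝ) : lam σ N ξ ≤ jb ξ ^ σ :=
  Real.rpow_le_rpow (by have := one_le_min_jb N ξ; linarith) (min_le_left _ _) hσ

theorem lam_le {σ : ℝ} (hσ : 0 ≤ σ) (N : ℕ) (ξ : ℝ) : lam σ N ξ ≤ (N + 1 : ℝ) ^ σ :=
  Real.rpow_le_rpow (by have := one_le_min_jb N ξ; linarith) (min_le_right _ _) hσ

theorem lam_mono {σ : ℝ} (hσ : 0 ≤ σ) {N N' : ℕ} (h : N ≤ N') (ξ : ℝ) :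
    lam σ N ξ ≤ lam σ N' ξ :=
  Real.rpow_le_rpow (by have := one_le_min_jb N ξ; linarith)
    (min_le_min le_rfl (by exact_mod_cast Nat.add_le_add_right h 1)) hσ

theorem lam_eventually_eq (σ : ℝ) (ξ : ℝ) : ∀ᶠ N : ℕ in atTop, lam σ N ξ = jb ξ ^ σ := by
  filter_upwards [eventually_ge_atTop ⌈jb ξ⌉₊] with N hN
  rw [lam, min_eq_left]
  have := Nat.ceil_le.1 hN
  linarith

/-- Capping is 1-Lipschitz. This is why all commutator bounds below are uniform in `N`. -/
theorem abs_min_jb_sub_le (N : ℕ) (ξ η : ℝ) :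
    |min (jb ξ) (N + 1) - min (jb η) (N + 1)| ≤ jb (ξ - η) := by
  refine (abs_min_sub_min_le_max _ _ _ _).trans ?_
  simp only [sub_self, abs_zero]
  exact max_le (abs_jb_sub_le_jb _ _) (jb_pos _).le

theorem abs_lam_one_sub_le (N : ℕ) (ξ η : ℝ) : |lam 1 N ξ - lam 1 N η| ≤ jb (ξ - η) := by
  simp only [lam, Real.rpow_one]
  exact abs_min_jb_sub_le N ξ η

theorem abs_rpow_sub_rpow_le {p a b c : ℝ} (hp : 1 ≤ p) (ha : 0 < a) (hb : 0 < b) (hac : a ≤ c)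
    (hbc : b ≤ c) : |a ^ p - b ^ p| ≤ p * c ^ (p - 1) * |a - b| := by
  have := Convex.norm_image_sub_le_of_norm_hasDerivWithin_le (f := fun x : ℝ => x ^ p)
    (f' := fun x => p * x ^ (p - 1)) (C := p * c ^ (p - 1)) (s := Set.Ioc 0 c) (x := b) (y := a)
    (fun x hx => (Real.hasDerivAt_rpow_const (Or.inl hx.1.ne')).hasDerivWithinAt)
    (fun x hx => by
      rw [Real.norm_of_nonneg (mul_nonneg (by linarith) (Real.rpow_nonneg hx.1.le _))]
      exact mul_le_mul_of_nonneg_left (Real.rpow_le_rpow hx.1.le hx.2 (by linarith)) (by linarith))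
    (convex_Ioc 0 c) ⟨hb, hbc⟩ ⟨ha, hac⟩
  simpa using this

theorem add_rpow_le_two_rpow {x y p : ℝ} (hx : 0 ≤ x) (hy : 0 ≤ y) (hp : 0 ≤ p) :
    (x + y) ^ p ≤ 2 ^ p * (x ^ p + y ^ p) := by
  have h1 : (x + y) ^ p ≤ (2 * max x y) ^ p :=
    Real.rpow_le_rpow (by positivity) (by linarith [le_max_left x y, le_max_right x y]) hp
  rw [Real.mul_rpow (by norm_num) (le_max_of_le_left hx)] at h1
  refine h1.trans (mul_le_mul_of_nonneg_left ?_ (by positivity))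
  rcases max_choice x y with h | h <;> rw [h]
  · linarith [Real.rpow_nonneg hy p]
  · linarith [Real.rpow_nonneg hx p]

/-- Mean value theorem for `x ↦ x ^ σ`, both bases being at most `jb (ξ - η) + jb η`. In a
commutator, `ξ - η` is the frequency of the coefficient: the first term puts one derivative on it,
the second puts all of them. -/
theorem abs_lam_sub_le {σ : ℝ} (hσ : 1 ≤ σ) (N : ℕ) (ξ η : ℝ) :
    |lam σ N ξ - lam σ N η| ≤
      σ * 2 ^ (σ - 1) * (jb (ξ - η) * jb η ^ (σ - 1) + jb (ξ - η) ^ σ) := by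
  have h1 := one_le_min_jb N ξ
  have h2 := one_le_min_jb N η
  have h3 := abs_rpow_sub_rpow_le (a := min (jb ξ) (N + 1)) (b := min (jb η) (N + 1))
    (c := jb (ξ - η) + jb η) hσ (by linarith) (by linarith)
    ((min_le_left _ _).trans (by linarith [abs_le.1 (abs_jb_sub_le_jb ξ η)]))
    ((min_le_left _ _).trans (by linarith [jb_pos (ξ - η)]))
  have h4 := add_rpow_le_two_rpow (jb_pos (ξ - η)).le (jb_pos η).le (sub_nonneg.2 hσ)
  have h5 : jb (ξ - η) ^ σ = jb (ξ - η) ^ (σ - 1) * jb (ξ - η) := by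
    rw [Real.rpow_sub_one (jb_pos _).ne', div_mul_cancel₀ _ (jb_pos _).ne']
  refine h3.trans ?_
  refine (mul_le_mul (mul_le_mul_of_nonneg_left h4 (by linarith)) (abs_min_jb_sub_le N ξ η)
    (abs_nonneg _) (by have := jb_pos (ξ - η); have := jb_pos η; positivity)).trans (le_of_eq ?_)
  rw [h5]
  ring

/-! ### Multiplication operators on `L²` -/

/-- The space `L²(ℝ; ℂ)`. -/
abbrev L2 : Type := Lp ℂ 2 (volume : Measure ℝ)

/-- A bounded measurable function. -/
structure IsBddMeas (b : ℝ → ℝ) : Prop where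
  meas : AEStronglyMeasurable b volume
  bdd : ∃ C, ∀ x, |b x| ≤ C

theorem IsBddMeas.memLp {b : ℝ → ℝ} (hb : IsBddMeas b) (f : L2) :
    MemLp (fun x => (b x : ℂ) * f x) 2 (volume : Measure ℝ) := by
  obtain ⟨C, hC⟩ := hb.bdd
  refine (Lp.memLp f).of_le_mul (c := C)
    ((Complex.continuous_ofReal.comp_aestronglyMeasurable hb.meas).mul (Lp.memLp f).1)
    (Eventually.of_forall fun x => ?_)
  rw [norm_mul, Complex.norm_real]
  exact mul_le_mul_of_nonneg_right (hC x) (norm_nonneg _)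

theorem norm_le_of_ae_le {f g : L2} {C : ℝ} (h : ∀ᵐ x, ‖f x‖ ≤ C * ‖g x‖) :
    ‖f‖ ≤ C * ‖g‖ := Lp.norm_le_mul_norm_of_ae_le_mul h

theorem norm_toLp_mul_le {b : ℝ → ℝ} (hb : IsBddMeas b) {C : ℝ} (hC : ∀ x, |b x| ≤ C) (f : L2) :
    ‖(hb.memLp f).toLp _‖ ≤ C * ‖f‖ := by
  refine norm_le_of_ae_le ?_
  filter_upwards [(hb.memLp f).coeFn_toLp] with x hx
  rw [hx, norm_mul, Complex.norm_real]
  exact mul_le_mul_of_nonneg_right (hC x) (norm_nonneg _)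

open Classical in
/-- Multiplication by a bounded measurable real function, as an operator on `L²`. -/
def mulL (b : ℝ → ℝ) : L2 →L[ℂ] L2 :=
  if hb : IsBddMeas b then
    LinearMap.mkContinuous
      { toFun := fun f => (hb.memLp f).toLp _
        map_add' := fun f g => by
          ext1
          filter_upwards [(hb.memLp (f + g)).coeFn_toLp, (hb.memLp f).coeFn_toLp,
            (hb.memLp g).coeFn_toLp, Lp.coeFn_add f g,
            Lp.coeFn_add ((hb.memLp f).toLp _) ((hb.memLp g).toLp _)] with x h1 h2 h3 h4 h5
          rw [h1, h5, Pi.add_apply, h2, h3, h4, Pi.add_apply, mul_add]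
        map_smul' := fun c f => by
          ext1
          filter_upwards [(hb.memLp (c • f)).coeFn_toLp, (hb.memLp f).coeFn_toLp,
            Lp.coeFn_smul c f, Lp.coeFn_smul c ((hb.memLp f).toLp _)] with x h1 h2 h3 h4
          simp only [RingHom.id_apply]
          rw [h1, h4, Pi.smul_apply, h2, h3, Pi.smul_apply, smul_eq_mul, smul_eq_mul]
          ring }
      hb.bdd.choose (fun f => norm_toLp_mul_le hb hb.bdd.choose_spec f)
  else 0

theorem coeFn_mulL {b : ℝ → ℝ} (hb : IsBddMeas b) (f : L2) :
    mulL b f =ᵐ[volume] fun x => (b x : ℂ) * f x := by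
  rw [mulL, dif_pos hb]
  exact (hb.memLp f).coeFn_toLp

theorem norm_mulL_apply_le {b : ℝ → ℝ} (hb : IsBddMeas b) {C : ℝ} (hC : ∀ x, |b x| ≤ C) (f : L2) :
    ‖mulL b f‖ ≤ C * ‖f‖ := by
  rw [mulL, dif_pos hb]
  exact norm_toLp_mul_le hb hC f

theorem isBddMeas_lam {σ : ℝ} (hσ : 0 ≤ σ) (N : ℕ) : IsBddMeas (lam σ N) :=
  ⟨(continuous_lam σ N).aestronglyMeasurable, _, fun x => by
    rw [abs_of_pos (lam_pos σ N x)]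
    exact lam_le hσ N x⟩

theorem IsBddMeas.of_continuous {b : ℝ → ℝ} (hb : Continuous b) {C : ℝ} (h : ∀ x, |b x| ≤ C) :
    IsBddMeas b := ⟨hb.aestronglyMeasurable, C, h⟩

theorem IsBddMeas.sub {a b : ℝ → ℝ} (ha : IsBddMeas a) (hb : IsBddMeas b) :
    IsBddMeas (fun x => a x - b x) := by
  obtain ⟨A, hA⟩ := ha.bdd
  obtain ⟨B, hB⟩ := hb.bdd
  exact ⟨ha.meas.sub hb.meas, A + B, fun x => (abs_sub _ _).trans (add_le_add (hA x) (hB x))⟩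

theorem mulL_sub {a b : ℝ → ℝ} (ha : IsBddMeas a) (hb : IsBddMeas b) (f : L2) :
    mulL (fun x => a x - b x) f = mulL a f - mulL b f := by
  ext1
  filter_upwards [coeFn_mulL ha f, coeFn_mulL hb f, coeFn_mulL (ha.sub hb) f,
    Lp.coeFn_sub (mulL a f) (mulL b f)] with x h1 h2 h3 h4
  rw [h3, h4, Pi.sub_apply, h1, h2]
  push_cast
  ring

theorem inner_mulL_left {b : ℝ → ℝ} (hb : IsBddMeas b) (f g : L2) :
    inner ℂ (mulL b f) g = inner ℂ f (mulL b g) := by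
  rw [L2.inner_def, L2.inner_def]
  refine integral_congr_ae ?_
  filter_upwards [coeFn_mulL hb f, coeFn_mulL hb g] with x h1 h2
  rw [h1, h2]
  simp only [RCLike.inner_apply, map_mul, Complex.conj_ofReal]
  ring

/-- The truncated Bessel potential `min(Λ, N)^σ` on `L²`. -/
def Lam (σ : ℝ) (N : ℕ) : L2 →L[ℂ] L2 :=
  ((Lp.fourierTransformₗᵢ ℝ ℂ).symm.toContinuousLinearEquiv : L2 →L[ℂ] L2) ∘L mulL (lam σ N) ∘L
    ((Lp.fourierTransformₗᵢ ℝ ℂ).toContinuousLinearEquiv : L2 →L[ℂ] L2)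

theorem fourier_Lam (σ : ℝ) (N : ℕ) (f : L2) : 𝓕 (Lam σ N f) = mulL (lam σ N) (𝓕 f) :=
  (Lp.fourierTransformₗᵢ ℝ ℂ).apply_symm_apply _

theorem norm_Lam (σ : ℝ) (N : ℕ) (f : L2) : ‖Lam σ N f‖ = ‖mulL (lam σ N) (𝓕 f)‖ := by
  rw [← fourier_Lam, Lp.norm_fourier_eq]

/-! ### Sobolev norms of elements of `L²` -/

/-- The `H^σ` norm of an element of `L²`. -/
def hsE (σ : ℝ) (f : L2) : ℝ≥0∞ :=
  eLpNorm (fun ξ : ℝ => ((jb ξ ^ σ : ℝ) : ℂ) * (𝓕 f : L2) ξ) 2 (volume : Measure ℝ)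

open Classical in
/-- The class in `L²` of a real function, zero if it is not square integrable. -/
def toL2 (f : ℝ → ℝ) : L2 :=
  if hf : MemLp (fun x => (f x : ℂ)) 2 (volume : Measure ℝ) then hf.toLp _ else 0

theorem memLp_of_hsNorm_lt_top {s : ℝ} {f : ℝ → ℝ} (h : hsNorm s f < ∞) :
    MemLp (fun x => (f x : ℂ)) 2 (volume : Measure ℝ) := by
  by_contra hf
  rw [hsNorm, dif_neg hf] at h
  exact lt_irrefl _ h

theorem hsNorm_eq {s : ℝ} {f : ℝ → ℝ} (hf : MemLp (fun x => (f x : ℂ)) 2 (volume : Measure ℝ)) :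
    hsNorm s f = hsE s (toL2 f) := by
  rw [hsNorm, dif_pos hf, toL2, dif_pos hf, hsE]
  simp only [jb_rpow]

/-- No integrability is required, since the right side is infinite outside `L²`. This lets the
source term be handled without any regularity assumption. -/
theorem hsE_toL2_le (s : ℝ) (f : ℝ → ℝ) : hsE s (toL2 f) ≤ hsNorm s f := by
  by_cases hf : MemLp (fun x => (f x : ℂ)) 2 (volume : Measure ℝ)
  · rw [hsNorm_eq hf]
  · rw [hsNorm, dif_neg hf]
    exact le_top

theorem coeFn_toL2 {f : ℝ → ℝ} (hf : MemLp (fun x => (f x : ℂ)) 2 (volume : Measure ℝ)) :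
    toL2 f =ᵐ[volume] fun x => (f x : ℂ) := by
  rw [toL2, dif_pos hf]
  exact hf.coeFn_toLp

theorem hsE_mono {σ τ : ℝ} (h : σ ≤ τ) (f : L2) : hsE σ f ≤ hsE τ f := by
  refine eLpNorm_mono fun ξ => ?_
  rw [norm_mul, norm_mul, Complex.norm_real, Complex.norm_real,
    Real.norm_of_nonneg (Real.rpow_nonneg (jb_pos _).le _),
    Real.norm_of_nonneg (Real.rpow_nonneg (jb_pos _).le _)]
  exact mul_le_mul_of_nonneg_right (Real.rpow_le_rpow_of_exponent_le (one_le_jb ξ) h)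
    (norm_nonneg _)

theorem enorm_eq_hsE_zero (f : L2) : ‖f‖ₑ = hsE 0 f := by
  rw [← Lp.norm_fourier_eq f |> fun h => (show ‖𝓕 f‖ₑ = ‖f‖ₑ by
    rw [← ofReal_norm, ← ofReal_norm, h]), Lp.enorm_def, hsE]
  simp

theorem enorm_Lam_le {σ : ℝ} (hσ : 0 ≤ σ) (N : ℕ) (f : L2) : ‖Lam σ N f‖ₑ ≤ hsE σ f := by
  rw [← ofReal_norm, norm_Lam, ofReal_norm, Lp.enorm_def, hsE]
  refine eLpNorm_mono_ae ?_
  filter_upwards [coeFn_mulL (isBddMeas_lam hσ N) (𝓕 f)] with ξ h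
  rw [h, norm_mul, norm_mul, Complex.norm_real, Complex.norm_real,
    Real.norm_of_nonneg (lam_pos _ _ _).le,
    Real.norm_of_nonneg (Real.rpow_nonneg (jb_pos _).le _)]
  exact mul_le_mul_of_nonneg_right (lam_le_jb hσ N ξ) (norm_nonneg _)

/-- Fatou's lemma: at each frequency the truncated weight is eventually the full one. Bounds uniform
in `N` for bounded operators thus prove regularity. -/
theorem hsE_le_of_forall {σ : ℝ} (hσ : 0 ≤ σ) {f : L2} {K : ℝ≥0∞}
    (h : ∀ N, ‖Lam σ N f‖ₑ ≤ K) : hsE σ f ≤ K := by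
  have h1 : ∀ N, eLpNorm (fun ξ => ((lam σ N ξ : ℝ) : ℂ) * (𝓕 f : L2) ξ) 2 volume ≤ K := by
    intro N
    refine le_trans (le_of_eq ?_) (h N)
    rw [← ofReal_norm, norm_Lam, ofReal_norm, Lp.enorm_def]
    exact eLpNorm_congr_ae (coeFn_mulL (isBddMeas_lam hσ N) (𝓕 f)).symm
  refine (Lp.eLpNorm_lim_le_liminf_eLpNorm (p := 2) (f := fun N ξ =>
    ((lam σ N ξ : ℝ) : ℂ) * (𝓕 f : L2) ξ) (fun N => ?_) _ ?_).trans ?_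
  · exact (Complex.continuous_ofReal.comp (continuous_lam σ N)).aestronglyMeasurable.mul
      (Lp.memLp _).1
  · refine Eventually.of_forall fun ξ => ?_
    refine tendsto_const_nhds.congr' ?_
    filter_upwards [lam_eventually_eq σ ξ] with N hN
    rw [hN]
  · exact (liminf_le_liminf (Eventually.of_forall h1)).trans (by simp)

/-! ### Fourier integrals of integrable elements of `L²` -/

theorem continuous_fourierInv {Φ : ℝ → ℂ} (hΦ : Integrable Φ) : Continuous (𝓕⁻ Φ) := by
  rw [Real.fourierInv_eq_fourier_comp_neg]
  exact VectorFourier.fourierIntegral_continuous Real.continuous_fourierChar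
    (by exact continuous_inner) hΦ.comp_neg

theorem norm_fourierInv_le (Φ : ℝ → ℂ) (x : ℝ) : ‖𝓕⁻ Φ x‖ ≤ ∫ ξ, ‖Φ ξ‖ := by
  rw [Real.fourierInv_eq_fourier_neg]
  exact VectorFourier.norm_fourierIntegral_le_integral_norm _ _ _ _ _

theorem integral_fourierInv_smul_eq {f g : ℝ → ℂ} (hf : Integrable f) (hg : Integrable g) :
    ∫ ξ, 𝓕⁻ f ξ • g ξ = ∫ x, f x • 𝓕⁻ g x := by
  have h : ∫ ξ, 𝓕 (fun x => f (-x)) ξ • g ξ = ∫ x, f (-x) • 𝓕 g x := by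
    have := VectorFourier.integral_fourierIntegral_smul_eq_flip (L := innerₗ ℝ)
      Real.continuous_fourierChar continuous_inner hf.comp_neg hg
    rwa [flip_innerₗ] at this
  rw [Real.fourierInv_eq_fourier_comp_neg f, h,
    ← integral_neg_eq_self (fun x => f x • 𝓕⁻ g x)]
  simp only [Real.fourierInv_eq_fourier_neg, neg_neg]

/-- The `L²` transform and the Fourier integral are compared as distributions: both are tested
against smooth compactly supported functions, and the inverse transform is moved onto the test
function. -/
theorem fourierInv_ae_eq {Φ : L2} (hΦ : Integrable (Φ : ℝ → ℂ)) :
    ((𝓕⁻ Φ : L2) : ℝ → ℂ) =ᵐ[volume] 𝓕⁻ (Φ : ℝ → ℂ) := by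
  refine ae_eq_of_integral_contDiff_smul_eq
    ((Lp.memLp (𝓕⁻ Φ : L2)).locallyIntegrable (by norm_num))
    (continuous_fourierInv hΦ).locallyIntegrable fun g hg hgs => ?_
  have hgs' : HasCompactSupport (fun x => (g x : ℂ)) := hgs.comp_left Complex.ofReal_zero
  have hgd : ContDiff ℝ (⊤ : ℕ∞) (fun x => (g x : ℂ)) := Complex.ofRealCLM.contDiff.comp hg
  let G := hgs'.toSchwartzMap hgd
  have hG : ∀ x, G x = (g x : ℂ) := fun x => rfl
  have h1 := congrArg (fun T => T G) (Lp.fourierInv_toTemperedDistribution_eq Φ)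
  simp only [TemperedDistribution.fourierInv_apply, Lp.toTemperedDistribution_apply] at h1
  have h2 : ∀ ξ, (𝓕⁻ G : SchwartzMap ℝ ℂ) ξ = 𝓕⁻ (fun x => (g x : ℂ)) ξ := fun ξ => by
    rw [SchwartzMap.fourierInv_coe]
    rfl
  simp only [h2, hG] at h1
  rw [integral_fourierInv_smul_eq (by exact G.integrable) hΦ] at h1
  simp only [smul_eq_mul, Complex.real_smul] at h1 ⊢
  exact h1.symm

theorem ae_eq_fourierInv_fourier {f : L2} (hf : Integrable ((𝓕 f : L2) : ℝ → ℂ)) :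
    (f : ℝ → ℂ) =ᵐ[volume] 𝓕⁻ ((𝓕 f : L2) : ℝ → ℂ) := by
  have := fourierInv_ae_eq hf
  rwa [FourierTransform.fourierInv_fourier_eq] at this

/-- The `L¹` norm of `⟨ξ⟩^τ 𝓕f`. -/
def wiener (τ : ℝ) (f : L2) : ℝ≥0∞ :=
  ∫⁻ ξ, ENNReal.ofReal (jb ξ ^ τ) * ‖(𝓕 f : L2) ξ‖ₑ

theorem measurable_Lp (f : L2) : Measurable (f : ℝ → ℂ) := (Lp.stronglyMeasurable f).measurable

theorem measurable_ofReal_jb (τ : ℝ) : Measurable fun ξ => ENNReal.ofReal (jb ξ ^ τ) :=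
  ENNReal.measurable_ofReal.comp (continuous_jb.measurable.pow_const τ)

theorem wiener_mono {σ τ : ℝ} (h : σ ≤ τ) (f : L2) : wiener σ f ≤ wiener τ f :=
  lintegral_mono fun ξ => mul_le_mul_left
    (ENNReal.ofReal_le_ofReal (Real.rpow_le_rpow_of_exponent_le (one_le_jb ξ) h)) _

theorem wiener_zero (f : L2) : wiener 0 f = ∫⁻ ξ, ‖(𝓕 f : L2) ξ‖ₑ := by
  simp [wiener]

theorem integrable_of_wiener {f : L2} (h : wiener 0 f < ∞) :
    Integrable ((𝓕 f : L2) : ℝ → ℂ) :=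
  ⟨(Lp.memLp _).1, by rwa [wiener_zero] at h⟩

theorem hsE_sq (σ : ℝ) (f : L2) :
    hsE σ f ^ 2 = ∫⁻ ξ, (ENNReal.ofReal (jb ξ ^ σ) * ‖(𝓕 f : L2) ξ‖ₑ) ^ 2 := by
  rw [hsE, eLpNorm_eq_lintegral_rpow_enorm_toReal (by norm_num) (by norm_num)]
  simp only [ENNReal.toReal_ofNat, enorm_mul]
  rw [← ENNReal.rpow_natCast, ← ENNReal.rpow_mul]
  norm_num
  refine lintegral_congr fun ξ => ?_
  congr 2
  rw [← ofReal_norm, Complex.norm_real, Real.norm_of_nonneg (Real.rpow_nonneg (jb_pos _).le _)]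

theorem enorm_sq_eq (f : L2) : ‖f‖ₑ ^ 2 = ∫⁻ ξ, ‖f ξ‖ₑ ^ 2 := by
  rw [Lp.enorm_def, eLpNorm_eq_lintegral_rpow_enorm_toReal (by norm_num) (by norm_num)]
  simp only [ENNReal.toReal_ofNat]
  rw [← ENNReal.rpow_natCast, ← ENNReal.rpow_mul]
  norm_num

theorem enorm_fourier (f : L2) : ‖(𝓕 f : L2)‖ₑ = ‖f‖ₑ := by
  rw [← ofReal_norm, Lp.norm_fourier_eq, ofReal_norm]

/-- The Cauchy--Schwarz inequality for lower integrals. -/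
theorem lintegral_mul_sq_le {a b : ℝ → ℝ≥0∞} (ha : AEMeasurable a) (hb : AEMeasurable b) :
    (∫⁻ x, a x * b x) ^ 2 ≤ (∫⁻ x, a x ^ 2) * ∫⁻ x, b x ^ 2 := by
  have h := ENNReal.lintegral_mul_le_Lp_mul_Lq volume Real.HolderConjugate.two_two ha hb
  have h2 := pow_le_pow_left₀ zero_le h 2
  rw [mul_pow, ← ENNReal.rpow_natCast, ← ENNReal.rpow_natCast, ← ENNReal.rpow_natCast,
    ← ENNReal.rpow_mul, ← ENNReal.rpow_mul] at h2
  norm_num at h2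
  exact h2

theorem lintegral_jb_rpow_lt_top {p : ℝ} (hp : 1 / 2 < p) :
    ∫⁻ ξ, ENNReal.ofReal (jb ξ ^ (-p)) ^ 2 < ∞ := by
  have h := (integrable_rpow_neg_one_add_norm_sq (E := ℝ) (μ := volume) (r := 2 * p)
    (by simp; linarith)).2
  refine lt_of_le_of_lt (lintegral_mono fun ξ => ?_) h
  rw [← ofReal_norm, ← ENNReal.ofReal_pow (Real.rpow_nonneg (jb_pos _).le _)]
  refine ENNReal.ofReal_le_ofReal ?_
  beta_reduce
  rw [Real.norm_of_nonneg (by positivity), ← Real.rpow_natCast, ← Real.rpow_mul (jb_pos _).le,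
    ← jb_rpow, Real.norm_eq_abs, sq_abs]
  have : (-p * (2 : ℕ)) / 2 = -(2 * p) / 2 := by push_cast; ring
  rw [this]
  refine Real.rpow_le_rpow_of_nonpos (by positivity) ?_ (by linarith)
  -- As `(2π)² ≥ 1`, the bracket `jb` dominates `(1 + ξ²)^{1/2}`, whose power `-2p` is integrable
  -- because `2p > 1`.
  nlinarith [Real.pi_gt_three, sq_nonneg ξ, mul_nonneg (sq_nonneg ξ) (sub_nonneg.2
    (by nlinarith [Real.pi_gt_three] : (1 : ℝ) ≤ (2 * Real.pi) ^ 2))]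

/-- Sobolev embedding into the weighted Wiener algebra. -/
theorem exists_wiener_le {p : ℝ} (hp : 1 / 2 < p) :
    ∃ K : ℝ≥0, ∀ (τ : ℝ) (f : L2), wiener τ f ≤ K * hsE (τ + p) f := by
  set I := ∫⁻ ξ, ENNReal.ofReal (jb ξ ^ (-p)) ^ 2
  have hI : I ≠ ∞ := (lintegral_jb_rpow_lt_top hp).ne
  refine ⟨NNReal.sqrt I.toNNReal, fun τ f => ?_⟩
  -- Cauchy–Schwarz against `⟨ξ⟩^{-p}`, which is square integrable because `p > 1/2`.
  have h := lintegral_mul_sq_le (measurable_ofReal_jb (-p)).aemeasurable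
    ((measurable_ofReal_jb (τ + p)).mul (measurable_Lp (𝓕 f)).enorm).aemeasurable
  simp only [Pi.mul_apply] at h
  rw [← hsE_sq] at h
  have h1 : wiener τ f = ∫⁻ x, ENNReal.ofReal (jb x ^ (-p)) *
      (ENNReal.ofReal (jb x ^ (τ + p)) * ‖(𝓕 f : L2) x‖ₑ) := by
    refine lintegral_congr fun ξ => ?_
    rw [← mul_assoc, ← ENNReal.ofReal_mul (Real.rpow_nonneg (jb_pos _).le _),
      ← Real.rpow_add (jb_pos _)]
    congr 3
    ring
  rw [← h1] at h
  rw [← ENNReal.pow_le_pow_left_iff two_ne_zero, mul_pow]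
  refine h.trans (le_of_eq ?_)
  congr 1
  rw [← ENNReal.coe_pow, NNReal.sq_sqrt, ENNReal.coe_toNNReal hI]

/-- Young's inequality `L¹ * L² ⊂ L²`. -/
theorem lintegral_conv_sq_le {a b : ℝ → ℝ≥0∞} (ha : Measurable a) (hb : Measurable b) :
    ∫⁻ ξ, (∫⁻ η, a (ξ - η) * b η) ^ 2 ≤ (∫⁻ ξ, a ξ) ^ 2 * ∫⁻ ξ, b ξ ^ 2 := by
  have h1 : ∀ ξ, (∫⁻ η, a (ξ - η) * b η) ^ 2 ≤ (∫⁻ η, a η) * ∫⁻ η, a (ξ - η) * b η ^ 2 := by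
    intro ξ
    have ha' : Measurable fun η => a (ξ - η) := ha.comp (measurable_const.sub measurable_id)
    -- Cauchy–Schwarz with `a = a^{1/2} a^{1/2}`: one factor yields the mass of `a`, the other stays
    -- with `b`, and Tonelli finishes.
    have h := lintegral_mul_sq_le (a := fun η => a (ξ - η) ^ (1 / 2 : ℝ))
      (b := fun η => a (ξ - η) ^ (1 / 2 : ℝ) * b η) (ha'.pow_const _).aemeasurable
      ((ha'.pow_const _).mul hb).aemeasurable
    have hs : ∀ y : ℝ≥0∞, (y ^ (1 / 2 : ℝ)) ^ 2 = y := fun y => by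
      rw [← ENNReal.rpow_natCast, ← ENNReal.rpow_mul]
      norm_num
    simp only [mul_pow, hs, ← mul_assoc] at h
    simp only [← sq, hs] at h
    rwa [lintegral_sub_left_eq_self a ξ] at h
  refine (lintegral_mono h1).trans ?_
  have hm : Measurable fun q : ℝ × ℝ => a (q.1 - q.2) * b q.2 ^ 2 :=
    (ha.comp (measurable_fst.sub measurable_snd)).mul ((hb.comp measurable_snd).pow_const 2)
  rw [lintegral_const_mul _ hm.lintegral_prod_right', lintegral_lintegral_swap hm.aemeasurable,
    sq, mul_assoc]
  refine mul_le_mul_right (le_of_eq ?_) _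
  rw [← lintegral_const_mul _ (hb.pow_const 2)]
  refine lintegral_congr fun η => ?_
  have ha' : Measurable fun ξ => a (ξ - η) := ha.comp (measurable_id.sub measurable_const)
  exact (lintegral_mul_const (b η ^ 2) ha').trans (by rw [lintegral_sub_right_eq_self (μ := volume) a η])

theorem lintegral_conv_sq_le' {a b : ℝ → ℝ≥0∞} (ha : Measurable a) (hb : Measurable b) :
    ∫⁻ ξ, (∫⁻ η, a (ξ - η) * b η) ^ 2 ≤ (∫⁻ ξ, a ξ ^ 2) * (∫⁻ ξ, b ξ) ^ 2 := by
  rw [mul_comm]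
  refine le_trans (le_of_eq ?_) (lintegral_conv_sq_le hb ha)
  refine lintegral_congr fun ξ => ?_
  rw [← lintegral_sub_left_eq_self _ ξ]
  simp [mul_comm]

/-- The Fourier transform of a product is the convolution of the Fourier transforms. -/
theorem fourier_mulL_ae_eq {f : ℝ → ℝ} {F g : L2} (hf : IsBddMeas f)
    (hfF : ∀ᵐ x, F x = (f x : ℂ)) (hF : wiener 0 F < ∞) (hg : wiener 0 g < ∞) :
    ((𝓕 (mulL f g) : L2) : ℝ → ℂ) =ᵐ[volume]
      fun ξ => ∫ η, (𝓕 F : L2) (ξ - η) * (𝓕 g : L2) η := by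
  have hΦ := integrable_of_wiener hF
  have hΨ := integrable_of_wiener hg
  set Φ : ℝ → ℂ := ((𝓕 F : L2) : ℝ → ℂ)
  set Ψ : ℝ → ℂ := ((𝓕 g : L2) : ℝ → ℂ)
  set c : ℝ → ℂ := fun ξ => ∫ η, Φ (ξ - η) * Ψ η
  have hc : c = MeasureTheory.convolution Φ Ψ (ContinuousLinearMap.mul ℂ ℂ) volume := by
    ext ξ
    exact MeasureTheory.convolution_mul_swap.symm
  have hci : Integrable c := by
    rw [hc]
    exact hΦ.integrable_convolution _ hΨ
  -- By Young's inequality the convolution is itself in `L²`, so it may be compared with the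
  -- transform of the product after applying the inverse transform of `L²`.
  have hc2 : MemLp c 2 volume := by
    refine ⟨hci.1, ?_⟩
    rw [eLpNorm_eq_lintegral_rpow_enorm_toReal (by norm_num) (by norm_num)]
    refine ENNReal.rpow_lt_top_of_nonneg (by norm_num) (ne_of_lt ?_)
    simp only [ENNReal.toReal_ofNat, ENNReal.rpow_ofNat]
    refine lt_of_le_of_lt ((lintegral_mono fun ξ => pow_le_pow_left₀ zero_le
      (enorm_integral_le_lintegral_enorm _) 2).trans ?_)
      (ENNReal.mul_lt_top (b := ‖(𝓕 g : L2)‖ₑ ^ 2)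
        (ENNReal.pow_lt_top (n := 2) hΦ.2) (ENNReal.pow_lt_top enorm_lt_top))
    rw [enorm_sq_eq]
    simp only [enorm_mul]
    exact lintegral_conv_sq_le (measurable_Lp (𝓕 F)).enorm (measurable_Lp (𝓕 g)).enorm
  have hcL : ((hc2.toLp c : L2) : ℝ → ℂ) =ᵐ[volume] c := hc2.coeFn_toLp
  have h1 := fourierInv_ae_eq (Φ := hc2.toLp c) (hci.congr hcL.symm)
  have h2 : 𝓕⁻ ((hc2.toLp c : L2) : ℝ → ℂ) = 𝓕⁻ c := by
    ext x
    rw [Real.fourierInv_eq, Real.fourierInv_eq]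
    refine integral_congr_ae ?_
    filter_upwards [hcL] with ξ hξ
    rw [hξ]
  have h3 : ∀ x, 𝓕⁻ c x = 𝓕⁻ Φ x * 𝓕⁻ Ψ x := fun x => by
    simp only [Real.fourierInv_eq_fourier_neg]
    rw [hc]
    exact Real.fourier_mul_convolution_eq hΦ hΨ (-x)
  have h4 : (𝓕⁻ (hc2.toLp c : L2) : L2) = mulL f g := by
    ext1
    filter_upwards [h1, coeFn_mulL hf g, hfF, ae_eq_fourierInv_fourier hΦ,
      ae_eq_fourierInv_fourier hΨ] with x e1 e2 e3 e4 e5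
    rw [e1, h2, h3, e2, ← e3, e4, e5]
  rw [← h4, FourierTransform.fourier_fourierInv_eq]
  exact hcL

/-! ### Commutators with the truncated Bessel potential. -/

theorem fourier_sub_L2 (f g : L2) : (𝓕 (f - g) : L2) = 𝓕 f - 𝓕 g :=
  (Lp.fourierTransformₗᵢ ℝ ℂ).map_sub f g

/-- The commutator of the truncated Bessel potential with the multiplication by `f`. -/
def comm (σ : ℝ) (N : ℕ) (f : ℝ → ℝ) : L2 →L[ℂ] L2 :=
  (Lam σ N) ∘L mulL f - mulL f ∘L Lam σ N

theorem comm_apply (σ : ℝ) (N : ℕ) (f : ℝ → ℝ) (g : L2) :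
    comm σ N f g = Lam σ N (mulL f g) - mulL f (Lam σ N g) := rfl

theorem wiener_Lam_lt_top {σ : ℝ} (hσ : 0 ≤ σ) (N : ℕ) {g : L2} (hg : wiener 0 g < ∞) :
    wiener 0 (Lam σ N g) < ∞ := by
  rw [wiener_zero] at hg ⊢
  rw [fourier_Lam]
  refine lt_of_le_of_lt (b := ∫⁻ ξ, ENNReal.ofReal ((N + 1 : ℝ) ^ σ) * ‖(𝓕 g : L2) ξ‖ₑ) ?_ ?_
  · refine lintegral_mono_ae ?_
    filter_upwards [coeFn_mulL (isBddMeas_lam hσ N) (𝓕 g)] with ξ h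
    rw [h, enorm_mul, ← ofReal_norm (((lam σ N ξ : ℝ) : ℂ)), Complex.norm_real,
      Real.norm_of_nonneg (lam_pos _ _ _).le]
    exact mul_le_mul_left (ENNReal.ofReal_le_ofReal (lam_le hσ N ξ)) _
  · rw [lintegral_const_mul _ (measurable_Lp _).enorm]
    exact ENNReal.mul_lt_top ENNReal.ofReal_lt_top hg

/-- On the Fourier side the commutator has kernel `(λ(ξ) - λ(η)) F̂(ξ - η)`. Finiteness of `wiener 0
g` only serves to write products as convolutions; it is removed later by frequency truncation of
`g`. -/
theorem enorm_comm_sq_le {σ : ℝ} (hσ : 0 ≤ σ) (N : ℕ) {f : ℝ → ℝ} {F g : L2} (hf : IsBddMeas f)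
    (hfF : ∀ᵐ x, F x = (f x : ℂ)) (hF : wiener 0 F < ∞) (hg : wiener 0 g < ∞) :
    ‖comm σ N f g‖ₑ ^ 2 ≤ ∫⁻ ξ, (∫⁻ η, ENNReal.ofReal |lam σ N ξ - lam σ N η| *
      ‖(𝓕 F : L2) (ξ - η)‖ₑ * ‖(𝓕 g : L2) η‖ₑ) ^ 2 := by
  rw [← enorm_fourier, comm_apply, fourier_sub_L2, enorm_sq_eq]
  refine lintegral_mono_ae ?_
  have hΦ := integrable_of_wiener hF
  have hΨ := integrable_of_wiener hg
  have hL := coeFn_mulL (isBddMeas_lam hσ N) (𝓕 g)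
  filter_upwards [Lp.coeFn_sub (𝓕 (Lam σ N (mulL f g)) : L2) (𝓕 (mulL f (Lam σ N g))),
    coeFn_mulL (isBddMeas_lam hσ N) (𝓕 (mulL f g)), fourier_mulL_ae_eq hf hfF hF hg,
    fourier_mulL_ae_eq hf hfF hF (wiener_Lam_lt_top hσ N hg),
    hΦ.ae_convolution_exists (ContinuousLinearMap.mul ℂ ℂ) hΨ] with ξ h1 h2 h3 h4 h5
  have h6 : ∫ η, (𝓕 F : L2) (ξ - η) * (𝓕 (Lam σ N g) : L2) η =
      ∫ η, (𝓕 F : L2) (ξ - η) * (((lam σ N η : ℝ) : ℂ) * (𝓕 g : L2) η) := by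
    refine integral_congr_ae ?_
    rw [fourier_Lam]
    filter_upwards [hL] with η h
    rw [h]
  have h7 : Integrable fun η => (𝓕 F : L2) (ξ - η) * (𝓕 g : L2) η := h5.integrable_swap
  have h8 : Integrable fun η => (𝓕 F : L2) (ξ - η) * (((lam σ N η : ℝ) : ℂ) * (𝓕 g : L2) η) := by
    refine (h7.bdd_mul (c := (N + 1 : ℝ) ^ σ) (f := fun η => ((lam σ N η : ℝ) : ℂ))
      (Complex.continuous_ofReal.comp (continuous_lam σ N)).aestronglyMeasurable
      (Eventually.of_forall fun η => ?_)).congr (Eventually.of_forall fun η => ?_)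
    · rw [Complex.norm_real, Real.norm_of_nonneg (lam_pos _ _ _).le]
      exact lam_le hσ N η
    · simp only
      ring
  refine pow_le_pow_left₀ zero_le ?_ 2
  rw [h1, Pi.sub_apply, fourier_Lam, h2, h3, h4, h6, ← integral_const_mul,
    ← integral_sub (h7.const_mul _) h8]
  refine (enorm_integral_le_lintegral_enorm _).trans (le_of_eq (lintegral_congr fun η => ?_))
  rw [← Real.norm_eq_abs, ← Complex.norm_real, ofReal_norm, ← enorm_mul, ← enorm_mul]
  congr 1
  push_cast
  ring

/-- The indicator function of the frequencies of absolute value at most `n`. -/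
def cutoff (n : ℕ) : ℝ → ℝ := Set.indicator (Set.Icc (-(n : ℝ)) n) 1

theorem abs_cutoff_le (n : ℕ) (ξ : ℝ) : |cutoff n ξ| ≤ 1 := by
  rw [cutoff, Set.indicator_apply]
  split_ifs <;> simp

theorem isBddMeas_cutoff (n : ℕ) : IsBddMeas (cutoff n) :=
  ⟨(measurable_one.indicator measurableSet_Icc).aestronglyMeasurable, 1, abs_cutoff_le n⟩

theorem cutoff_eventually_eq (ξ : ℝ) : ∀ᶠ n : ℕ in atTop, cutoff n ξ = 1 := by
  filter_upwards [eventually_ge_atTop ⌈|ξ|⌉₊] with n hn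
  have := abs_le.1 (Nat.ceil_le.1 hn)
  rw [cutoff, Set.indicator_of_mem (show ξ ∈ Set.Icc (-(n : ℝ)) n from this)]
  rfl

/-- The sharp frequency truncation. -/
def trunc (n : ℕ) (g : L2) : L2 := 𝓕⁻ (mulL (cutoff n) (𝓕 g) : L2)

theorem fourier_trunc (n : ℕ) (g : L2) : (𝓕 (trunc n g) : L2) = mulL (cutoff n) (𝓕 g) :=
  FourierTransform.fourier_fourierInv_eq _

theorem enorm_fourier_trunc_le (n : ℕ) (g : L2) :
    ∀ᵐ ξ, ‖(𝓕 (trunc n g) : L2) ξ‖ₑ ≤ ‖(𝓕 g : L2) ξ‖ₑ := by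
  rw [fourier_trunc]
  filter_upwards [coeFn_mulL (isBddMeas_cutoff n) (𝓕 g)] with ξ h
  rw [h, enorm_mul, ← ofReal_norm (((cutoff n ξ : ℝ) : ℂ)), Complex.norm_real]
  exact mul_le_of_le_one_left zero_le (ENNReal.ofReal_le_one.2 (abs_cutoff_le n ξ))

theorem wiener_trunc_lt_top (n : ℕ) (g : L2) : wiener 0 (trunc n g) < ∞ := by
  rw [wiener_zero, fourier_trunc]
  have h : ∫⁻ ξ, ‖(mulL (cutoff n) (𝓕 g) : L2) ξ‖ₑ
      = ∫⁻ ξ in Set.Icc (-(n : ℝ)) n, ‖(𝓕 g : L2) ξ‖ₑ := by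
    rw [← lintegral_indicator measurableSet_Icc]
    refine lintegral_congr_ae ?_
    filter_upwards [coeFn_mulL (isBddMeas_cutoff n) (𝓕 g)] with ξ h
    rw [h, cutoff, Set.indicator_apply, Set.indicator_apply]
    split_ifs <;> simp
  rw [h]
  exact ((Lp.memLp (𝓕 g : L2)).restrict _).integrable (by norm_num) |>.2

theorem tendsto_trunc (g : L2) : Tendsto (fun n => trunc n g) atTop (𝓝 g) := by
  rw [tendsto_iff_edist_tendsto_0]
  have h1 : ∀ n, edist (trunc n g) g ^ 2 =
      ∫⁻ ξ, ‖(𝓕 (trunc n g) : L2) ξ - (𝓕 g : L2) ξ‖ₑ ^ 2 := by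
    intro n
    rw [edist_eq_enorm_sub, ← enorm_fourier, fourier_sub_L2, enorm_sq_eq]
    refine lintegral_congr_ae ?_
    filter_upwards [Lp.coeFn_sub (𝓕 (trunc n g) : L2) (𝓕 g)] with ξ h
    rw [h, Pi.sub_apply]
  have hm : ∀ ξ, ∀ n, (𝓕 (trunc n g) : L2) ξ = (cutoff n ξ : ℂ) * (𝓕 g : L2) ξ →
      ‖(𝓕 (trunc n g) : L2) ξ - (𝓕 g : L2) ξ‖ₑ ≤ ‖(𝓕 g : L2) ξ‖ₑ := by
    intro ξ n h
    rw [h, cutoff, Set.indicator_apply]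
    split_ifs <;> simp
  have hc : ∀ n, ∀ᵐ ξ, (𝓕 (trunc n g) : L2) ξ = (cutoff n ξ : ℂ) * (𝓕 g : L2) ξ := by
    intro n
    rw [fourier_trunc]
    exact coeFn_mulL (isBddMeas_cutoff n) (𝓕 g)
  have h2 : Tendsto (fun n => edist (trunc n g) g ^ 2) atTop (𝓝 0) := by
    simp only [h1]
    rw [← lintegral_zero (μ := (volume : Measure ℝ)) (α := ℝ)]
    refine tendsto_lintegral_of_dominated_convergence (fun ξ => ‖(𝓕 g : L2) ξ‖ₑ ^ 2)
      (fun n => ((measurable_Lp _).sub (measurable_Lp _)).enorm.pow_const 2) (fun n => ?_) ?_ ?_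
    · filter_upwards [hc n] with ξ h
      exact pow_le_pow_left₀ zero_le (hm ξ n h) 2
    · rw [← enorm_sq_eq]
      exact (ENNReal.pow_lt_top enorm_lt_top).ne
    · filter_upwards [ae_all_iff.2 hc] with ξ h
      refine tendsto_const_nhds.congr' ?_
      filter_upwards [cutoff_eventually_eq ξ] with n hn
      rw [h n, hn]
      simp
  have h3 := (ENNReal.continuous_rpow_const (y := (1 / 2 : ℝ))).tendsto 0 |>.comp h2
  rw [ENNReal.zero_rpow_of_pos (by norm_num)] at h3
  refine h3.congr fun n => ?_
  simp only [Function.comp_apply]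
  rw [← ENNReal.rpow_natCast, ← ENNReal.rpow_mul]
  norm_num

/-- A density argument: truncations of `g` have integrable Fourier transform and converge to `g`.
The bound must not depend on `n`, which is ensured by the monotonicity of the norms under truncation
proved next. -/
theorem enorm_sq_le_of_trunc (A : L2 →L[ℂ] L2) (g : L2) {K : ℝ≥0∞}
    (h : ∀ n, ‖A (trunc n g)‖ₑ ^ 2 ≤ K) : ‖A g‖ₑ ^ 2 ≤ K := by
  have h1 : Tendsto (fun n => ‖A (trunc n g)‖ₑ ^ 2) atTop (𝓝 (‖A g‖ₑ ^ 2)) :=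
    ((ENNReal.continuous_pow 2).tendsto _).comp
      ((continuous_enorm.tendsto _).comp ((A.continuous.tendsto g).comp (tendsto_trunc g)))
  exact le_of_tendsto' h1 h

theorem wiener_trunc_le (τ : ℝ) (n : ℕ) (g : L2) : wiener τ (trunc n g) ≤ wiener τ g := by
  refine lintegral_mono_ae ?_
  filter_upwards [enorm_fourier_trunc_le n g] with ξ h
  exact mul_le_mul_right h _

theorem hsE_sq_trunc_le (τ : ℝ) (n : ℕ) (g : L2) : hsE τ (trunc n g) ^ 2 ≤ hsE τ g ^ 2 := by
  rw [hsE_sq, hsE_sq]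
  refine lintegral_mono_ae ?_
  filter_upwards [enorm_fourier_trunc_le n g] with ξ h
  exact pow_le_pow_left₀ zero_le (mul_le_mul_right h _) 2

theorem enorm_trunc_le (n : ℕ) (g : L2) : ‖trunc n g‖ₑ ^ 2 ≤ ‖g‖ₑ ^ 2 := by
  rw [enorm_eq_hsE_zero, enorm_eq_hsE_zero g]
  exact hsE_sq_trunc_le 0 n g

/-- Commutator estimate of order one. -/
theorem enorm_comm_one_le (N : ℕ) {f : ℝ → ℝ} {F : L2} (hf : IsBddMeas f)
    (hfF : ∀ᵐ x, F x = (f x : ℂ)) (hF : wiener 1 F < ∞) (g : L2) :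
    ‖comm 1 N f g‖ₑ ≤ wiener 1 F * ‖g‖ₑ := by
  have hF0 : wiener 0 F < ∞ := (wiener_mono zero_le_one F).trans_lt hF
  rw [← ENNReal.pow_le_pow_left_iff two_ne_zero]
  refine enorm_sq_le_of_trunc _ g fun n => ?_
  refine (enorm_comm_sq_le zero_le_one N hf hfF hF0 (wiener_trunc_lt_top n g)).trans ?_
  rw [mul_pow]
  refine le_trans ?_ (mul_le_mul_right (enorm_trunc_le n g) _)
  rw [← enorm_fourier (trunc n g), enorm_sq_eq]
  refine le_trans (lintegral_mono fun ξ => pow_le_pow_left₀ zero_le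
    (lintegral_mono fun η => mul_le_mul_left ?_ _) 2) (lintegral_conv_sq_le
      ((measurable_ofReal_jb 1).mul (measurable_Lp (𝓕 F)).enorm)
      (measurable_Lp (𝓕 (trunc n g))).enorm)
  refine mul_le_mul_left (ENNReal.ofReal_le_ofReal ?_) _
  rw [Real.rpow_one]
  -- At order one the difference of weights involves no power of `⟨η⟩`, so the `L²` norm of `g`
  -- suffices.
  exact abs_lam_one_sub_le N ξ η

theorem add_sq_le_ennreal (a b : ℝ≥0∞) : (a + b) ^ 2 ≤ 2 * (a ^ 2 + b ^ 2) := by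
  have h := ENNReal.rpow_add_le_mul_rpow_add_rpow a b (p := 2) (by norm_num)
  norm_num at h
  exact h

/-- Commutator estimate of order `σ ≥ 1`. -/
theorem exists_enorm_comm_sq_le {σ : ℝ} (hσ : 1 ≤ σ) :
    ∃ K : ℝ≥0, ∀ (N : ℕ) (f : ℝ → ℝ) (F g : L2), IsBddMeas f → (∀ᵐ x, F x = (f x : ℂ)) →
      wiener 1 F < ∞ → ‖comm σ N f g‖ₑ ^ 2 ≤
        K * ((wiener 1 F * hsE (σ - 1) g) ^ 2 + (hsE σ F * wiener 0 g) ^ 2) := by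
  set k : ℝ := σ * 2 ^ (σ - 1)
  have hk : 0 ≤ k := by positivity
  refine ⟨2 * (Real.toNNReal k) ^ 2, fun N f F g hf hfF hF => ?_⟩
  have hF0 : wiener 0 F < ∞ := (wiener_mono zero_le_one F).trans_lt hF
  refine enorm_sq_le_of_trunc _ g fun n => ?_
  refine (enorm_comm_sq_le (by linarith) N hf hfF hF0 (wiener_trunc_lt_top n g)).trans ?_
  refine le_trans ?_ (mul_le_mul_right (add_le_add
    (pow_le_pow_left₀ zero_le (mul_le_mul_right
      ((ENNReal.pow_le_pow_left_iff two_ne_zero).1 (hsE_sq_trunc_le (σ - 1) n g)) _) 2)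
    (pow_le_pow_left₀ zero_le (mul_le_mul_right (wiener_trunc_le 0 n g) _) 2)) _)
  set G := trunc n g
  set a : ℝ → ℝ≥0∞ := fun ξ => ENNReal.ofReal (jb ξ ^ (1 : ℝ)) * ‖(𝓕 F : L2) ξ‖ₑ
  set b : ℝ → ℝ≥0∞ := fun ξ => ENNReal.ofReal (jb ξ ^ (σ - 1)) * ‖(𝓕 G : L2) ξ‖ₑ
  set c : ℝ → ℝ≥0∞ := fun ξ => ENNReal.ofReal (jb ξ ^ σ) * ‖(𝓕 F : L2) ξ‖ₑ
  set d : ℝ → ℝ≥0∞ := fun ξ => ‖(𝓕 G : L2) ξ‖ₑ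
  have ha : Measurable a := (measurable_ofReal_jb 1).mul (measurable_Lp (𝓕 F)).enorm
  have hb : Measurable b := (measurable_ofReal_jb _).mul (measurable_Lp (𝓕 G)).enorm
  have hc : Measurable c := (measurable_ofReal_jb _).mul (measurable_Lp (𝓕 F)).enorm
  have hd : Measurable d := (measurable_Lp (𝓕 G)).enorm
  -- The two terms of `abs_lam_sub_le` give two convolutions. In the first, `a` is measured in `L¹`
  -- and `b` in `L²`; in the second, `c` in `L²` and `d` in `L¹`. Each uses the matching form of
  -- Young's inequality.
  have key : ∀ ξ η, ENNReal.ofReal |lam σ N ξ - lam σ N η| * ‖(𝓕 F : L2) (ξ - η)‖ₑ *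
      ‖(𝓕 G : L2) η‖ₑ ≤ ENNReal.ofReal k * (a (ξ - η) * b η + c (ξ - η) * d η) := by
    intro ξ η
    have h1 := ENNReal.ofReal_le_ofReal (abs_lam_sub_le hσ N ξ η)
    rw [ENNReal.ofReal_mul hk, ENNReal.ofReal_add (mul_nonneg (jb_pos _).le
      (Real.rpow_nonneg (jb_pos _).le _)) (Real.rpow_nonneg (jb_pos _).le _),
      ENNReal.ofReal_mul (jb_pos _).le] at h1
    refine (mul_le_mul_left (mul_le_mul_left h1 _) _).trans (le_of_eq ?_)
    simp only [a, b, c, d, Real.rpow_one]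
    ring
  have hm1 : ∀ ξ, Measurable fun η => a (ξ - η) * b η := fun ξ =>
    (ha.comp (measurable_const.sub measurable_id)).mul hb
  have hm2 : ∀ ξ, Measurable fun η => c (ξ - η) * d η := fun ξ =>
    (hc.comp (measurable_const.sub measurable_id)).mul hd
  have hM1 : Measurable fun ξ => ∫⁻ η, a (ξ - η) * b η :=
    Measurable.lintegral_prod_right' (f := fun q : ℝ × ℝ => a (q.1 - q.2) * b q.2)
      ((ha.comp (measurable_fst.sub measurable_snd)).mul (hb.comp measurable_snd))
  have h1 : ∀ ξ, (∫⁻ η, ENNReal.ofReal |lam σ N ξ - lam σ N η| * ‖(𝓕 F : L2) (ξ - η)‖ₑ *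
      ‖(𝓕 G : L2) η‖ₑ) ^ 2 ≤ (ENNReal.ofReal k ^ 2 * 2) *
      ((∫⁻ η, a (ξ - η) * b η) ^ 2 + (∫⁻ η, c (ξ - η) * d η) ^ 2) := by
    intro ξ
    have h2 := lintegral_mono (μ := volume) (key ξ)
    rw [lintegral_const_mul' _ _ ENNReal.ofReal_ne_top, lintegral_add_left (hm1 ξ)] at h2
    refine (pow_le_pow_left₀ zero_le h2 2).trans ?_
    rw [mul_pow, mul_assoc]
    exact mul_le_mul_right (add_sq_le_ennreal _ _) _
  refine (lintegral_mono h1).trans ?_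
  have hfin : ENNReal.ofReal k ^ 2 * 2 ≠ ∞ := by finiteness
  rw [lintegral_const_mul' _ _ hfin, lintegral_add_left (hM1.pow_const 2)]
  refine mul_le_mul' (le_of_eq ?_) (add_le_add ?_ ?_)
  · push_cast
    rw [mul_comm]
    rfl
  · rw [mul_pow, hsE_sq]
    exact lintegral_conv_sq_le ha hb
  · rw [mul_pow, hsE_sq, wiener_zero]
    exact lintegral_conv_sq_le' hc hd

/-! ### Continuous representatives and derivatives -/

/-- The continuous representative of an element of `L²` with integrable Fourier transform. -/
def rep (F : L2) : ℝ → ℂ := 𝓕⁻ ((𝓕 F : L2) : ℝ → ℂ)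

theorem continuous_rep {F : L2} (hF : wiener 0 F < ∞) : Continuous (rep F) :=
  continuous_fourierInv (integrable_of_wiener hF)

theorem ae_eq_rep {F : L2} (hF : wiener 0 F < ∞) : (F : ℝ → ℂ) =ᵐ[volume] rep F :=
  ae_eq_fourierInv_fourier (integrable_of_wiener hF)

theorem norm_rep_le {F : L2} {a : ℝ} (ha : 0 ≤ a) (hF : wiener 0 F ≤ ENNReal.ofReal a) (x : ℝ) :
    ‖rep F x‖ ≤ a := by
  refine (norm_fourierInv_le _ x).trans ?_
  rw [integral_norm_eq_lintegral_enorm (Lp.memLp _).1, ← wiener_zero]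
  exact ENNReal.toReal_le_of_le_ofReal ha hF

theorem hasDerivAt_fourierInv {Φ : ℝ → ℂ} (h0 : Integrable Φ)
    (h1 : Integrable fun ξ : ℝ => ξ • Φ ξ) (x : ℝ) :
    HasDerivAt (𝓕⁻ Φ) (𝓕⁻ (fun ξ : ℝ => ((2 * Real.pi * ξ : ℝ) : ℂ) * Complex.I * Φ ξ) x) x := by
  have h := Real.hasDerivAt_fourier h0 h1 (-x)
  have h2 := h.scomp x (hasDerivAt_neg x)
  have e : 𝓕⁻ Φ = 𝓕 Φ ∘ Neg.neg := funext fun y => Real.fourierInv_eq_fourier_neg Φ y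
  rw [e]
  refine h2.congr_deriv ?_
  rw [Real.fourierInv_eq_fourier_neg, neg_one_smul]
  simp only [Real.fourier_eq]
  rw [← integral_neg]
  refine integral_congr_ae (Eventually.of_forall fun ξ => ?_)
  simp only [Circle.smul_def, smul_eq_mul]
  push_cast
  ring

theorem norm_fourier_symbol (ξ : ℝ) (z : ℂ) :
    ‖((2 * Real.pi * ξ : ℝ) : ℂ) * Complex.I * z‖ = |2 * Real.pi * ξ| * ‖z‖ := by
  rw [norm_mul, norm_mul, Complex.norm_I, mul_one, Complex.norm_real, Real.norm_eq_abs]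

theorem memLp_symbol {F : L2} (hF : hsE 1 F < ∞) :
    MemLp (fun ξ : ℝ => ((2 * Real.pi * ξ : ℝ) : ℂ) * Complex.I * (𝓕 F : L2) ξ) 2 volume := by
  refine ⟨((by fun_prop : Continuous fun ξ : ℝ =>
    ((2 * Real.pi * ξ : ℝ) : ℂ) * Complex.I)).aestronglyMeasurable.mul (Lp.memLp _).1,
    lt_of_le_of_lt (eLpNorm_mono fun ξ => ?_) hF⟩
  rw [norm_fourier_symbol, norm_mul, Complex.norm_real, Real.norm_of_nonneg
    (Real.rpow_nonneg (jb_pos _).le _), Real.rpow_one]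
  exact mul_le_mul_of_nonneg_right (abs_le_jb ξ) (norm_nonneg _)

open Classical in
/-- The derivative of an element of `H¹`. -/
def derL (F : L2) : L2 :=
  if h : hsE 1 F < ∞ then 𝓕⁻ ((memLp_symbol h).toLp _ : L2) else 0

theorem fourier_derL {F : L2} (h : hsE 1 F < ∞) :
    ((𝓕 (derL F) : L2) : ℝ → ℂ) =ᵐ[volume]
      fun ξ : ℝ => ((2 * Real.pi * ξ : ℝ) : ℂ) * Complex.I * (𝓕 F : L2) ξ := by
  rw [derL, dif_pos h, FourierTransform.fourier_fourierInv_eq]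
  exact (memLp_symbol h).coeFn_toLp

theorem ofReal_jb_mul_enorm_derL_le {F : L2} (h : hsE 1 F < ∞) (τ : ℝ) :
    ∀ᵐ ξ, ENNReal.ofReal (jb ξ ^ τ) * ‖(𝓕 (derL F) : L2) ξ‖ₑ ≤
      ENNReal.ofReal (jb ξ ^ (τ + 1)) * ‖(𝓕 F : L2) ξ‖ₑ := by
  filter_upwards [fourier_derL h] with ξ hξ
  rw [hξ, ← ofReal_norm, norm_fourier_symbol, ← ofReal_norm,
    ← ENNReal.ofReal_mul (Real.rpow_nonneg (jb_pos _).le _),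
    ← ENNReal.ofReal_mul (Real.rpow_nonneg (jb_pos _).le _)]
  refine ENNReal.ofReal_le_ofReal ?_
  rw [Real.rpow_add_one (jb_pos _).ne', ← mul_assoc]
  exact mul_le_mul_of_nonneg_right (mul_le_mul_of_nonneg_left (abs_le_jb ξ)
    (Real.rpow_nonneg (jb_pos _).le _)) (norm_nonneg _)

theorem wiener_derL_le {F : L2} (h : hsE 1 F < ∞) (τ : ℝ) :
    wiener τ (derL F) ≤ wiener (τ + 1) F :=
  lintegral_mono_ae (ofReal_jb_mul_enorm_derL_le h τ)

theorem hsE_derL_le {F : L2} (h : hsE 1 F < ∞) (τ : ℝ) : hsE τ (derL F) ≤ hsE (τ + 1) F := by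
  rw [← ENNReal.pow_le_pow_left_iff two_ne_zero, hsE_sq, hsE_sq]
  refine lintegral_mono_ae ?_
  filter_upwards [ofReal_jb_mul_enorm_derL_le h τ] with ξ hξ
  exact pow_le_pow_left₀ zero_le hξ 2

theorem hasDerivAt_rep {F : L2} (h : hsE 1 F < ∞) (hw : wiener 1 F < ∞) (x : ℝ) :
    HasDerivAt (rep F) (rep (derL F) x) x := by
  have h0 : wiener 0 F < ∞ := (wiener_mono zero_le_one F).trans_lt hw
  have h1 : Integrable fun ξ : ℝ => ξ • (𝓕 F : L2) ξ := by
    refine ⟨continuous_id.aestronglyMeasurable.smul (Lp.memLp _).1,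
      lt_of_le_of_lt (lintegral_mono fun ξ => ?_) hw⟩
    rw [enorm_smul]
    refine mul_le_mul_left ?_ _
    rw [← ofReal_norm, Real.rpow_one, Real.norm_eq_abs]
    refine ENNReal.ofReal_le_ofReal (le_trans ?_ (abs_le_jb ξ))
    rw [abs_mul, abs_of_pos Real.two_pi_pos]
    exact le_mul_of_one_le_left (abs_nonneg _) (by nlinarith [Real.pi_gt_three])
  refine (hasDerivAt_fourierInv (integrable_of_wiener h0) h1 x).congr_deriv ?_
  rw [rep, Real.fourierInv_eq, Real.fourierInv_eq]
  refine integral_congr_ae ?_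
  filter_upwards [fourier_derL h] with ξ hξ
  rw [hξ]

theorem hsE_Lam_lt_top {σ τ : ℝ} (hσ : 0 ≤ σ) (N : ℕ) {F : L2} (h : hsE τ F < ∞) :
    hsE τ (Lam σ N F) < ∞ := by
  refine lt_of_le_of_lt (b := (ENNReal.ofReal ((N + 1 : ℝ) ^ σ)) * hsE τ F) ?_
    (ENNReal.mul_lt_top ENNReal.ofReal_lt_top h)
  rw [← ENNReal.pow_le_pow_left_iff two_ne_zero, mul_pow, hsE_sq, hsE_sq,
    ← lintegral_const_mul' _ _ (by finiteness)]
  refine lintegral_mono_ae ?_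
  rw [fourier_Lam]
  filter_upwards [coeFn_mulL (isBddMeas_lam hσ N) (𝓕 F)] with ξ h
  rw [← mul_pow, h, enorm_mul, ← ofReal_norm (((lam σ N ξ : ℝ) : ℂ)), Complex.norm_real,
    Real.norm_of_nonneg (lam_pos _ _ _).le, mul_left_comm]
  exact pow_le_pow_left₀ zero_le
    (mul_le_mul_left (ENNReal.ofReal_le_ofReal (lam_le hσ N ξ)) _) 2

theorem fourier_injective {F G : L2} (h : (𝓕 F : L2) = 𝓕 G) : F = G :=
  (Lp.fourierTransformₗᵢ ℝ ℂ).injective h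

theorem derL_Lam {σ : ℝ} (hσ : 0 ≤ σ) (N : ℕ) {F : L2} (h : hsE 1 F < ∞) :
    derL (Lam σ N F) = Lam σ N (derL F) := by
  refine fourier_injective ?_
  rw [fourier_Lam]
  ext1
  have h1 := fourier_derL (hsE_Lam_lt_top hσ N h)
  rw [fourier_Lam] at h1
  filter_upwards [h1, coeFn_mulL (isBddMeas_lam hσ N) (𝓕 F), fourier_derL h,
    coeFn_mulL (isBddMeas_lam hσ N) (𝓕 (derL F))] with ξ e1 e2 e3 e4
  rw [e1, e2, e4, e3]
  ring

/-! ### Calculus in `H^s` -/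

/-- `f` is continuous and `|f|_{H^s} ≤ a`. -/
structure HsBdd (s : ℝ) (f : ℝ → ℝ) (a : ℝ) : Prop where
  cont : Continuous f
  nonneg : 0 ≤ a
  le : hsNorm s f ≤ ENNReal.ofReal a

namespace HsBdd

variable {s a b : ℝ} {f g : ℝ → ℝ}

theorem memLp (h : HsBdd s f a) : MemLp (fun x => (f x : ℂ)) 2 (volume : Measure ℝ) :=
  memLp_of_hsNorm_lt_top (h.le.trans_lt ENNReal.ofReal_lt_top)

theorem coeFn (h : HsBdd s f a) : ∀ᵐ x, toL2 f x = (f x : ℂ) := coeFn_toL2 h.memLp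

theorem hsE_le (h : HsBdd s f a) : hsE s (toL2 f) ≤ ENNReal.ofReal a :=
  (hsE_toL2_le s f).trans h.le

theorem mono_exp (h : HsBdd s f a) {σ : ℝ} (hσ : σ ≤ s) : HsBdd σ f a :=
  ⟨h.cont, h.nonneg, by rw [hsNorm_eq h.memLp]; exact (hsE_mono hσ _).trans h.hsE_le⟩

theorem mono (h : HsBdd s f a) (hab : a ≤ b) : HsBdd s f b :=
  ⟨h.cont, h.nonneg.trans hab, h.le.trans (ENNReal.ofReal_le_ofReal hab)⟩

/-- Two continuous functions that agree almost everywhere agree. Continuity is part of `HsBdd` for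
this reason: `L²` information becomes pointwise. -/
theorem eq_rep (h : HsBdd s f a) (hw : wiener 0 (toL2 f) < ∞) (x : ℝ) :
    (f x : ℂ) = rep (toL2 f) x := by
  have h1 : (fun x => (f x : ℂ)) =ᵐ[volume] rep (toL2 f) := by
    filter_upwards [h.coeFn, ae_eq_rep hw] with x e1 e2
    rw [← e1, e2]
  exact congrFun (((Complex.continuous_ofReal.comp h.cont).ae_eq_iff_eq volume
    (continuous_rep hw)).1 h1) x

theorem of_forall (hf : Continuous f) (ha : 0 ≤ a) (hs : 0 ≤ s)
    (hm : MemLp (fun x => (f x : ℂ)) 2 (volume : Measure ℝ))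
    (h : ∀ N, ‖Lam s N (toL2 f)‖ ≤ a) : HsBdd s f a := by
  refine ⟨hf, ha, ?_⟩
  rw [hsNorm_eq hm]
  refine hsE_le_of_forall hs fun N => ?_
  rw [← ofReal_norm]
  exact ENNReal.ofReal_le_ofReal (h N)

theorem norm_Lam_le (h : HsBdd s f a) (hs : 0 ≤ s) (N : ℕ) : ‖Lam s N (toL2 f)‖ ≤ a := by
  have h1 := (enorm_Lam_le hs N (toL2 f)).trans h.hsE_le
  rw [← ofReal_norm] at h1
  exact (ENNReal.ofReal_le_ofReal_iff h.nonneg).1 h1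

theorem norm_toL2_le (h : HsBdd s f a) (hs : 0 ≤ s) : ‖toL2 f‖ ≤ a := by
  have h1 := (hsE_mono hs (toL2 f)).trans h.hsE_le
  rw [← enorm_eq_hsE_zero, ← ofReal_norm] at h1
  exact (ENNReal.ofReal_le_ofReal_iff h.nonneg).1 h1

end HsBdd

theorem memLp_add {f g : ℝ → ℝ} (hf : MemLp (fun x => (f x : ℂ)) 2 (volume : Measure ℝ))
    (hg : MemLp (fun x => (g x : ℂ)) 2 (volume : Measure ℝ)) :
    MemLp (fun x => ((f x + g x : ℝ) : ℂ)) 2 (volume : Measure ℝ) :=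
  (hf.add hg).ae_eq (Eventually.of_forall fun x => by simp)

theorem toL2_add {f g : ℝ → ℝ} (hf : MemLp (fun x => (f x : ℂ)) 2 (volume : Measure ℝ))
    (hg : MemLp (fun x => (g x : ℂ)) 2 (volume : Measure ℝ)) :
    toL2 (fun x => f x + g x) = toL2 f + toL2 g := by
  have h := memLp_add hf hg
  ext1
  filter_upwards [coeFn_toL2 hf, coeFn_toL2 hg, coeFn_toL2 h,
    Lp.coeFn_add (toL2 f) (toL2 g)] with x h1 h2 h3 h4
  rw [h3, h4, Pi.add_apply, h1, h2]
  push_cast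
  rfl

theorem memLp_const_mul (c : ℝ) {f : ℝ → ℝ}
    (hf : MemLp (fun x => (f x : ℂ)) 2 (volume : Measure ℝ)) :
    MemLp (fun x => ((c * f x : ℝ) : ℂ)) 2 (volume : Measure ℝ) := by
  simpa using hf.const_mul (c : ℂ)

theorem toL2_const_mul (c : ℝ) {f : ℝ → ℝ}
    (hf : MemLp (fun x => (f x : ℂ)) 2 (volume : Measure ℝ)) :
    toL2 (fun x => c * f x) = (c : ℂ) • toL2 f := by
  ext1
  filter_upwards [coeFn_toL2 hf, coeFn_toL2 (memLp_const_mul c hf),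
    Lp.coeFn_smul (c : ℂ) (toL2 f)] with x h1 h2 h3
  rw [h2, h3, Pi.smul_apply, h1]
  push_cast
  rfl

theorem HsBdd.add {s a b : ℝ} {f g : ℝ → ℝ} (hs : 0 ≤ s) (hf : HsBdd s f a) (hg : HsBdd s g b) :
    HsBdd s (fun x => f x + g x) (a + b) := by
  refine .of_forall (hf.cont.add hg.cont) (add_nonneg hf.nonneg hg.nonneg) hs
    (memLp_add hf.memLp hg.memLp) fun N => ?_
  rw [toL2_add hf.memLp hg.memLp, map_add]
  exact (norm_add_le _ _).trans (add_le_add (hf.norm_Lam_le hs N) (hg.norm_Lam_le hs N))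

theorem HsBdd.const_mul {s a : ℝ} {f : ℝ → ℝ} (hs : 0 ≤ s) (c : ℝ) (hf : HsBdd s f a) :
    HsBdd s (fun x => c * f x) (|c| * a) := by
  refine .of_forall (hf.cont.const_mul c) (mul_nonneg (abs_nonneg _) hf.nonneg) hs
    (memLp_const_mul c hf.memLp) fun N => ?_
  rw [toL2_const_mul c hf.memLp, map_smul, norm_smul, Complex.norm_real, Real.norm_eq_abs]
  exact mul_le_mul_of_nonneg_left (hf.norm_Lam_le hs N) (abs_nonneg _)

theorem exists_wiener_le_of_hsE {τ p : ℝ} (hp : τ + 1 / 2 < p) :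
    ∃ K : ℝ, 0 ≤ K ∧ ∀ (F : L2) (a : ℝ), hsE p F ≤ ENNReal.ofReal a →
      wiener τ F ≤ ENNReal.ofReal (K * a) := by
  obtain ⟨K, hK⟩ := exists_wiener_le (p := p - τ) (by linarith)
  refine ⟨K, NNReal.coe_nonneg K, fun F a h => ?_⟩
  have h1 := hK τ F
  rw [add_sub_cancel] at h1
  rw [ENNReal.ofReal_mul (NNReal.coe_nonneg K), ENNReal.ofReal_coe_nnreal]
  exact h1.trans (mul_le_mul_right h _)

/-- The embedding of `H^p` into bounded continuous functions, `p > 1/2`. -/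
theorem exists_abs_le_of_hsBdd {p : ℝ} (hp : 1 / 2 < p) :
    ∃ K : ℝ, 0 ≤ K ∧ ∀ (f : ℝ → ℝ) (a : ℝ), HsBdd p f a → ∀ x, |f x| ≤ K * a := by
  obtain ⟨K, hK0, hK⟩ := exists_wiener_le_of_hsE (τ := 0) (p := p) (by linarith)
  refine ⟨K, hK0, fun f a h x => ?_⟩
  have h1 := hK _ _ h.hsE_le
  rw [← Real.norm_eq_abs, ← Complex.norm_real, h.eq_rep (h1.trans_lt ENNReal.ofReal_lt_top)]
  exact norm_rep_le (mul_nonneg hK0 h.nonneg) h1 x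

/-- Functions of `H^s`, `s > 3/2`, are of class `C¹` with bounded derivative. -/
theorem HsBdd.hasDerivAt {s a : ℝ} {f : ℝ → ℝ} (hs : 3 / 2 < s) (h : HsBdd s f a) (x : ℝ) :
    HasDerivAt f (deriv f x) x ∧ ((deriv f x : ℝ) : ℂ) = rep (derL (toL2 f)) x := by
  obtain ⟨K, hK0, hK⟩ := exists_wiener_le_of_hsE (τ := 1) (p := s) (by linarith)
  have h1 := (hK _ _ h.hsE_le).trans_lt ENNReal.ofReal_lt_top
  have h0 : wiener 0 (toL2 f) < ∞ := (wiener_mono zero_le_one _).trans_lt h1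
  have hE : hsE 1 (toL2 f) < ∞ :=
    ((hsE_mono (by linarith) _).trans h.hsE_le).trans_lt ENNReal.ofReal_lt_top
  have hd := hasDerivAt_rep hE h1 x
  have e : rep (toL2 f) = fun y => (f y : ℂ) := funext fun y => (h.eq_rep h0 y).symm
  rw [e] at hd
  have hre : HasDerivAt f (rep (derL (toL2 f)) x).re x :=
     Complex.reCLM.hasFDerivAt.comp_hasDerivAt x hd
  have hd2 : HasDerivAt f (deriv f x) x := hre.differentiableAt.hasDerivAt
  exact ⟨hd2, hd2.ofReal_comp.unique hd⟩

theorem exists_abs_deriv_le {s : ℝ} (hs : 3 / 2 < s) :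
    ∃ K : ℝ, 0 ≤ K ∧ ∀ (f : ℝ → ℝ) (a : ℝ), HsBdd s f a →
      (∀ x, |deriv f x| ≤ K * a) ∧ Continuous (deriv f) := by
  obtain ⟨K, hK0, hK⟩ := exists_wiener_le_of_hsE (τ := 1) (p := s) (by linarith)
  refine ⟨K, hK0, fun f a h => ?_⟩
  have hE : hsE 1 (toL2 f) < ∞ :=
    ((hsE_mono (by linarith) _).trans h.hsE_le).trans_lt ENNReal.ofReal_lt_top
  have h1 := (wiener_derL_le hE 0).trans (by simpa using hK _ _ h.hsE_le)
  refine ⟨fun x => ?_, ?_⟩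
  · rw [← Real.norm_eq_abs, ← Complex.norm_real, (h.hasDerivAt hs x).2]
    exact norm_rep_le (mul_nonneg hK0 h.nonneg) h1 x
  · have hc := Complex.continuous_re.comp (continuous_rep (h1.trans_lt ENNReal.ofReal_lt_top))
    refine hc.congr fun x => ?_
    rw [Function.comp_apply, ← (h.hasDerivAt hs x).2, Complex.ofReal_re]

/-- The class of the derivative is the derivative of the class. -/
theorem HsBdd.derL_eq {s a : ℝ} {f : ℝ → ℝ} (hs : 3 / 2 < s) (h : HsBdd s f a) :
    ∀ᵐ x, derL (toL2 f) x = ((deriv f x : ℝ) : ℂ) := by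
  obtain ⟨K, hK0, hK⟩ := exists_wiener_le_of_hsE (τ := 1) (p := s) (by linarith)
  have hE : hsE 1 (toL2 f) < ∞ :=
    ((hsE_mono (by linarith) _).trans h.hsE_le).trans_lt ENNReal.ofReal_lt_top
  have h1 := (wiener_derL_le hE 0).trans (by simpa using hK _ _ h.hsE_le)
  filter_upwards [ae_eq_rep (h1.trans_lt ENNReal.ofReal_lt_top)] with x hx
  rw [hx, (h.hasDerivAt hs x).2]

/-- The commutator estimate with real constants. -/
theorem exists_norm_comm_le {s σ : ℝ} (hs : 3 / 2 < s) (hσ : 1 ≤ σ) (hσs : σ ≤ s) :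
    ∃ K : ℝ, 0 ≤ K ∧ ∀ (N : ℕ) (f : ℝ → ℝ) (a : ℝ) (g : L2) (b : ℝ), HsBdd s f a → 0 ≤ b →
      hsE (σ - 1) g ≤ ENNReal.ofReal b → wiener 0 g ≤ ENNReal.ofReal b →
      ‖comm σ N f g‖ ≤ K * a * b := by
  obtain ⟨K₁, hK₁⟩ := exists_enorm_comm_sq_le hσ
  obtain ⟨K₂, hK₂0, hK₂⟩ := exists_wiener_le_of_hsE (τ := 1) (p := s) (by linarith)
  obtain ⟨K₃, hK₃0, hK₃⟩ := exists_abs_le_of_hsBdd (p := s) (by linarith)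
  -- `K₂` bounds the Wiener norm of the coefficient in the first square; the `1` is the `H^σ` norm
  -- of the coefficient, at most `a`, in the second.
  refine ⟨Real.sqrt (K₁ * (K₂ ^ 2 + 1)), Real.sqrt_nonneg _, fun N f a g b hf hb hg1 hg2 => ?_⟩
  have ha := hf.nonneg
  have hw := hK₂ _ _ hf.hsE_le
  have h := hK₁ N f _ g (.of_continuous hf.cont (hK₃ f a hf)) hf.coeFn
    (hw.trans_lt ENNReal.ofReal_lt_top)
  have h1 : ‖comm σ N f g‖ₑ ^ 2 ≤ ENNReal.ofReal (K₁ * ((K₂ * a * b) ^ 2 + (a * b) ^ 2)) := by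
    refine h.trans ?_
    rw [ENNReal.ofReal_mul (NNReal.coe_nonneg K₁), ENNReal.ofReal_coe_nnreal,
      ENNReal.ofReal_add (by positivity) (by positivity), ENNReal.ofReal_pow (by positivity),
      ENNReal.ofReal_pow (by positivity), ENNReal.ofReal_mul (by positivity),
      ENNReal.ofReal_mul ha]
    gcongr
    exact (hsE_mono hσs _).trans hf.hsE_le
  rw [← ofReal_norm, ← ENNReal.ofReal_pow (norm_nonneg _),
    ENNReal.ofReal_le_ofReal_iff (by positivity)] at h1
  refine (sq_le_sq₀ (norm_nonneg _) (by positivity)).1 (h1.trans (le_of_eq ?_))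
  rw [mul_assoc (Real.sqrt _), mul_pow (Real.sqrt _), Real.sq_sqrt (by positivity)]
  ring

theorem mulL_toL2 {f g : ℝ → ℝ} (hf : IsBddMeas f)
    (hg : MemLp (fun x => (g x : ℂ)) 2 (volume : Measure ℝ)) :
    MemLp (fun x => ((f x * g x : ℝ) : ℂ)) 2 (volume : Measure ℝ) ∧
      mulL f (toL2 g) = toL2 (fun x => f x * g x) := by
  have h1 : MemLp (fun x => ((f x * g x : ℝ) : ℂ)) 2 (volume : Measure ℝ) := by
    refine (hf.memLp (toL2 g)).ae_eq ?_
    filter_upwards [coeFn_toL2 hg] with x h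
    rw [h]
    push_cast
    rfl
  refine ⟨h1, ?_⟩
  ext1
  filter_upwards [coeFn_mulL hf (toL2 g), coeFn_toL2 hg, coeFn_toL2 h1] with x e1 e2 e3
  rw [e1, e2, e3]
  push_cast
  rfl

/-- `H^s` is an algebra for `s > 3/2`. -/
theorem exists_hsBdd_mul {s : ℝ} (hs : 3 / 2 < s) :
    ∃ K : ℝ, 0 ≤ K ∧ ∀ (f g : ℝ → ℝ) (a b : ℝ), HsBdd s f a → HsBdd s g b →
      HsBdd s (fun x => f x * g x) (K * (a * b)) := by
  obtain ⟨K₁, hK₁0, hK₁⟩ := exists_norm_comm_le (s := s) (σ := s) hs (by linarith) le_rfl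
  obtain ⟨K₂, hK₂0, hK₂⟩ := exists_wiener_le_of_hsE (τ := 0) (p := s) (by linarith)
  obtain ⟨K₃, hK₃0, hK₃⟩ := exists_abs_le_of_hsBdd (p := s) (by linarith)
  refine ⟨K₁ * (1 + K₂) + K₃, by positivity, fun f g a b hf hg => ?_⟩
  have ha := hf.nonneg
  have hb := hg.nonneg
  have hfb : IsBddMeas f := .of_continuous hf.cont (hK₃ f a hf)
  obtain ⟨hm, he⟩ := mulL_toL2 hfb hg.memLp
  refine .of_forall (hf.cont.mul hg.cont) (by positivity) (by linarith) hm fun N => ?_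
  -- `Λ(fg) = [Λ, f] g + f Λg`: the product estimate is a consequence of the commutator estimate and
  -- of the sup bound on `f`.
  have h1 : Lam s N (toL2 fun x => f x * g x) =
      comm s N f (toL2 g) + mulL f (Lam s N (toL2 g)) := by
    rw [comm_apply, he]
    abel
  have h2 := hK₁ N f a (toL2 g) ((1 + K₂) * b) hf (by positivity)
    (((hsE_mono (by linarith) _).trans hg.hsE_le).trans
      (ENNReal.ofReal_le_ofReal (by nlinarith [mul_nonneg hK₂0 hb])))
    ((hK₂ _ _ hg.hsE_le).trans (ENNReal.ofReal_le_ofReal (by nlinarith)))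
  have h3 := norm_mulL_apply_le hfb (hK₃ f a hf) (Lam s N (toL2 g))
  have h4 := mul_le_mul_of_nonneg_left (hg.norm_Lam_le (by linarith) N)
    (mul_nonneg hK₃0 ha)
  rw [h1]
  refine (norm_add_le _ _).trans ((add_le_add h2 (h3.trans h4)).trans (le_of_eq ?_))
  ring

theorem norm_le_of_mulL {b : ℝ → ℝ} (hb : IsBddMeas b) {h₀ : ℝ} (h₀0 : 0 < h₀)
    (h : ∀ x, h₀ ≤ b x) (g : L2) : ‖g‖ ≤ h₀⁻¹ * ‖mulL b g‖ := by
  refine norm_le_of_ae_le ?_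
  filter_upwards [coeFn_mulL hb g] with x hx
  rw [hx, norm_mul, Complex.norm_real, Real.norm_of_nonneg (h₀0.le.trans (h x)), ← mul_assoc]
  refine le_mul_of_one_le_left (norm_nonneg _) ?_
  rw [inv_mul_eq_div, one_le_div h₀0]
  exact h x

/-- `H^s` is stable under `f ↦ f / (c + f)` where `c + f` is bounded from below. -/
theorem exists_hsBdd_div {s : ℝ} (hs : 3 / 2 < s) (A h₀ : ℝ) (h₀0 : 0 < h₀) :
    ∃ K : ℝ, 0 ≤ K ∧ ∀ (c : ℝ) (f : ℝ → ℝ) (a : ℝ), HsBdd s f a → a ≤ A →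
      (∀ x, h₀ ≤ c + f x) → HsBdd s (fun x => f x / (c + f x)) (K * a) := by
  obtain ⟨Kb, hKb0, hKb⟩ := exists_abs_le_of_hsBdd (p := s) (by linarith)
  obtain ⟨Kw, hKw0, hKw⟩ := exists_wiener_le_of_hsE (τ := 1) (p := s) (by linarith)
  obtain ⟨Kv, hKv0, hKv⟩ := exists_wiener_le_of_hsE (τ := 0) (p := 1) (by norm_num)
  set i := h₀⁻¹ with hi
  have hi0 : 0 < i := inv_pos.2 h₀0
  -- With `G = f / (c + f)` one has `(c + f) Λ^σ G = Λ^σ f - [Λ^σ, f] G`, and `c + f ≥ h₀` can be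
  -- divided out. The constant `c` commutes with `Λ^σ`, so it does not appear in the bounds.
  have setup : ∀ (c : ℝ) (f : ℝ → ℝ) (a : ℝ), HsBdd s f a → (∀ x, h₀ ≤ c + f x) →
      Continuous (fun x => f x / (c + f x)) ∧
      MemLp (fun x => ((f x / (c + f x) : ℝ) : ℂ)) 2 (volume : Measure ℝ) ∧
      ‖toL2 (fun x => f x / (c + f x))‖ ≤ i * a ∧
      ∀ σ N, 0 ≤ σ → σ ≤ s → ‖Lam σ N (toL2 (fun x => f x / (c + f x)))‖ ≤
        i * (a + ‖comm σ N f (toL2 (fun x => f x / (c + f x)))‖) := by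
    intro c f a hf hc
    have hpos : ∀ x, 0 < c + f x := fun x => h₀0.trans_le (hc x)
    have hcont : Continuous (fun x => f x / (c + f x)) :=
      hf.cont.div (continuous_const.add hf.cont) fun x => (hpos x).ne'
    have hbd : ∀ x, |(c + f x)⁻¹| ≤ i := fun x => by
      rw [abs_of_pos (inv_pos.2 (hpos x))]
      exact inv_anti₀ h₀0 (hc x)
    have hinv : IsBddMeas (fun x => (c + f x)⁻¹) :=
      .of_continuous ((continuous_const.add hf.cont).inv₀ fun x => (hpos x).ne') hbd
    obtain ⟨hm, he⟩ := mulL_toL2 hinv hf.memLp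
    have e : (fun x => (c + f x)⁻¹ * f x) = fun x => f x / (c + f x) :=
      funext fun x => by rw [div_eq_inv_mul]
    rw [e] at he
    have hm' : MemLp (fun x => ((f x / (c + f x) : ℝ) : ℂ)) 2 (volume : Measure ℝ) := by
      simpa only [div_eq_inv_mul] using hm
    have hfb : IsBddMeas f := .of_continuous hf.cont (hKb f a hf)
    have hb : IsBddMeas (fun x => c + f x) :=
      .of_continuous (C := |c| + Kb * a) (continuous_const.add hf.cont) fun x =>
        (abs_add_le _ _).trans (add_le_add le_rfl (hKb f a hf x))
    have hcf : ∀ g : L2, mulL (fun x => c + f x) g = (c : ℂ) • g + mulL f g := by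
      intro g
      ext1
      filter_upwards [coeFn_mulL hb g, coeFn_mulL hfb g, Lp.coeFn_smul (c : ℂ) g,
        Lp.coeFn_add ((c : ℂ) • g) (mulL f g)] with x h1 h2 h3 h4
      rw [h1, h4, Pi.add_apply, h2, h3, Pi.smul_apply, smul_eq_mul]
      push_cast
      ring
    have hbG : mulL (fun x => c + f x) (toL2 fun x => f x / (c + f x)) = toL2 f := by
      rw [(mulL_toL2 hb hm').2]
      congr 1
      ext x
      exact mul_div_cancel₀ _ (hpos x).ne'
    refine ⟨hcont, hm', ?_, fun σ N hσ hσs => ?_⟩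
    · rw [← he]
      exact (norm_mulL_apply_le hinv hbd _).trans
        (mul_le_mul_of_nonneg_left (hf.norm_toL2_le (by linarith)) hi0.le)
    · set G := toL2 fun x => f x / (c + f x)
      refine (norm_le_of_mulL hb h₀0 hc _).trans (mul_le_mul_of_nonneg_left ?_ hi0.le)
      have h1 : mulL (fun x => c + f x) (Lam σ N G) = Lam σ N (toL2 f) - comm σ N f G := by
        rw [← hbG, hcf, hcf, comm_apply, map_add, map_smul]
        abel
      rw [h1]
      exact (norm_sub_le _ _).trans (add_le_add ((hf.mono_exp hσs).norm_Lam_le hσ N) le_rfl)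
  -- Bootstrap on the regularity of `G`: the commutator of order `σ` needs `G` only in `H^{σ-1}` and
  -- in the Wiener algebra. The start, from `L²` to `H¹`, uses the commutator of order one; from
  -- then on `H¹` controls the Wiener norm.
  have step : ∀ n : ℕ, ∃ K : ℝ, 0 ≤ K ∧ ∀ (c : ℝ) (f : ℝ → ℝ) (a : ℝ), HsBdd s f a → a ≤ A →
      (∀ x, h₀ ≤ c + f x) →
      hsE (min (n + 1) s) (toL2 (fun x => f x / (c + f x))) ≤ ENNReal.ofReal (K * a) := by
    intro n
    induction n with
    | zero =>
      refine ⟨i * (1 + Kw * |A| * i), by positivity, fun c f a hf haA hc => ?_⟩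
      have ha := hf.nonneg
      obtain ⟨hcont, hm, hG, hL⟩ := setup c f a hf hc
      have hmin : min (((0 : ℕ) : ℝ) + 1) s = 1 := by
        rw [min_eq_left (by push_cast; linarith)]
        simp
      rw [hmin]
      refine hsE_le_of_forall zero_le_one fun N => ?_
      rw [← ofReal_norm]
      refine ENNReal.ofReal_le_ofReal ((hL 1 N zero_le_one (by linarith)).trans ?_)
      rw [mul_assoc]
      refine mul_le_mul_of_nonneg_left ?_ hi0.le
      have hw := hKw _ _ hf.hsE_le
      have h1 := enorm_comm_one_le N (.of_continuous hf.cont (hKb f a hf)) hf.coeFn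
        (hw.trans_lt ENNReal.ofReal_lt_top) (toL2 fun x => f x / (c + f x))
      have h2 := h1.trans (mul_le_mul_left hw _)
      rw [← ofReal_norm, ← ofReal_norm, ← ENNReal.ofReal_mul (by positivity),
        ENNReal.ofReal_le_ofReal_iff (by positivity)] at h2
      have h3 := mul_le_mul_of_nonneg_left hG (mul_nonneg hKw0 ha)
      -- One of the two factors `a` is traded for `|A|`, so that the bound stays linear in `a`.
      have h4 : Kw * a * (i * a) ≤ Kw * |A| * i * a := by
        have : Kw * i * a * a ≤ Kw * i * a * |A| :=
          mul_le_mul_of_nonneg_left (haA.trans (le_abs_self A)) (by positivity)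
        linarith
      linarith
    | succ n ih =>
      obtain ⟨K, hK0, hK⟩ := ih
      have hσ1 : 1 ≤ min (((n + 1 : ℕ) : ℝ) + 1) s :=
        le_min (by push_cast; linarith [n.cast_nonneg (α := ℝ)]) (by linarith)
      obtain ⟨Kc, hKc0, hKc⟩ := exists_norm_comm_le (s := s) hs hσ1 (min_le_right _ _)
      refine ⟨i * (1 + Kc * |A| * ((1 + Kv) * K)), by positivity, fun c f a hf haA hc => ?_⟩
      have ha := hf.nonneg
      obtain ⟨hcont, hm, hG, hL⟩ := setup c f a hf hc
      have hprev := hK c f a hf haA hc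
      refine hsE_le_of_forall (by linarith) fun N => ?_
      rw [← ofReal_norm]
      refine ENNReal.ofReal_le_ofReal ((hL _ N (by linarith) (min_le_right _ _)).trans ?_)
      rw [mul_assoc]
      refine mul_le_mul_of_nonneg_left ?_ hi0.le
      have hone : (1 : ℝ) ≤ min ((n : ℝ) + 1) s :=
        le_min (by linarith [n.cast_nonneg (α := ℝ)]) (by linarith)
      have h1 := hKc N f a (toL2 fun x => f x / (c + f x)) ((1 + Kv) * (K * a)) hf
        (by positivity)
        (((hsE_mono (by
          rw [le_min_iff]
          constructor
          · have := min_le_left (((n + 1 : ℕ) : ℝ) + 1) s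
            push_cast at this ⊢
            linarith
          · linarith [min_le_right (((n + 1 : ℕ) : ℝ) + 1) s]) _).trans hprev).trans
          (ENNReal.ofReal_le_ofReal (by nlinarith [mul_nonneg hKv0 (mul_nonneg hK0 ha)])))
        ((hKv _ _ ((hsE_mono hone _).trans hprev)).trans
          (ENNReal.ofReal_le_ofReal (by nlinarith [mul_nonneg hK0 ha])))
      have h4 : Kc * a * ((1 + Kv) * (K * a)) ≤ Kc * |A| * ((1 + Kv) * K) * a := by
        have : Kc * ((1 + Kv) * K) * a * a ≤ Kc * ((1 + Kv) * K) * a * |A| :=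
          mul_le_mul_of_nonneg_left (haA.trans (le_abs_self A)) (by positivity)
        linarith
      linarith
  obtain ⟨K, hK0, hK⟩ := step ⌈s⌉₊
  refine ⟨K, hK0, fun c f a hf haA hc => ?_⟩
  obtain ⟨hcont, hm, hG, hL⟩ := setup c f a hf hc
  refine ⟨hcont, mul_nonneg hK0 hf.nonneg, ?_⟩
  have h := hK c f a hf haA hc
  rw [min_eq_right (by linarith [Nat.le_ceil s])] at h
  rwa [hsNorm_eq hm]

/-! ### The symmetrizer and the structure of the system -/

/-- The parameters are bounded in terms of `P`. -/
structure Adm (P γ δ : ℝ) : Prop where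
  one_le : 1 ≤ P
  le_γ : P⁻¹ ≤ γ
  γ_lt : γ < 1
  le_δ : P⁻¹ ≤ δ
  δ_le : δ ≤ P

namespace Adm

variable {P γ δ : ℝ}

theorem P_pos (h : Adm P γ δ) : 0 < P := one_pos.trans_le h.one_le
theorem γ_pos (h : Adm P γ δ) : 0 < γ := (inv_pos.2 h.P_pos).trans_le h.le_γ
theorem δ_pos (h : Adm P γ δ) : 0 < δ := (inv_pos.2 h.P_pos).trans_le h.le_δ

/-- A factor `1 - γ` absorbs `r⁻¹` and leaves `r (γ + δ)`; this is the source of the uniformity as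
`r → 0`. -/
theorem rho_sq (h : Adm P γ δ) : rho γ δ ^ 2 * (γ + δ) = 1 - γ := by
  have := add_pos h.γ_pos h.δ_pos
  rw [rho, Real.sq_sqrt (div_nonneg (by linarith [h.γ_lt]) this.le), div_mul_cancel₀ _ this.ne']

theorem rho_pos (h : Adm P γ δ) : 0 < rho γ δ :=
  Real.sqrt_pos.2 (div_pos (by linarith [h.γ_lt]) (add_pos h.γ_pos h.δ_pos))

theorem rho_le (h : Adm P γ δ) : rho γ δ ≤ P := by
  rw [rho]
  refine Real.sqrt_le_iff.2 ⟨h.P_pos.le, ?_⟩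
  rw [div_le_iff₀ (add_pos h.γ_pos h.δ_pos)]
  have h1 : 1 ≤ P * γ := by
    have := mul_le_mul_of_nonneg_left h.le_γ h.P_pos.le
    rwa [mul_inv_cancel₀ h.P_pos.ne'] at this
  nlinarith [h.one_le, h.γ_pos, h.δ_pos, mul_pos h.P_pos h.P_pos,
    mul_pos (mul_pos h.P_pos h.P_pos) h.δ_pos, mul_le_mul h.one_le h1 (by norm_num) h.P_pos.le]

theorem inv_γ_le (h : Adm P γ δ) : γ⁻¹ ≤ P := inv_le_of_inv_le₀ h.P_pos h.le_γ
theorem inv_δ_le (h : Adm P γ δ) : δ⁻¹ ≤ P := inv_le_of_inv_le₀ h.P_pos h.le_δ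

end Adm

/-- The functions of the parameters and of the unknown that are generated by the coordinates and
the inverse of the total depth, with bounded coefficients. -/
inductive Tame (P : ℝ) : (ℝ → ℝ → (Fin 4 → ℝ) → ℝ) → Prop
  | const (c : ℝ → ℝ → ℝ) (h : ∃ K : ℝ, ∀ γ δ, Adm P γ δ → |c γ δ| ≤ K) :
      Tame P fun γ δ _ => c γ δ
  | coord (i : Fin 4) : Tame P fun _ _ V => V i
  | inv : Tame P fun γ δ V => (depth₁ γ δ V + depth₂ δ V)⁻¹
  | add {f g} : Tame P f → Tame P g → Tame P fun γ δ V => f γ δ V + g γ δ V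
  | mul {f g} : Tame P f → Tame P g → Tame P fun γ δ V => f γ δ V * g γ δ V

/-- The coordinate `ζ₂` cancels: the total depth is a constant plus a multiple of one coordinate,
the form treated by `exists_hsBdd_div`. -/
theorem total_eq (γ δ : ℝ) (V : Fin 4 → ℝ) :
    depth₁ γ δ V + depth₂ δ V = (1 + δ⁻¹) + rho γ δ * V 0 := by
  simp only [depth₁, depth₂]
  ring

namespace Tame

variable {P : ℝ} {f g : ℝ → ℝ → (Fin 4 → ℝ) → ℝ}

theorem num (c : ℝ) : Tame P fun _ _ _ => c := .const _ ⟨|c|, fun _ _ _ => le_rfl⟩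

theorem gam : Tame P fun γ _ _ => γ := .const (fun γ _ => γ) ⟨1, fun γ δ h => by
  rw [abs_of_pos h.γ_pos]
  exact h.γ_lt.le⟩

theorem del : Tame P fun _ δ _ => δ := .const (fun _ δ => δ) ⟨P, fun γ δ h => by
  rw [abs_of_pos h.δ_pos]
  exact h.δ_le⟩

theorem gamInv : Tame P fun γ _ _ => γ⁻¹ := .const (fun γ _ => γ⁻¹) ⟨P, fun γ δ h => by
  rw [abs_of_pos (inv_pos.2 h.γ_pos)]
  exact h.inv_γ_le⟩

theorem delInv : Tame P fun _ δ _ => δ⁻¹ := .const (fun _ δ => δ⁻¹) ⟨P, fun γ δ h => by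
  rw [abs_of_pos (inv_pos.2 h.δ_pos)]
  exact h.inv_δ_le⟩

/-- `r` is an allowed coefficient whereas `r⁻¹` is unbounded as `γ → 1`: a tame expression is one
that is controlled uniformly in `r`. -/
theorem rh : Tame P fun γ δ _ => rho γ δ := .const _ ⟨P, fun γ δ h => by
  rw [abs_of_pos h.rho_pos]
  exact h.rho_le⟩

theorem neg (hf : Tame P f) : Tame P fun γ δ V => -f γ δ V := by
  simpa using (num (-1)).mul hf

theorem sub (hf : Tame P f) (hg : Tame P g) : Tame P fun γ δ V => f γ δ V - g γ δ V := by
  simpa [sub_eq_add_neg] using hf.add hg.neg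

theorem dep₁ : Tame P fun γ δ V => depth₁ γ δ V :=
  ((num 1).add (rh.mul (coord 0))).sub (coord 1)

theorem dep₂ : Tame P fun _ δ V => depth₂ δ V := delInv.add (coord 1)

theorem vel₁ : Tame P fun γ δ V => chgF γ δ V 2 := by
  have := ((coord 3).sub (dep₂.mul (coord 2))).mul ((gamInv (P := P)).mul inv)
  convert this using 4
  simp only [chgF, Matrix.cons_val]
  rw [div_eq_mul_inv, mul_inv]

theorem vel₂ : Tame P fun γ δ V => chgF γ δ V 3 := by
  have := ((coord 3).add (dep₁.mul (coord 2))).mul (inv (P := P))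
  convert this using 4
  simp only [chgF, Matrix.cons_val]
  rw [div_eq_mul_inv]

/-- Tame functions are bounded and Lipschitz. -/
theorem exists_lipschitz (hf : Tame P f) (B h₀ : ℝ) (h₀0 : 0 < h₀) :
    ∃ K : ℝ, 0 ≤ K ∧ ∀ γ δ, Adm P γ δ → ∀ V V' : Fin 4 → ℝ, (∀ i, |V i| ≤ B) →
      (∀ i, |V' i| ≤ B) → h₀ ≤ depth₁ γ δ V + depth₂ δ V → h₀ ≤ depth₁ γ δ V' + depth₂ δ V' →
      |f γ δ V| ≤ K ∧ ∀ d, (∀ i, |V i - V' i| ≤ d) → |f γ δ V - f γ δ V'| ≤ K * d := by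
  induction hf with
  | const c h =>
    obtain ⟨K, hK⟩ := h
    refine ⟨|K|, abs_nonneg _, fun γ δ ha V V' _ _ _ _ => ⟨(hK γ δ ha).trans (le_abs_self _),
      fun d hd => ?_⟩⟩
    have := (abs_nonneg _).trans (hd 0)
    simpa using by positivity
  | coord i =>
    refine ⟨|B| + 1, by positivity, fun γ δ ha V V' hV _ _ _ =>
      ⟨(hV i).trans (by linarith [le_abs_self B]), fun d hd => (hd i).trans ?_⟩⟩
    have := (abs_nonneg _).trans (hd 0)
    nlinarith [abs_nonneg B]
  | inv =>
    refine ⟨h₀⁻¹ + |P| * h₀⁻¹ ^ 2, by positivity, fun γ δ ha V V' _ _ h h' => ?_⟩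
    have hp := h₀0.trans_le h
    have hp' := h₀0.trans_le h'
    have e := inv_anti₀ h₀0 h
    have e' := inv_anti₀ h₀0 h'
    have hP : 0 ≤ |P| * h₀⁻¹ ^ 2 := by positivity
    refine ⟨?_, fun d hd => ?_⟩
    · rw [abs_of_pos (inv_pos.2 hp)]
      linarith
    · have hd0 := (abs_nonneg _).trans (hd 0)
      rw [inv_sub_inv hp.ne' hp'.ne', abs_div, abs_of_pos (mul_pos hp hp'), div_eq_mul_inv,
        mul_inv]
      have h1 : |depth₁ γ δ V' + depth₂ δ V' - (depth₁ γ δ V + depth₂ δ V)| ≤ |P| * d := by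
        rw [total_eq, total_eq]
        have : (1 + δ⁻¹) + rho γ δ * V' 0 - ((1 + δ⁻¹) + rho γ δ * V 0)
            = rho γ δ * -(V 0 - V' 0) := by ring
        rw [this, abs_mul, abs_neg, abs_of_pos ha.rho_pos]
        exact mul_le_mul (ha.rho_le.trans (le_abs_self _)) (hd 0) (abs_nonneg _) (abs_nonneg _)
      have h2 : (depth₁ γ δ V + depth₂ δ V)⁻¹ * (depth₁ γ δ V' + depth₂ δ V')⁻¹ ≤ h₀⁻¹ ^ 2 := by
        rw [sq]
        exact mul_le_mul e e' (inv_pos.2 hp').le (inv_pos.2 h₀0).le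
      refine (mul_le_mul h1 h2 (mul_pos (inv_pos.2 hp) (inv_pos.2 hp')).le (by positivity)).trans ?_
      nlinarith [inv_pos.2 h₀0]
  | add _ _ ihf ihg =>
    obtain ⟨K, hK0, hK⟩ := ihf
    obtain ⟨L, hL0, hL⟩ := ihg
    refine ⟨K + L, by positivity, fun γ δ ha V V' hV hV' h h' => ?_⟩
    obtain ⟨h1, h2⟩ := hK γ δ ha V V' hV hV' h h'
    obtain ⟨h3, h4⟩ := hL γ δ ha V V' hV hV' h h'
    refine ⟨(abs_add_le _ _).trans (add_le_add h1 h3), fun d hd => ?_⟩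
    rw [add_sub_add_comm, add_mul]
    exact (abs_add_le _ _).trans (add_le_add (h2 d hd) (h4 d hd))
  | @mul f g _ _ ihf ihg =>
    obtain ⟨K, hK0, hK⟩ := ihf
    obtain ⟨L, hL0, hL⟩ := ihg
    refine ⟨K * L + K * L + K * L, by positivity, fun γ δ ha V V' hV hV' h h' => ?_⟩
    obtain ⟨h1, h2⟩ := hK γ δ ha V V' hV hV' h h'
    obtain ⟨h3, h4⟩ := hL γ δ ha V V' hV hV' h h'
    obtain ⟨h5, -⟩ := hL γ δ ha V' V hV' hV h' h
    have hKL : 0 ≤ K * L := by positivity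
    refine ⟨?_, fun d hd => ?_⟩
    · rw [abs_mul]
      refine (mul_le_mul h1 h3 (abs_nonneg _) hK0).trans (by linarith)
    · have hd0 := (abs_nonneg _).trans (hd 0)
      have e : f γ δ V * g γ δ V - f γ δ V' * g γ δ V'
          = f γ δ V * (g γ δ V - g γ δ V') + (f γ δ V - f γ δ V') * g γ δ V' := by ring
      rw [e]
      refine (abs_add_le _ _).trans ?_
      rw [abs_mul, abs_mul]
      have e1 := mul_le_mul h1 (h4 d hd) (abs_nonneg _) hK0
      have e2 := mul_le_mul (h2 d hd) h5 (abs_nonneg _) (by positivity)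
      nlinarith [mul_nonneg hKL hd0]

/-- Tame functions of a vector field in `H^s` are in `H^s` up to constants. -/
theorem exists_hsBdd {s : ℝ} (hs : 3 / 2 < s) (hf : Tame P f) (A h₀ : ℝ) (h₀0 : 0 < h₀) :
    ∃ K : ℝ, 0 ≤ K ∧ ∀ γ δ, Adm P γ δ → |f γ δ 0| ≤ K ∧
      ∀ (V : ℝ → Fin 4 → ℝ) (a : ℝ), (∀ i, HsBdd s (fun x => V x i) a) → a ≤ A →
      (∀ x, h₀ ≤ depth₁ γ δ (V x) + depth₂ δ (V x)) →
      HsBdd s (fun x => f γ δ (V x) - f γ δ 0) (K * a) := by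
  have hs0 : 0 ≤ s := by linarith
  induction hf with
  | const c h =>
    obtain ⟨K, hK⟩ := h
    refine ⟨|K|, abs_nonneg _, fun γ δ ha => ⟨(hK γ δ ha).trans (le_abs_self _),
      fun V a hV haA hH => ?_⟩⟩
    have h1 := ((hV 0).const_mul hs0 0).mono (b := |K| * a)
      (by simpa using mul_nonneg (abs_nonneg K) (hV 0).nonneg)
    simpa using h1
  | coord i =>
    refine ⟨1, zero_le_one, fun γ δ ha => ⟨by simp, fun V a hV haA hH => ?_⟩⟩
    simpa using hV i
  | inv =>
    obtain ⟨K, hK0, hK⟩ := exists_hsBdd_div hs (|P| * |A|) h₀ h₀0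
    refine ⟨1 + K * |P|, by positivity, fun γ δ ha => ?_⟩
    have hc : (1 : ℝ) ≤ 1 + δ⁻¹ := by linarith [inv_pos.2 ha.δ_pos]
    have hci : (1 + δ⁻¹)⁻¹ ≤ 1 := inv_le_one_of_one_le₀ hc
    have hci0 : 0 < (1 + δ⁻¹)⁻¹ := inv_pos.2 (by linarith)
    have hP : rho γ δ ≤ |P| := ha.rho_le.trans (le_abs_self P)
    refine ⟨?_, fun V a hV haA hH => ?_⟩
    · beta_reduce
      rw [total_eq, Pi.zero_apply, mul_zero, add_zero, abs_of_pos hci0]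
      have : 0 ≤ K * |P| := by positivity
      linarith
    · have ha0 := (hV 0).nonneg
      have h1 := (hV 0).const_mul hs0 (rho γ δ)
      rw [abs_of_pos ha.rho_pos] at h1
      have h2 := hK (1 + δ⁻¹) _ _ h1
        (mul_le_mul hP (haA.trans (le_abs_self A)) ha0 (abs_nonneg _))
        (fun x => by rw [← total_eq]; exact hH x)
      have h3 := (h2.const_mul hs0 (-(1 + δ⁻¹)⁻¹)).mono (b := (1 + K * |P|) * a) (by
        rw [abs_neg, abs_of_pos hci0]
        have e1 : K * (rho γ δ * a) ≤ K * (|P| * a) := by gcongr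
        have e2 : (1 + δ⁻¹)⁻¹ * (K * (rho γ δ * a)) ≤ 1 * (K * (rho γ δ * a)) :=
          mul_le_mul_of_nonneg_right hci
            (mul_nonneg hK0 (mul_nonneg ha.rho_pos.le ha0))
        nlinarith)
      -- The identity `1/(c + f) - 1/c = -(1/c) f/(c + f)` with `c = 1 + δ⁻¹` and `f = r ζ₁`.
      have e : (fun x => (depth₁ γ δ (V x) + depth₂ δ (V x))⁻¹ -
          (depth₁ γ δ (0 : Fin 4 → ℝ) + depth₂ δ (0 : Fin 4 → ℝ))⁻¹) =
          fun x => -(1 + δ⁻¹)⁻¹ * (rho γ δ * V x 0 / (1 + δ⁻¹ + rho γ δ * V x 0)) := by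
        ext x
        have hx := h₀0.trans_le (hH x)
        rw [total_eq] at hx ⊢
        rw [total_eq, Pi.zero_apply, mul_zero, add_zero]
        have hc0 : (1 + δ⁻¹) ≠ 0 := by linarith
        rw [inv_sub_inv hx.ne' hc0, div_eq_mul_inv, div_eq_mul_inv, mul_inv]
        ring
      rw [e]
      exact h3
  | @add f g _ _ ihf ihg =>
    obtain ⟨K, hK0, hK⟩ := ihf
    obtain ⟨L, hL0, hL⟩ := ihg
    refine ⟨K + L, by positivity, fun γ δ ha => ⟨(abs_add_le _ _).trans
      (add_le_add (hK γ δ ha).1 (hL γ δ ha).1), fun V a hV haA hH => ?_⟩⟩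
    have h1 := ((hK γ δ ha).2 V a hV haA hH).add hs0 ((hL γ δ ha).2 V a hV haA hH)
    simpa only [add_sub_add_comm, add_mul] using h1
  | @mul f g _ _ ihf ihg =>
    obtain ⟨K, hK0, hK⟩ := ihf
    obtain ⟨L, hL0, hL⟩ := ihg
    obtain ⟨m, hm0, hm⟩ := exists_hsBdd_mul hs
    refine ⟨K * L + K * L + m * (K * L * |A|) + K * L, by positivity, fun γ δ ha => ?_⟩
    have hKL : 0 ≤ K * L := by positivity
    have hKA : 0 ≤ m * (K * L * |A|) := by positivity
    refine ⟨?_, fun V a hV haA hH => ?_⟩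
    · rw [abs_mul]
      refine (mul_le_mul (hK γ δ ha).1 (hL γ δ ha).1 (abs_nonneg _) hK0).trans (by linarith)
    · have ha0 := (hV 0).nonneg
      have h1 := (hK γ δ ha).2 V a hV haA hH
      have h2 := (hL γ δ ha).2 V a hV haA hH
      -- With `f₀`, `g₀` the values at `0`: `fg - f₀g₀ = f₀(g - g₀) + g₀(f - f₀) + (f - f₀)(g -
      -- g₀)`. The last term, quadratic in `a`, is made linear using `a ≤ |A|`.
      have h3 := ((h2.const_mul hs0 (f γ δ 0)).add hs0 (h1.const_mul hs0 (g γ δ 0))).add hs0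
        (hm _ _ _ _ h1 h2)
      have h4 := h3.mono (b := (K * L + K * L + m * (K * L * |A|) + K * L) * a) (by
        have e1 : |f γ δ 0| * (L * a) ≤ K * (L * a) :=
          mul_le_mul_of_nonneg_right (hK γ δ ha).1 (by positivity)
        have e2 : |g γ δ 0| * (K * a) ≤ L * (K * a) :=
          mul_le_mul_of_nonneg_right (hL γ δ ha).1 (by positivity)
        have e3 : m * (K * a * (L * a)) ≤ m * (K * L * |A|) * a := by
          have : m * (K * L) * a * a ≤ m * (K * L) * a * |A| :=
            mul_le_mul_of_nonneg_left (haA.trans (le_abs_self A)) (by positivity)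
          linarith
        nlinarith [mul_nonneg hKL ha0])
      convert h4 using 2
      ring

end Tame

/-- A matrix with tame entries. -/
def MTame (P : ℝ) (A : ℝ → ℝ → (Fin 4 → ℝ) → Matrix (Fin 4) (Fin 4) ℝ) : Prop :=
  ∀ i j, Tame P fun γ δ V => A γ δ V i j

namespace MTame

variable {P : ℝ} {A B : ℝ → ℝ → (Fin 4 → ℝ) → Matrix (Fin 4) (Fin 4) ℝ}

theorem mul (hA : MTame P A) (hB : MTame P B) : MTame P fun γ δ V => A γ δ V * B γ δ V := by
  intro i j
  simp only [Matrix.mul_apply, Fin.sum_univ_four]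
  exact ((((hA i 0).mul (hB 0 j)).add ((hA i 1).mul (hB 1 j))).add
    ((hA i 2).mul (hB 2 j))).add ((hA i 3).mul (hB 3 j))

theorem add (hA : MTame P A) (hB : MTame P B) : MTame P fun γ δ V => A γ δ V + B γ δ V :=
  fun i j => (hA i j).add (hB i j)

theorem transpose (hA : MTame P A) : MTame P fun γ δ V => (A γ δ V)ᵀ := fun i j => hA j i

end MTame

/-- The inverse of `jacF`. -/
def jacG (γ δ : ℝ) (V : Fin 4 → ℝ) : Matrix (Fin 4) (Fin 4) ℝ :=
  !![1, 0, 0, 0;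
     0, 1, 0, 0;
     0, 0, -γ, 1;
     γ * rho γ δ * chgF γ δ V 2, chgF γ δ V 3 - γ * chgF γ δ V 2, γ * depth₁ γ δ V, depth₂ δ V]

/-- The symmetrizer of `matA`. -/
def matS (γ δ : ℝ) (U : Fin 4 → ℝ) : Matrix (Fin 4) (Fin 4) ℝ :=
  !![γ, 0, 0, 0;
     0, γ + δ, 0, U 3 - U 2;
     0, 0, γ * depth₁ γ δ U, 0;
     0, U 3 - U 2, 0, depth₂ δ U]

/-- The regular part of `matA`. -/
def regA (γ δ : ℝ) (U : Fin 4 → ℝ) : Matrix (Fin 4) (Fin 4) ℝ :=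
  !![U 2, 0, 0, 0;
     0, U 3, 0, depth₂ δ U;
     0, 0, U 2, 0;
     0, δ + γ, 0, U 3]

/-- The regular part of `matS * matA`. -/
def regS (γ δ : ℝ) (U : Fin 4 → ℝ) : Matrix (Fin 4) (Fin 4) ℝ :=
  !![γ * U 2, 0, 0, 0;
     0, (γ + δ) * (U 3 + (U 3 - U 2)), 0, (γ + δ) * depth₂ δ U + (U 3 - U 2) * U 3;
     0, 0, γ * depth₁ γ δ U * U 2, 0;
     0, (γ + δ) * depth₂ δ U + (U 3 - U 2) * U 3, 0, (U 3 - U 2) * depth₂ δ U + depth₂ δ U * U 3]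

/-- The remainder in `(0, u₂ - u₁, h₁, h₂) ⬝ dF = (0, 0, 0, 1) + r p`. -/
def vecP (γ δ : ℝ) (V : Fin 4 → ℝ) : Fin 4 → ℝ :=
  ![rho γ δ * (γ + δ) * (depth₁ γ δ V * jacF γ δ V 2 0 + chgF γ δ V 2 * rho γ δ) - chgF γ δ V 2,
    rho γ δ * (γ + δ) * (depth₁ γ δ V * jacF γ δ V 2 1 - chgF γ δ V 2),
    rho γ δ * (γ + δ) * (depth₁ γ δ V * jacF γ δ V 2 2),
    rho γ δ * (γ + δ) * (depth₁ γ δ V * jacF γ δ V 2 3)]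

/-- The vector `(0, u₂ - u₁, h₁, h₂)`. -/
def vecW (γ δ : ℝ) (U : Fin 4 → ℝ) : Fin 4 → ℝ := ![0, U 3 - U 2, depth₁ γ δ U, depth₂ δ U]

/-- The matrix of the system in the variable `V`. -/
def sysM (γ δ : ℝ) (V : Fin 4 → ℝ) : Matrix (Fin 4) (Fin 4) ℝ :=
  (rho γ δ)⁻¹ • matL γ δ + matB γ δ V

/-- The constant singular part of `sysM`, up to the factor `r⁻¹`. -/
def singM (γ δ : ℝ) : Matrix (Fin 4) (Fin 4) ℝ :=
  !![0, 0, 0, 1; 0, 0, 0, 0; 0, 0, 0, 0; γ * (1 + δ⁻¹), 0, 0, 0]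

/-- The regular part of `sysM`. -/
def regM (γ δ : ℝ) (V : Fin 4 → ℝ) : Matrix (Fin 4) (Fin 4) ℝ :=
  jacG γ δ V * regA γ δ (chgF γ δ V) * jacF γ δ V +
    Matrix.of ![vecP γ δ V, 0, 0, fun j => γ * chgF γ δ V 2 *
      (![0, 0, 0, 1] j + rho γ δ * vecP γ δ V j) + ![γ * V 0, 0, 0, 0] j]

/-- The symmetrizer of `sysM`. -/
def symT (γ δ : ℝ) (V : Fin 4 → ℝ) : Matrix (Fin 4) (Fin 4) ℝ :=
  (jacF γ δ V)ᵀ * matS γ δ (chgF γ δ V) * jacF γ δ V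

/-- The constant singular part of `symT * sysM`, up to the factor `r⁻¹`. -/
def singS (γ : ℝ) : Matrix (Fin 4) (Fin 4) ℝ :=
  !![0, 0, 0, γ; 0, 0, 0, 0; 0, 0, 0, 0; γ, 0, 0, 0]

/-- The regular part of `symT * sysM`. -/
def regT (γ δ : ℝ) (V : Fin 4 → ℝ) : Matrix (Fin 4) (Fin 4) ℝ :=
  (jacF γ δ V)ᵀ * regS γ δ (chgF γ δ V) * jacF γ δ V +
    (Matrix.of ![fun j => γ * vecP γ δ V j, 0, 0, 0] +
      (Matrix.of ![fun j => γ * vecP γ δ V j, 0, 0, 0])ᵀ)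

theorem depth₁_chgF (γ δ : ℝ) (V : Fin 4 → ℝ) : depth₁ γ δ (chgF γ δ V) = depth₁ γ δ V := rfl

theorem depth₂_chgF (γ δ : ℝ) (V : Fin 4 → ℝ) : depth₂ δ (chgF γ δ V) = depth₂ δ V := rfl

/-! ### Tameness of the matrices, entry by entry. -/

theorem mTame_jacF (P : ℝ) : MTame P jacF := by
  have H := Tame.inv (P := P)
  have G := Tame.gamInv (P := P)
  have r := Tame.rh (P := P)
  have h1 := Tame.dep₁ (P := P)
  have h2 := Tame.dep₂ (P := P)
  have v := fun i => Tame.coord (P := P) i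
  intro i j
  fin_cases i <;> fin_cases j
  · exact .num 1
  · exact .num 0
  · exact .num 0
  · exact .num 0
  · exact .num 0
  · exact .num 1
  · exact .num 0
  · exact .num 0
  · convert (r.mul ((v 3).sub (h2.mul (v 2)))).neg.mul (G.mul (H.mul H)) using 4
    simp only [jacF, Fin.zero_eta, Fin.reduceFinMk, Matrix.of_apply, Matrix.cons_val]
    rw [div_eq_mul_inv, mul_inv, sq, mul_inv]
  · convert (v 2).neg.mul (G.mul H) using 4
    simp only [jacF, Fin.mk_one, Fin.reduceFinMk, Matrix.of_apply, Matrix.cons_val]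
    rw [div_eq_mul_inv, mul_inv]
  · convert h2.neg.mul (G.mul H) using 4
    simp only [jacF, Fin.reduceFinMk, Matrix.of_apply, Matrix.cons_val]
    rw [div_eq_mul_inv, mul_inv]
  · convert G.mul H using 4
    simp only [jacF, Fin.reduceFinMk, Matrix.of_apply, Matrix.cons_val]
    rw [div_eq_mul_inv, mul_inv, one_mul]
  · convert ((r.mul (v 2)).mul H).sub ((r.mul ((v 3).add (h1.mul (v 2)))).mul (H.mul H)) using 4
    simp only [jacF, Fin.zero_eta, Fin.reduceFinMk, Matrix.of_apply, Matrix.cons_val]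
    rw [div_eq_mul_inv, div_eq_mul_inv, sq, mul_inv]
  · convert (v 2).neg.mul H using 4
    exact div_eq_mul_inv _ _
  · convert h1.mul H using 4
    exact div_eq_mul_inv _ _
  · convert H using 4
    simp only [jacF, Fin.reduceFinMk, Matrix.of_apply, Matrix.cons_val]
    rw [one_div]

theorem tame_vecP (P : ℝ) (j : Fin 4) : Tame P fun γ δ V => vecP γ δ V j := by
  have g := Tame.gam (P := P)
  have r := Tame.rh (P := P)
  have c := r.mul (g.add .del)
  have h1 := Tame.dep₁ (P := P)
  have u := Tame.vel₁ (P := P)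
  have J := mTame_jacF P 2
  fin_cases j
  · exact (c.mul ((h1.mul (J 0)).add (u.mul r))).sub u
  · exact c.mul ((h1.mul (J 1)).sub u)
  · exact c.mul (h1.mul (J 2))
  · exact c.mul (h1.mul (J 3))

theorem mTame_jacG (P : ℝ) : MTame P jacG := by
  have g := Tame.gam (P := P)
  intro i j
  fin_cases i <;> fin_cases j
  · exact .num 1
  · exact .num 0
  · exact .num 0
  · exact .num 0
  · exact .num 0
  · exact .num 1
  · exact .num 0
  · exact .num 0
  · exact .num 0
  · exact .num 0
  · exact g.neg
  · exact .num 1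
  · exact (g.mul .rh).mul .vel₁
  · exact Tame.vel₂.sub (g.mul .vel₁)
  · exact g.mul .dep₁
  · exact .dep₂

theorem mTame_matS (P : ℝ) : MTame P fun γ δ V => matS γ δ (chgF γ δ V) := by
  have g := Tame.gam (P := P)
  intro i j
  fin_cases i <;> fin_cases j
  · exact g
  · exact .num 0
  · exact .num 0
  · exact .num 0
  · exact .num 0
  · exact g.add .del
  · exact .num 0
  · exact Tame.vel₂.sub .vel₁
  · exact .num 0
  · exact .num 0
  · exact g.mul .dep₁
  · exact .num 0
  · exact .num 0
  · exact Tame.vel₂.sub .vel₁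
  · exact .num 0
  · exact .dep₂

theorem mTame_regA (P : ℝ) : MTame P fun γ δ V => regA γ δ (chgF γ δ V) := by
  intro i j
  fin_cases i <;> fin_cases j
  · exact .vel₁
  · exact .num 0
  · exact .num 0
  · exact .num 0
  · exact .num 0
  · exact .vel₂
  · exact .num 0
  · exact .dep₂
  · exact .num 0
  · exact .num 0
  · exact .vel₁
  · exact .num 0
  · exact .num 0
  · exact Tame.del.add .gam
  · exact .num 0
  · exact .vel₂

theorem mTame_regS (P : ℝ) : MTame P fun γ δ V => regS γ δ (chgF γ δ V) := by
  have g := Tame.gam (P := P)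
  have c := g.add .del
  have u1 := Tame.vel₁ (P := P)
  have u2 := Tame.vel₂ (P := P)
  have h2 := Tame.dep₂ (P := P)
  intro i j
  fin_cases i <;> fin_cases j
  · exact g.mul u1
  · exact .num 0
  · exact .num 0
  · exact .num 0
  · exact .num 0
  · exact c.mul (u2.add (u2.sub u1))
  · exact .num 0
  · exact (c.mul h2).add ((u2.sub u1).mul u2)
  · exact .num 0
  · exact .num 0
  · exact (g.mul .dep₁).mul u1
  · exact .num 0
  · exact .num 0
  · exact (c.mul h2).add ((u2.sub u1).mul u2)
  · exact .num 0
  · exact ((u2.sub u1).mul h2).add (h2.mul u2)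

theorem mTame_regM (P : ℝ) : MTame P regM := by
  refine MTame.add (((mTame_jacG P).mul (mTame_regA P)).mul (mTame_jacF P)) fun i j => ?_
  fin_cases i
  · exact tame_vecP P j
  · exact .num 0
  · exact .num 0
  · refine ((Tame.gam.mul .vel₁).mul ((Tame.num _).add (Tame.rh.mul (tame_vecP P j)))).add ?_
    fin_cases j
    · exact Tame.gam.mul (.coord 0)
    · exact .num 0
    · exact .num 0
    · exact .num 0

theorem mTame_symT (P : ℝ) : MTame P symT :=
  ((mTame_jacF P).transpose.mul (mTame_matS P)).mul (mTame_jacF P)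

theorem mTame_regT (P : ℝ) : MTame P regT := by
  have h : MTame P fun γ δ V => Matrix.of ![fun j => γ * vecP γ δ V j, 0, 0, 0] := fun i j => by
    fin_cases i
    · exact Tame.gam.mul (tame_vecP P j)
    · exact .num 0
    · exact .num 0
    · exact .num 0
  exact MTame.add (((mTame_jacF P).transpose.mul (mTame_regS P)).mul (mTame_jacF P))
    (h.add h.transpose)

/-! ### Algebraic identities for the symmetrized system. -/

section Identities

variable {P γ δ : ℝ} {V : Fin 4 → ℝ}

/-- `jacG` is the Jacobian of the inverse change of unknowns, `u_s = u₂ - γ u₁` and `m = γ h₁ u₁ +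
h₂ u₂`, evaluated at `F(V)`. -/
theorem jacG_mul_jacF (ha : Adm P γ δ) (hH : depth₁ γ δ V + depth₂ δ V ≠ 0) :
    jacG γ δ V * jacF γ δ V = 1 := by
  have hγ := ha.γ_pos.ne'
  ext i j
  fin_cases i <;> fin_cases j <;>
    simp [jacG, jacF, chgF, Matrix.mul_apply, Fin.sum_univ_four] <;> field_simp <;> ring

/-- `L_r` cancels against the definition of `B[V]`; its precise form plays no role in what follows,
where `singM` takes its place. -/
theorem sysM_eq (ha : Adm P γ δ) (hH : depth₁ γ δ V + depth₂ δ V ≠ 0) :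
    sysM γ δ V = jacG γ δ V * matA γ δ (chgF γ δ V) * jacF γ δ V := by
  rw [sysM, matB, add_sub_cancel, Matrix.inv_eq_left_inv (jacG_mul_jacF ha hH)]

/-- As a differential, the left side is `d(h₁u₁ + h₂u₂) - r u₁ dζ₁`. Now `h₁u₁ + h₂u₂ = m + (1 - γ)
h₁u₁` and `1 - γ = r² (γ + δ)`, so it equals `dm + r (r (γ + δ) d(h₁u₁) - u₁ dζ₁)`. This is what the
unknown `m` is for. -/
theorem vecW_vecMul_jacF (ha : Adm P γ δ) (hH : depth₁ γ δ V + depth₂ δ V ≠ 0) :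
    vecW γ δ (chgF γ δ V) ᵥ* jacF γ δ V =
      fun j => ![0, 0, 0, 1] j + rho γ δ * vecP γ δ V j := by
  have hγ := ha.γ_pos.ne'
  have hr := ha.rho_sq
  have hc : rho γ δ * (rho γ δ * (γ + δ)) = 1 - γ := by rw [← hr]; ring
  have e : ∀ y : ℝ, rho γ δ * (rho γ δ * (γ + δ) * y) = (1 - γ) * y := fun y => by
    rw [← hc]; ring
  ext j
  fin_cases j <;>
    simp [vecW, vecP, Matrix.vecMul, dotProduct, Fin.sum_univ_four, mul_sub, e, depth₁_chgF,
      depth₂_chgF] <;>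
    simp [jacF, chgF] <;> field_simp <;> ring

theorem matA_eq (U : Fin 4 → ℝ) : matA γ δ U = regA γ δ U + (rho γ δ)⁻¹ •
    (Matrix.vecMulVec ![1, 0, 0, 0] (vecW γ δ U) +
      Matrix.vecMulVec ![0, 0, 1, γ] ![1, 0, 0, 0]) := by
  ext i j
  fin_cases i <;> fin_cases j <;> simp [matA, regA, vecW] <;> ring

/-- `S` maps `e₁` to `γ e₁` and `e₃ + γ e₄` to `γ w`; the two rank-one singular terms of `matA_eq`
become transposes of each other. -/
theorem matS_mul_matA (U : Fin 4 → ℝ) : matS γ δ U * matA γ δ U = regS γ δ U +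
    (γ * (rho γ δ)⁻¹) • (Matrix.vecMulVec ![1, 0, 0, 0] (vecW γ δ U) +
      Matrix.vecMulVec (vecW γ δ U) ![1, 0, 0, 0]) := by
  ext i j
  fin_cases i <;> fin_cases j <;>
    simp [matA, matS, regS, vecW, Matrix.mul_apply, Fin.sum_univ_four] <;>
    ring

theorem e_vecMul_jacF : (![1, 0, 0, 0] : Fin 4 → ℝ) ᵥ* jacF γ δ V = ![1, 0, 0, 0] := by
  ext j
  fin_cases j <;> simp [jacF, Matrix.vecMul, dotProduct, Fin.sum_univ_four]

/-- In the rank-one terms of `A`, `dF⁻¹ e₁`, `dF⁻¹ (e₃ + γ e₄)` and `w ⬝ dF` are constant up to a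
multiple of `r`, which compensates `r⁻¹`. All dependence on `V` therefore lies in the regular part.
-/
theorem sysM_eq_sing_add_reg (ha : Adm P γ δ) (hH : depth₁ γ δ V + depth₂ δ V ≠ 0) :
    sysM γ δ V = (rho γ δ)⁻¹ • singM γ δ + regM γ δ V := by
  have hr := ha.rho_pos.ne'
  have h1 : jacG γ δ V *ᵥ ![1, 0, 0, 0] = ![1, 0, 0, γ * rho γ δ * chgF γ δ V 2] := by
    ext j
    fin_cases j <;> simp [jacG, Matrix.mulVec, dotProduct, Fin.sum_univ_four]
  have h2 : jacG γ δ V *ᵥ ![0, 0, 1, γ] =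
      ![0, 0, 0, γ * (1 + δ⁻¹) + rho γ δ * (γ * V 0)] := by
    ext j
    fin_cases j <;> simp [jacG, Matrix.mulVec, dotProduct, Fin.sum_univ_four, depth₁, depth₂]
    ring
  rw [sysM_eq ha hH, matA_eq, Matrix.mul_add, Matrix.add_mul, Matrix.mul_smul, Matrix.smul_mul,
    Matrix.mul_add, Matrix.add_mul, Matrix.mul_vecMulVec, Matrix.mul_vecMulVec,
    Matrix.vecMulVec_mul, Matrix.vecMulVec_mul, vecW_vecMul_jacF ha hH, e_vecMul_jacF, h1, h2,
    regM, add_left_comm]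
  congr 1
  ext i j
  simp only [Matrix.add_apply, Matrix.smul_apply, Matrix.vecMulVec_apply, Matrix.of_apply,
    smul_eq_mul]
  fin_cases i <;> fin_cases j <;>
    simp [singM] <;> field_simp <;> ring

/-- The product is `dFᵀ (S A) dF`, and `e₁ ⬝ dF = e₁`, `w ⬝ dF = e₄ + r p`. The singular part is
constant, so it disappears when the energy identity is integrated by parts. -/
theorem symT_mul_sysM (ha : Adm P γ δ) (hH : depth₁ γ δ V + depth₂ δ V ≠ 0) :
    symT γ δ V * sysM γ δ V = (rho γ δ)⁻¹ • singS γ + regT γ δ V := by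
  have hr := ha.rho_pos.ne'
  have h1 : jacF γ δ V * jacG γ δ V = 1 := mul_eq_one_comm.1 (jacG_mul_jacF ha hH)
  have h2 : symT γ δ V * sysM γ δ V =
      (jacF γ δ V)ᵀ * (matS γ δ (chgF γ δ V) * matA γ δ (chgF γ δ V)) * jacF γ δ V := by
    rw [sysM_eq ha hH, symT]
    calc _ = (jacF γ δ V)ᵀ * matS γ δ (chgF γ δ V) * (jacF γ δ V * jacG γ δ V) *
        matA γ δ (chgF γ δ V) * jacF γ δ V := by simp only [Matrix.mul_assoc]
      _ = _ := by rw [h1, Matrix.mul_one]; simp only [Matrix.mul_assoc]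
  rw [h2, matS_mul_matA, Matrix.mul_add, Matrix.add_mul, Matrix.mul_smul, Matrix.smul_mul,
    Matrix.mul_add, Matrix.add_mul, Matrix.mul_vecMulVec, Matrix.mul_vecMulVec,
    Matrix.vecMulVec_mul, Matrix.vecMulVec_mul, Matrix.mulVec_transpose, Matrix.mulVec_transpose,
    vecW_vecMul_jacF ha hH, e_vecMul_jacF, regT, add_left_comm]
  congr 1
  ext i j
  simp only [Matrix.add_apply, Matrix.smul_apply, Matrix.vecMulVec_apply, Matrix.of_apply,
    Matrix.transpose_apply, smul_eq_mul]
  fin_cases i <;> fin_cases j <;>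
    simp [singS] <;> field_simp

theorem symT_isSymm (γ δ : ℝ) (V : Fin 4 → ℝ) : (symT γ δ V)ᵀ = symT γ δ V := by
  have h : (matS γ δ (chgF γ δ V))ᵀ = matS γ δ (chgF γ δ V) := by
    ext i j
    fin_cases i <;> fin_cases j <;> rfl
  rw [symT, Matrix.transpose_mul, Matrix.transpose_mul, Matrix.transpose_transpose, h,
    Matrix.mul_assoc]

theorem regT_isSymm (γ δ : ℝ) (V : Fin 4 → ℝ) : (regT γ δ V)ᵀ = regT γ δ V := by
  have h : (regS γ δ (chgF γ δ V))ᵀ = regS γ δ (chgF γ δ V) := by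
    ext i j
    fin_cases i <;> fin_cases j <;> rfl
  rw [regT, Matrix.transpose_add, Matrix.transpose_add, Matrix.transpose_transpose,
    Matrix.transpose_mul, Matrix.transpose_mul, Matrix.transpose_transpose, h, Matrix.mul_assoc,
    add_comm (Matrix.of _)ᵀ]

end Identities

/-! ### Uniform bounds on tame matrices and coercivity of the symmetrizer. -/

theorem MTame.exists_lipschitz {P : ℝ} {A : ℝ → ℝ → (Fin 4 → ℝ) → Matrix (Fin 4) (Fin 4) ℝ}
    (hA : MTame P A) (B h₀ : ℝ) (h₀0 : 0 < h₀) :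
    ∃ K : ℝ, 0 ≤ K ∧ ∀ γ δ, Adm P γ δ → ∀ V V' : Fin 4 → ℝ, (∀ i, |V i| ≤ B) →
      (∀ i, |V' i| ≤ B) → h₀ ≤ depth₁ γ δ V + depth₂ δ V → h₀ ≤ depth₁ γ δ V' + depth₂ δ V' →
      ∀ i j, |A γ δ V i j| ≤ K ∧
        ∀ d, (∀ i, |V i - V' i| ≤ d) → |A γ δ V i j - A γ δ V' i j| ≤ K * d := by
  choose K hK0 hK using fun i j => (hA i j).exists_lipschitz B h₀ h₀0
  have hle : ∀ i j, K i j ≤ ∑ i, ∑ j, K i j := fun i j =>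
    (Finset.single_le_sum (fun k _ => hK0 i k) (Finset.mem_univ j)).trans
      (Finset.single_le_sum (f := fun i => ∑ j, K i j)
        (fun k _ => Finset.sum_nonneg fun l _ => hK0 k l) (Finset.mem_univ i))
  refine ⟨∑ i, ∑ j, K i j, Finset.sum_nonneg fun i _ => Finset.sum_nonneg fun j _ => hK0 i j,
    fun γ δ ha V V' hV hV' h h' i j => ?_⟩
  obtain ⟨h1, h2⟩ := hK i j γ δ ha V V' hV hV' h h'
  exact ⟨h1.trans (hle i j), fun d hd => (h2 d hd).trans
    (mul_le_mul_of_nonneg_right (hle i j) ((abs_nonneg _).trans (hd 0)))⟩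

theorem MTame.exists_hsBdd {P : ℝ} {A : ℝ → ℝ → (Fin 4 → ℝ) → Matrix (Fin 4) (Fin 4) ℝ} {s : ℝ}
    (hs : 3 / 2 < s) (hA : MTame P A) (B h₀ : ℝ) (h₀0 : 0 < h₀) :
    ∃ K : ℝ, 0 ≤ K ∧ ∀ γ δ, Adm P γ δ → ∀ (V : ℝ → Fin 4 → ℝ) (a : ℝ),
      (∀ i, HsBdd s (fun x => V x i) a) → a ≤ B →
      (∀ x, h₀ ≤ depth₁ γ δ (V x) + depth₂ δ (V x)) →
      ∀ i j, HsBdd s (fun x => A γ δ (V x) i j - A γ δ 0 i j) (K * a) := by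
  choose K hK0 hK using fun i j => (hA i j).exists_hsBdd hs B h₀ h₀0
  have hle : ∀ i j, K i j ≤ ∑ i, ∑ j, K i j := fun i j =>
    (Finset.single_le_sum (fun k _ => hK0 i k) (Finset.mem_univ j)).trans
      (Finset.single_le_sum (f := fun i => ∑ j, K i j)
        (fun k _ => Finset.sum_nonneg fun l _ => hK0 k l) (Finset.mem_univ i))
  refine ⟨∑ i, ∑ j, K i j, Finset.sum_nonneg fun i _ => Finset.sum_nonneg fun j _ => hK0 i j,
    fun γ δ ha V a hV haB hH i j => ?_⟩
  exact ((hK i j γ δ ha).2 V a hV haB hH).mono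
    (mul_le_mul_of_nonneg_right (hle i j) (hV 0).nonneg)

/-- A lower bound for the quadratic form `a z² + 2 d z w + h w²`. -/
theorem quadratic_lower_bound {a h d h₀ κ D z w : ℝ} (ha : κ ≤ a) (hκ : 0 < κ) (hκh : κ ≤ h₀)
    (hd : |d| ≤ D) (hh : h₀ ≤ h - d ^ 2 / a) :
    κ / (2 + 2 * (D / κ) ^ 2 + 1) * (z ^ 2 + w ^ 2) ≤ a * z ^ 2 + 2 * d * (z * w) + h * w ^ 2 := by
  have ha0 : 0 < a := hκ.trans_le ha
  have hD : 0 ≤ D := (abs_nonneg d).trans hd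
  set q := d / a with hq
  have hqa : d = q * a := by rw [hq, div_mul_cancel₀ _ ha0.ne']
  have h1 : d ^ 2 / a = q ^ 2 * a := by
    rw [hqa]
    field_simp
  rw [h1] at hh
  have hqD : q ^ 2 ≤ (D / κ) ^ 2 := by
    rw [← sq_abs q, hq, abs_div, abs_of_pos ha0]
    gcongr
  have hpos : 0 < 2 + 2 * (D / κ) ^ 2 + 1 := by positivity
  rw [div_mul_eq_mul_div, div_le_iff₀ hpos]
  -- Completing the square in `z` leaves the coefficient `h - d²/a` on `w²`, exactly the quantity
  -- bounded below by hyperbolicity.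
  have h2 : κ * ((z + q * w) ^ 2 + w ^ 2) ≤ a * z ^ 2 + 2 * d * (z * w) + h * w ^ 2 := by
    have e : a * z ^ 2 + 2 * d * (z * w) + h * w ^ 2 =
        a * (z + q * w) ^ 2 + (h - q ^ 2 * a) * w ^ 2 := by
      rw [hqa]
      ring
    rw [e, mul_add]
    exact add_le_add (mul_le_mul_of_nonneg_right ha (sq_nonneg _))
      (mul_le_mul_of_nonneg_right (hκh.trans hh) (sq_nonneg _))
  have h3 : z ^ 2 + w ^ 2 ≤ (2 + 2 * (D / κ) ^ 2 + 1) * ((z + q * w) ^ 2 + w ^ 2) := by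
    have e1 : z ^ 2 ≤ 2 * (z + q * w) ^ 2 + 2 * q ^ 2 * w ^ 2 := by
      nlinarith [sq_nonneg (z + 2 * (q * w))]
    have e2 : q ^ 2 * w ^ 2 ≤ (D / κ) ^ 2 * w ^ 2 := mul_le_mul_of_nonneg_right hqD (sq_nonneg _)
    nlinarith [sq_nonneg (z + q * w), sq_nonneg w, mul_nonneg (sq_nonneg (D / κ))
      (sq_nonneg (z + q * w))]
  calc κ * (z ^ 2 + w ^ 2) ≤ κ * ((2 + 2 * (D / κ) ^ 2 + 1) * ((z + q * w) ^ 2 + w ^ 2)) :=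
        mul_le_mul_of_nonneg_left h3 hκ.le
    _ = κ * ((z + q * w) ^ 2 + w ^ 2) * (2 + 2 * (D / κ) ^ 2 + 1) := by ring
    _ ≤ _ := mul_le_mul_of_nonneg_right h2 hpos.le

theorem sum_sq_mulVec_le {A : Matrix (Fin 4) (Fin 4) ℝ} {K : ℝ} (hA : ∀ i j, |A i j| ≤ K)
    (y : Fin 4 → ℝ) : ∑ i, (A *ᵥ y) i ^ 2 ≤ 16 * K ^ 2 * ∑ i, y i ^ 2 := by
  have h : ∀ i, (A *ᵥ y) i ^ 2 ≤ 4 * K ^ 2 * ∑ i, y i ^ 2 := by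
    intro i
    have h1 := Finset.sum_mul_sq_le_sq_mul_sq Finset.univ (fun j => A i j) y
    have h2 : ∑ j, A i j ^ 2 ≤ 4 * K ^ 2 := by
      refine (Finset.sum_le_sum fun j _ => (sq_le_sq' (abs_le.1 (hA i j)).1
        (abs_le.1 (hA i j)).2)).trans (le_of_eq ?_)
      simp
    exact h1.trans (mul_le_mul_of_nonneg_right h2 (Finset.sum_nonneg fun j _ => sq_nonneg _))
  refine (Finset.sum_le_sum fun i _ => h i).trans (le_of_eq ?_)
  simp
  ring

/-- The symmetrizer is uniformly positive definite in the hyperbolic domain. -/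
theorem exists_symT_coercive (P B h₀ : ℝ) (h₀0 : 0 < h₀) :
    ∃ κ : ℝ, 0 < κ ∧ ∀ γ δ, Adm P γ δ → ∀ V : Fin 4 → ℝ, (∀ i, |V i| ≤ B) →
      h₀ ≤ depth₁ γ δ V →
      h₀ ≤ depth₂ δ V - |chgF γ δ V 3 - chgF γ δ V 2| ^ 2 / (γ + δ) →
      ∀ v : Fin 4 → ℝ, κ * ∑ i, v i ^ 2 ≤ v ⬝ᵥ (symT γ δ V *ᵥ v) := by
  obtain ⟨K, hK0, hK⟩ := (mTame_jacG P).exists_lipschitz B h₀ h₀0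
  obtain ⟨D, hD0, hD⟩ := (mTame_matS P).exists_lipschitz B h₀ h₀0
  set κ₁ := min |P|⁻¹ h₀ with hκ₁
  by_cases hP : 0 < P
  swap
  · exact ⟨1, one_pos, fun γ δ ha => absurd ha.P_pos hP⟩
  have hPi : |P|⁻¹ = P⁻¹ := by rw [abs_of_pos hP]
  have hκ₁0 : 0 < κ₁ := lt_min (by rw [hPi]; exact inv_pos.2 hP) h₀0
  -- Lower bounds for the three blocks of `S`: the `(1, 3)` block, the entry `γ`, and the entry `γ
  -- h₁`.
  set m := min (κ₁ / (2 + 2 * (D / κ₁) ^ 2 + 1)) (min κ₁ (κ₁ * h₀)) with hm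
  have hm0 : 0 < m := lt_min (by positivity) (lt_min hκ₁0 (by positivity))
  refine ⟨m / (16 * K ^ 2 + 1), by positivity, fun γ δ ha V hV h1 h2 v => ?_⟩
  have hκγ : κ₁ ≤ γ := (min_le_left _ _).trans (by rw [hPi]; exact ha.le_γ)
  have hγδ : κ₁ ≤ γ + δ := by linarith [ha.δ_pos]
  have hh2 : h₀ ≤ depth₂ δ V := h2.trans (sub_le_self _
    (div_nonneg (sq_nonneg _) (add_pos ha.γ_pos ha.δ_pos).le))
  have hH : h₀ ≤ depth₁ γ δ V + depth₂ δ V := by linarith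
  have hHne : depth₁ γ δ V + depth₂ δ V ≠ 0 := by linarith
  set y := jacF γ δ V *ᵥ v with hy
  -- Coercivity passes from `S` to `dFᵀ S dF` because the inverse of `dF` is bounded.
  have hv : v = jacG γ δ V *ᵥ y := by
    rw [hy, Matrix.mulVec_mulVec, jacG_mul_jacF ha hHne, Matrix.one_mulVec]
  have hvy : ∑ i, v i ^ 2 ≤ 16 * K ^ 2 * ∑ i, y i ^ 2 := by
    conv_lhs => rw [hv]
    exact sum_sq_mulVec_le (fun i j => (hK γ δ ha V V hV hV hH hH i j).1) y
  have hT : v ⬝ᵥ (symT γ δ V *ᵥ v) = y ⬝ᵥ (matS γ δ (chgF γ δ V) *ᵥ y) := by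
    rw [symT, hy, ← Matrix.mulVec_mulVec, ← Matrix.mulVec_mulVec, Matrix.dotProduct_mulVec,
      Matrix.vecMul_transpose]
  have hd : |chgF γ δ V 3 - chgF γ δ V 2| ≤ D := (hD γ δ ha V V hV hV hH hH 1 3).1
  rw [sq_abs] at h2
  have hq := quadratic_lower_bound (z := y 1) (w := y 3) hγδ hκ₁0 (min_le_right _ _) hd h2
  have e : y ⬝ᵥ (matS γ δ (chgF γ δ V) *ᵥ y) = γ * y 0 ^ 2 + γ * depth₁ γ δ V * y 2 ^ 2 +
      ((γ + δ) * y 1 ^ 2 + 2 * (chgF γ δ V 3 - chgF γ δ V 2) * (y 1 * y 3) +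
        depth₂ δ V * y 3 ^ 2) := by
    simp [matS, dotProduct, Matrix.mulVec, Fin.sum_univ_four, depth₁_chgF, depth₂_chgF]
    ring
  have hS : m * ∑ i, y i ^ 2 ≤ v ⬝ᵥ (symT γ δ V *ᵥ v) := by
    rw [hT, e, Fin.sum_univ_four]
    have m1 : m * y 0 ^ 2 ≤ γ * y 0 ^ 2 := mul_le_mul_of_nonneg_right
      (((min_le_right _ _).trans (min_le_left _ _)).trans hκγ) (sq_nonneg _)
    have m2 : m * y 2 ^ 2 ≤ γ * depth₁ γ δ V * y 2 ^ 2 := mul_le_mul_of_nonneg_right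
      (((min_le_right _ _).trans (min_le_right _ _)).trans
        (mul_le_mul hκγ h1 h₀0.le ha.γ_pos.le)) (sq_nonneg _)
    have m3 : m * (y 1 ^ 2 + y 3 ^ 2) ≤
        κ₁ / (2 + 2 * (D / κ₁) ^ 2 + 1) * (y 1 ^ 2 + y 3 ^ 2) :=
      mul_le_mul_of_nonneg_right (min_le_left _ _) (by positivity)
    linarith
  refine le_trans ?_ hS
  have hy0 : 0 ≤ ∑ i, y i ^ 2 := Finset.sum_nonneg fun i _ => sq_nonneg _
  rw [div_mul_eq_mul_div, div_le_iff₀ (by positivity), mul_assoc]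
  refine mul_le_mul_of_nonneg_left (hvy.trans ?_) hm0.le
  nlinarith

/-! ### Quadratic forms on `L²` -/

/-- The sesquilinear form with matrix coefficients `b`, real part. -/
def bform (b : Fin 4 → Fin 4 → ℝ → ℝ) (u w : Fin 4 → L2) : ℝ :=
  ∑ i, ∑ j, (inner ℂ (u i) (mulL (b i j) (w j))).re

theorem abs_sum_sum_le {c : Fin 4 → Fin 4 → ℝ} {K : ℝ} (h : ∀ i j, |c i j| ≤ K) :
    |∑ i, ∑ j, c i j| ≤ 16 * K := by
  refine (Finset.abs_sum_le_sum_abs _ _).trans ((Finset.sum_le_sum fun i _ =>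
    (Finset.abs_sum_le_sum_abs _ _).trans (Finset.sum_le_sum fun j _ => h i j)).trans ?_)
  simp
  linarith

theorem abs_bform_le {b : Fin 4 → Fin 4 → ℝ → ℝ} {K : ℝ} (hb : ∀ i j, IsBddMeas (b i j))
    (hK : ∀ i j x, |b i j x| ≤ K) (u w : Fin 4 → L2) :
    |bform b u w| ≤ 16 * (K * ‖u‖ * ‖w‖) := by
  have hK0 : 0 ≤ K := (abs_nonneg _).trans (hK 0 0 0)
  refine abs_sum_sum_le fun i j => ?_
  refine (Complex.abs_re_le_norm _).trans ((norm_inner_le_norm _ _).trans ?_)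
  have h1 := norm_mulL_apply_le (hb i j) (hK i j) (w j)
  calc ‖u i‖ * ‖mulL (b i j) (w j)‖ ≤ ‖u‖ * (K * ‖w‖) :=
        mul_le_mul (norm_le_pi_norm u i)
          (h1.trans (mul_le_mul_of_nonneg_left (norm_le_pi_norm w j) hK0)) (norm_nonneg _)
          (norm_nonneg _)
    _ = _ := by ring

theorem bform_sub_coeff {b b' : Fin 4 → Fin 4 → ℝ → ℝ} (hb : ∀ i j, IsBddMeas (b i j))
    (hb' : ∀ i j, IsBddMeas (b' i j)) (u w : Fin 4 → L2) :
    bform b u w - bform b' u w = bform (fun i j x => b i j x - b' i j x) u w := by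
  simp only [bform, ← Finset.sum_sub_distrib]
  refine Finset.sum_congr rfl fun i _ => Finset.sum_congr rfl fun j _ => ?_
  rw [mulL_sub (hb i j) (hb' i j), inner_sub_right, Complex.sub_re]

theorem bform_add_right (b : Fin 4 → Fin 4 → ℝ → ℝ) (u w w' : Fin 4 → L2) :
    bform b u (w + w') = bform b u w + bform b u w' := by
  simp only [bform, ← Finset.sum_add_distrib]
  refine Finset.sum_congr rfl fun i _ => Finset.sum_congr rfl fun j _ => ?_
  rw [Pi.add_apply, map_add, inner_add_right, Complex.add_re]

theorem bform_comm {b : Fin 4 → Fin 4 → ℝ → ℝ} (hb : ∀ i j, IsBddMeas (b i j))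
    (hs : ∀ i j, b i j = b j i) (u w : Fin 4 → L2) : bform b u w = bform b w u := by
  rw [bform, bform, Finset.sum_comm]
  refine Finset.sum_congr rfl fun i _ => Finset.sum_congr rfl fun j _ => ?_
  rw [hs j i, ← inner_mulL_left (hb i j), ← inner_conj_symm, Complex.conj_re]

theorem re_inner_mulL {b : ℝ → ℝ} (hb : IsBddMeas b) (f g : L2) :
    Integrable (fun x => b x * ((f x).re * (g x).re + (f x).im * (g x).im)) ∧
    (inner ℂ f (mulL b g)).re = ∫ x, b x * ((f x).re * (g x).re + (f x).im * (g x).im) := by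
  have h1 := L2.integrable_inner (𝕜 := ℂ) f (mulL b g)
  have h2 : (fun x => (inner ℂ (f x) (mulL b g x)).re) =ᵐ[volume]
      fun x => b x * ((f x).re * (g x).re + (f x).im * (g x).im) := by
    filter_upwards [coeFn_mulL hb g] with x hx
    rw [hx]
    simp
    ring
  refine ⟨(h1.re).congr h2, ?_⟩
  rw [L2.inner_def]
  have h3 := integral_re h1
  rw [← integral_congr_ae h2]
  exact h3.symm

/-- The pointwise inequality is applied separately to real and imaginary parts. The norm on the left
is a supremum over the components, hence at most the Euclidean one. -/
theorem bform_coercive {b : Fin 4 → Fin 4 → ℝ → ℝ} (hb : ∀ i j, IsBddMeas (b i j)) {κ : ℝ}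
    (hκ : 0 ≤ κ)
    (h : ∀ x (v : Fin 4 → ℝ), κ * ∑ i, v i ^ 2 ≤ ∑ i, ∑ j, b i j x * (v i * v j))
    (w : Fin 4 → L2) : κ * ‖w‖ ^ 2 ≤ bform b w w := by
  have hone : IsBddMeas (fun _ => (1 : ℝ)) := ⟨aestronglyMeasurable_const, 1, by simp⟩
  have hsq : ∀ f : L2, Integrable (fun x => (f x).re ^ 2 + (f x).im ^ 2) ∧
      ‖f‖ ^ 2 = ∫ x, ((f x).re ^ 2 + (f x).im ^ 2) := by
    intro f
    obtain ⟨h1, h2⟩ := re_inner_mulL hone f f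
    have h3 : mulL (fun _ => (1 : ℝ)) f = f := by
      ext1
      filter_upwards [coeFn_mulL hone f] with x hx
      rw [hx]
      simp
    rw [h3] at h2
    simp only [one_mul, ← sq] at h1 h2
    refine ⟨h1, ?_⟩
    rw [← h2, inner_self_eq_norm_sq_to_K]
    norm_cast
  have h1 : κ * ∑ i, ‖w i‖ ^ 2 ≤ bform b w w := by
    simp only [bform, (hsq _).2, (re_inner_mulL (hb _ _) _ _).2]
    rw [← integral_finsetSum _ fun i _ => (hsq (w i)).1, ← integral_const_mul]
    simp only [← integral_finsetSum _ fun j _ => (re_inner_mulL (hb _ _) _ (w j)).1]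
    rw [← integral_finsetSum _ fun i _ => integrable_finsetSum _ fun j _ =>
      (re_inner_mulL (hb i j) (w i) (w j)).1]
    refine integral_mono ((integrable_finsetSum _ fun i _ => (hsq (w i)).1).const_mul κ)
      (integrable_finsetSum _ fun i _ => integrable_finsetSum _ fun j _ =>
        (re_inner_mulL (hb i j) (w i) (w j)).1) fun x => ?_
    have e1 := h x fun i => (w i x).re
    have e2 := h x fun i => (w i x).im
    simp only [mul_add, Finset.sum_add_distrib] at e1 e2 ⊢
    exact add_le_add e1 e2
  refine le_trans (mul_le_mul_of_nonneg_left ?_ hκ) h1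
  have h2 : ‖w‖ ≤ Real.sqrt (∑ i, ‖w i‖ ^ 2) := by
    refine (pi_norm_le_iff_of_nonneg (Real.sqrt_nonneg _)).2 fun i => ?_
    exact Real.le_sqrt_of_sq_le (Finset.single_le_sum (f := fun i => ‖w i‖ ^ 2)
      (fun j _ => sq_nonneg _) (Finset.mem_univ i))
  calc ‖w‖ ^ 2 ≤ Real.sqrt (∑ i, ‖w i‖ ^ 2) ^ 2 := pow_le_pow_left₀ (norm_nonneg _) h2 2
    _ = _ := Real.sq_sqrt (Finset.sum_nonneg fun i _ => sq_nonneg _)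

/-- Integration by parts. -/
theorem inner_derL_add {b b' : ℝ → ℝ} (hb : IsBddMeas b) (hb' : IsBddMeas b')
    (hd : ∀ x, HasDerivAt b (b' x) x) {u w : L2} (hu : hsE 1 u < ∞) (hw : hsE 1 w < ∞)
    (hu1 : wiener 1 u < ∞) (hw1 : wiener 1 w < ∞) :
    inner ℂ u (mulL b (derL w)) + inner ℂ (derL u) (mulL b w) + inner ℂ u (mulL b' w) = 0 := by
  have h0 : ∀ {f : L2}, hsE 1 f < ∞ → wiener 1 f < ∞ →
      ((f : ℝ → ℂ) =ᵐ[volume] rep f) ∧ ((derL f : L2) : ℝ → ℂ) =ᵐ[volume] rep (derL f) := by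
    intro f hf hf1
    refine ⟨ae_eq_rep ((wiener_mono zero_le_one f).trans_lt hf1),
      ae_eq_rep ((wiener_derL_le hf 0).trans_lt ?_)⟩
    simpa using hf1
  have hderiv : ∀ x, HasDerivAt (fun x => (starRingEnd ℂ) (rep u x) * ((b x : ℂ) * rep w x))
      ((starRingEnd ℂ) (rep (derL u) x) * ((b x : ℂ) * rep w x) +
        (starRingEnd ℂ) (rep u x) * ((b' x : ℂ) * rep w x + (b x : ℂ) * rep (derL w) x)) x := by
    intro x
    exact ((hasDerivAt_rep hu hu1 x).star).mul
      ((hd x).ofReal_comp.mul (hasDerivAt_rep hw hw1 x))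
  have i1 := L2.integrable_inner (𝕜 := ℂ) u (mulL b (derL w))
  have i2 := L2.integrable_inner (𝕜 := ℂ) (derL u) (mulL b w)
  have i3 := L2.integrable_inner (𝕜 := ℂ) u (mulL b' w)
  have i4 := L2.integrable_inner (𝕜 := ℂ) u (mulL b w)
  have e4 : (fun x => inner ℂ (u x) (mulL b w x)) =ᵐ[volume]
      fun x => (starRingEnd ℂ) (rep u x) * ((b x : ℂ) * rep w x) := by
    filter_upwards [coeFn_mulL hb w, (h0 hu hu1).1, (h0 hw hw1).1] with x k1 k2 k3
    rw [k1, k2, k3]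
    simp [mul_comm]
  have e : (fun x => inner ℂ (u x) (mulL b (derL w) x) + inner ℂ (derL u x) (mulL b w x) +
      inner ℂ (u x) (mulL b' w x)) =ᵐ[volume]
      fun x => (starRingEnd ℂ) (rep (derL u) x) * ((b x : ℂ) * rep w x) +
        (starRingEnd ℂ) (rep u x) * ((b' x : ℂ) * rep w x + (b x : ℂ) * rep (derL w) x) := by
    filter_upwards [coeFn_mulL hb w, coeFn_mulL hb (derL w), coeFn_mulL hb' w, (h0 hu hu1).1,
      (h0 hu hu1).2, (h0 hw hw1).1, (h0 hw hw1).2] with x k1 k2 k3 k4 k5 k6 k7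
    rw [k1, k2, k3, k4, k5, k6, k7]
    simp only [RCLike.inner_apply]
    ring
  have e5 := integral_add (i1.add i2) i3
  simp only [Pi.add_apply] at e5
  rw [L2.inner_def, L2.inner_def, L2.inner_def, ← integral_add i1 i2, ← e5, integral_congr_ae e]
  -- No boundary term: the function and its derivative are both integrable on the line.
  exact integral_eq_zero_of_hasDerivAt_of_integrable hderiv (((i1.add i2).add i3).congr e)
    (i4.congr e4)

/-- Symmetry of the coefficients merges the two terms of the integration by parts that differentiate
`w`. Only derivatives of the coefficients remain, so constants of any size are harmless. -/
theorem bform_derL {b b' : Fin 4 → Fin 4 → ℝ → ℝ} (hb : ∀ i j, IsBddMeas (b i j))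
    (hb' : ∀ i j, IsBddMeas (b' i j)) (hs : ∀ i j, b i j = b j i)
    (hd : ∀ i j x, HasDerivAt (b i j) (b' i j x) x) {w : Fin 4 → L2} (hw : ∀ i, hsE 1 (w i) < ∞)
    (hw1 : ∀ i, wiener 1 (w i) < ∞) :
    2 * bform b w (fun i => derL (w i)) = -bform b' w w := by
  have h1 : bform b w (fun i => derL (w i)) + bform b (fun i => derL (w i)) w + bform b' w w = 0 := by
    simp only [bform, ← Finset.sum_add_distrib]
    refine Finset.sum_eq_zero fun i _ => Finset.sum_eq_zero fun j _ => ?_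
    rw [← Complex.add_re, ← Complex.add_re,
      inner_derL_add (hb i j) (hb' i j) (hd i j) (hw i) (hw j) (hw1 i) (hw1 j), Complex.zero_re]
  rw [bform_comm hb hs (fun i => derL (w i)) w] at h1
  linarith

/-! ### The energy estimate in space -/

theorem IsBddMeas.add {a b : ℝ → ℝ} (ha : IsBddMeas a) (hb : IsBddMeas b) :
    IsBddMeas (fun x => a x + b x) := by
  obtain ⟨A, hA⟩ := ha.bdd
  obtain ⟨B, hB⟩ := hb.bdd
  exact ⟨ha.meas.add hb.meas, A + B, fun x => (abs_add_le _ _).trans (add_le_add (hA x) (hB x))⟩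

theorem IsBddMeas.mul {a b : ℝ → ℝ} (ha : IsBddMeas a) (hb : IsBddMeas b) :
    IsBddMeas (fun x => a x * b x) := by
  obtain ⟨A, hA⟩ := ha.bdd
  obtain ⟨B, hB⟩ := hb.bdd
  refine ⟨ha.meas.mul hb.meas, A * B, fun x => ?_⟩
  rw [abs_mul]
  exact mul_le_mul (hA x) (hB x) (abs_nonneg _) ((abs_nonneg _).trans (hA x))

theorem mulL_add {a b : ℝ → ℝ} (ha : IsBddMeas a) (hb : IsBddMeas b) (f : L2) :
    mulL (fun x => a x + b x) f = mulL a f + mulL b f := by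
  ext1
  filter_upwards [coeFn_mulL ha f, coeFn_mulL hb f, coeFn_mulL (ha.add hb) f,
    Lp.coeFn_add (mulL a f) (mulL b f)] with x h1 h2 h3 h4
  rw [h3, h4, Pi.add_apply, h1, h2]
  push_cast
  ring

theorem mulL_mul {a b : ℝ → ℝ} (ha : IsBddMeas a) (hb : IsBddMeas b) (f : L2) :
    mulL (fun x => a x * b x) f = mulL a (mulL b f) := by
  ext1
  filter_upwards [coeFn_mulL ha (mulL b f), coeFn_mulL hb f, coeFn_mulL (ha.mul hb) f]
    with x h1 h2 h3
  rw [h3, h1, h2]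
  push_cast
  ring

theorem mulL_const (c : ℝ) (f : L2) : mulL (fun _ => c) f = (c : ℂ) • f := by
  have hc : IsBddMeas (fun _ => c) := ⟨aestronglyMeasurable_const, |c|, fun _ => le_rfl⟩
  ext1
  filter_upwards [coeFn_mulL hc f, Lp.coeFn_smul (c : ℂ) f] with x h1 h2
  rw [h1, h2]
  rfl

/-- This removes `r⁻¹` times the singular matrix from the commutators. -/
theorem comm_add_const {f : ℝ → ℝ} (hf : IsBddMeas f) (c : ℝ) (σ : ℝ) (N : ℕ) (g : L2) :
    comm σ N (fun x => c + f x) g = comm σ N f g := by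
  have hc : IsBddMeas (fun _ => c) := ⟨aestronglyMeasurable_const, |c|, fun _ => le_rfl⟩
  rw [comm_apply, comm_apply, mulL_add hc hf, mulL_add hc hf, mulL_const, mulL_const, map_add,
    map_smul]
  abel

theorem toL2_eq_of_ae {G : L2} {f : ℝ → ℝ} (h : (G : ℝ → ℂ) =ᵐ[volume] fun x => (f x : ℂ)) :
    toL2 f = G := by
  have hm : MemLp (fun x => (f x : ℂ)) 2 (volume : Measure ℝ) := (Lp.memLp G).ae_eq h
  ext1
  exact (coeFn_toL2 hm).trans h.symm

/-- The action of a matrix of functions on a vector of elements of `L²`. -/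
def matAct (M : Fin 4 → Fin 4 → ℝ → ℝ) (u : Fin 4 → L2) : Fin 4 → L2 :=
  fun i => ∑ j, mulL (M i j) (u j)

theorem bform_matAct {T M S : Fin 4 → Fin 4 → ℝ → ℝ} (hT : ∀ i j, IsBddMeas (T i j))
    (hM : ∀ i j, IsBddMeas (M i j)) (hS : ∀ i j x, S i j x = ∑ k, T i k x * M k j x)
    (w u : Fin 4 → L2) : bform T w (matAct M u) = bform S w u := by
  have h1 : ∀ i j, S i j = fun x => T i 0 x * M 0 j x + T i 1 x * M 1 j x + T i 2 x * M 2 j x +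
      T i 3 x * M 3 j x := fun i j => funext fun x => by rw [hS, Fin.sum_univ_four]
  have h2 : ∀ i j, mulL (S i j) (u j) = ∑ k, mulL (T i k) (mulL (M k j) (u j)) := by
    intro i j
    have h := fun k => (hT i k).mul (hM k j)
    rw [h1, Fin.sum_univ_four, mulL_add (((h 0).add (h 1)).add (h 2)) (h 3),
      mulL_add ((h 0).add (h 1)) (h 2), mulL_add (h 0) (h 1)]
    simp only [mulL_mul (hT i _) (hM _ j)]
  simp only [bform, matAct, h2, map_sum, inner_sum, Complex.re_sum]
  exact Finset.sum_congr rfl fun i _ => Finset.sum_comm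

/-- The truncated Bessel potential of a vector field. -/
def lamV (s : ℝ) (N : ℕ) (W : ℝ → Fin 4 → ℝ) : Fin 4 → L2 :=
  fun i => Lam s N (toL2 fun x => W x i)

/-- Apply `Lam s N` to the equation and pair with `T w`. The transport term is controlled by
symmetry of `T` times the system, the rest by commutators. The constant depends neither on `N` nor
on `r`, and the non-source terms carry the factor `a`. The commutators need the full `H^s` bound `φ`
of `W`, not only the truncated norm. -/
theorem exists_space_estimate {s : ℝ} (hs : 3 / 2 < s) (P A h₀ : ℝ) (h₀0 : 0 < h₀) :
    ∃ C : ℝ, 0 ≤ C ∧ ∀ γ δ, Adm P γ δ → ∀ (V W W' R : ℝ → Fin 4 → ℝ) (a φ : ℝ),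
      (∀ i, HsBdd s (fun x => V x i) a) → a ≤ A →
      (∀ x, h₀ ≤ depth₁ γ δ (V x) + depth₂ δ (V x)) →
      (∀ i, HsBdd s (fun x => W x i) φ) →
      (∀ i, MemLp (fun x => (W' x i : ℂ)) 2 (volume : Measure ℝ)) →
      (∀ᵐ x, W' x + sysM γ δ (V x) *ᵥ dx W x = R x) → ∀ N : ℕ,
      bform (fun i j x => symT γ δ (V x) i j) (lamV s N W) (lamV s N W') ≤
        C * ‖lamV s N W‖ * (a * φ + ‖lamV s N R‖) := by
  have hs0 : 0 ≤ s := by linarith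
  obtain ⟨Kb, hKb0, hKb⟩ := exists_abs_le_of_hsBdd (p := s) (by linarith)
  obtain ⟨Kd, hKd0, hKd⟩ := exists_abs_deriv_le hs
  obtain ⟨Kw, hKw0, hKw⟩ := exists_wiener_le_of_hsE (τ := 1) (p := s) (by linarith)
  obtain ⟨Kc, hKc0, hKc⟩ := exists_norm_comm_le hs (σ := s) (by linarith) le_rfl
  obtain ⟨KT, hKT0, hKT⟩ := (mTame_symT P).exists_lipschitz (Kb * |A|) h₀ h₀0
  obtain ⟨KS, hKS0, hKS⟩ := (mTame_symT P).exists_hsBdd hs |A| h₀ h₀0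
  obtain ⟨KM, hKM0, hKM⟩ := (mTame_regM P).exists_hsBdd hs |A| h₀ h₀0
  obtain ⟨KR, hKR0, hKR⟩ := (mTame_regT P).exists_hsBdd hs |A| h₀ h₀0
  -- In order: the source term, half of the form with differentiated coefficients, and the
  -- commutators (four per component).
  refine ⟨16 * KT + 8 * (Kd * KR) + 16 * KT * (4 * (Kc * KM * (1 + Kw))), by positivity, ?_⟩
  intro γ δ ha V W W' R a φ hV haA hH hW hW' hpde N
  have ha0 : 0 ≤ a := (hV 0).nonneg
  have hφ0 : 0 ≤ φ := (hW 0).nonneg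
  have haA' : a ≤ |A| := haA.trans (le_abs_self A)
  have hHne : ∀ x, depth₁ γ δ (V x) + depth₂ δ (V x) ≠ 0 := fun x =>
    (h₀0.trans_le (hH x)).ne'
  have hVb : ∀ x i, |V x i| ≤ Kb * |A| := fun x i =>
    (hKb _ _ (hV i) x).trans (mul_le_mul_of_nonneg_left haA' hKb0)
  have hTbd : ∀ i j x, |symT γ δ (V x) i j| ≤ KT := fun i j x =>
    (hKT γ δ ha _ _ (hVb x) (hVb x) (hH x) (hH x) i j).1
  have bddOf : ∀ (f : ℝ → ℝ) (c k : ℝ), HsBdd s (fun x => f x - c) k → IsBddMeas f := by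
    intro f c k h
    refine .of_continuous (C := Kb * k + |c|) ?_ fun x => ?_
    · simpa using h.cont.add_const c
    · have := hKb _ _ h x
      calc |f x| = |(f x - c) + c| := by ring_nf
        _ ≤ _ := (abs_add_le _ _).trans (add_le_add this le_rfl)
  set T : Fin 4 → Fin 4 → ℝ → ℝ := fun i j x => symT γ δ (V x) i j
  set S : Fin 4 → Fin 4 → ℝ → ℝ := fun i j x => (rho γ δ)⁻¹ * singS γ i j + regT γ δ (V x) i j
  -- `c` collects everything constant in `x`, including the singular part; `m` is the remaining
  -- `H^s` part, of norm `O(a)`.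
  set c : Fin 4 → Fin 4 → ℝ := fun i j => (rho γ δ)⁻¹ * singM γ δ i j + regM γ δ 0 i j
  set m : Fin 4 → Fin 4 → ℝ → ℝ := fun i j x => regM γ δ (V x) i j - regM γ δ 0 i j
  set M : Fin 4 → Fin 4 → ℝ → ℝ := fun i j x => c i j + m i j x
  have hTm : ∀ i j, IsBddMeas (T i j) := fun i j =>
    bddOf _ _ _ (hKS γ δ ha V a hV haA' hH i j)
  have hmH : ∀ i j, HsBdd s (m i j) (KM * a) := hKM γ δ ha V a hV haA' hH
  have hmm : ∀ i j, IsBddMeas (m i j) := fun i j =>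
    .of_continuous (hmH i j).cont (hKb _ _ (hmH i j))
  have hcm : ∀ i j, IsBddMeas (fun _ : ℝ => c i j) := fun i j =>
    ⟨aestronglyMeasurable_const, _, fun _ => le_rfl⟩
  have hMm : ∀ i j, IsBddMeas (M i j) := fun i j => (hcm i j).add (hmm i j)
  have hMsys : ∀ i j x, M i j x = sysM γ δ (V x) i j := fun i j x => by
    rw [sysM_eq_sing_add_reg ha (hHne x)]
    simp only [M, c, m, Matrix.add_apply, Matrix.smul_apply, smul_eq_mul]
    ring
  have hRH := hKR γ δ ha V a hV haA' hH
  have hSe : ∀ i j, S i j = fun x =>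
      ((rho γ δ)⁻¹ * singS γ i j + regT γ δ 0 i j) + (regT γ δ (V x) i j - regT γ δ 0 i j) :=
    fun i j => funext fun x => by
      simp only [S]
      ring
  have hSm : ∀ i j, IsBddMeas (S i j) := fun i j => by
    rw [hSe]
    exact IsBddMeas.add ⟨aestronglyMeasurable_const, _, fun _ => le_rfl⟩
      (.of_continuous (hRH i j).cont (hKb _ _ (hRH i j)))
  set S' : Fin 4 → Fin 4 → ℝ → ℝ := fun i j =>
    deriv (fun x => regT γ δ (V x) i j - regT γ δ 0 i j)
  have hSd : ∀ i j x, HasDerivAt (S i j) (S' i j x) x := fun i j x => by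
    rw [hSe]
    exact ((hRH i j).hasDerivAt hs x).1.const_add _
  have hS'bd : ∀ i j x, |S' i j x| ≤ Kd * (KR * a) := fun i j => (hKd _ _ (hRH i j)).1
  have hS'm : ∀ i j, IsBddMeas (S' i j) := fun i j =>
    .of_continuous (hKd _ _ (hRH i j)).2 (hS'bd i j)
  have hSsymm : ∀ i j, S i j = S j i := fun i j => funext fun x => by
    have h1 := congrFun (congrFun (regT_isSymm γ δ (V x)) j) i
    have h2 : singS γ i j = singS γ j i := by fin_cases i <;> fin_cases j <;> rfl
    rw [Matrix.transpose_apply] at h1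
    simp only [S, h1, h2]
  have hTM : ∀ i j x, S i j x = ∑ k, T i k x * M k j x := fun i j x => by
    have := congrFun (congrFun (symT_mul_sysM ha (hHne x)) i) j
    rw [Matrix.mul_apply] at this
    simp only [T, S, hMsys, this, Matrix.add_apply, Matrix.smul_apply, smul_eq_mul]
  set w := lamV s N W
  set D : Fin 4 → L2 := fun i => derL (toL2 fun x => W x i)
  have hE1 : ∀ i, hsE 1 (toL2 fun x => W x i) < ∞ := fun i =>
    ((hsE_mono (by linarith) _).trans (hW i).hsE_le).trans_lt ENNReal.ofReal_lt_top
  have hwder : (fun i => derL (w i)) = fun i => Lam s N (D i) :=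
    funext fun i => derL_Lam hs0 N (hE1 i)
  have hwE : ∀ i, hsE 1 (w i) < ∞ := fun i => hsE_Lam_lt_top hs0 N (hE1 i)
  have hwW : ∀ i, wiener 1 (w i) < ∞ := fun i => by
    have h1 : hsE s (w i) < ∞ :=
      hsE_Lam_lt_top hs0 N ((hW i).hsE_le.trans_lt ENNReal.ofReal_lt_top)
    refine (hKw (w i) _ (ENNReal.ofReal_toReal h1.ne).ge).trans_lt ENNReal.ofReal_lt_top
  set Q : Fin 4 → L2 := fun i => ∑ j, comm s N (m i j) (D j)
  have hR : ∀ i, (toL2 fun x => R x i) = (toL2 fun x => W' x i) + ∑ j, mulL (M i j) (D j) := by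
    intro i
    refine toL2_eq_of_ae ?_
    have hd := fun j => (hW j).derL_eq hs
    rw [Fin.sum_univ_four]
    filter_upwards [hpde, hd 0, hd 1, hd 2, hd 3, coeFn_toL2 (hW' i), coeFn_mulL (hMm i 0) (D 0),
      coeFn_mulL (hMm i 1) (D 1), coeFn_mulL (hMm i 2) (D 2), coeFn_mulL (hMm i 3) (D 3),
      Lp.coeFn_add (toL2 fun x => W' x i) (mulL (M i 0) (D 0) + mulL (M i 1) (D 1) +
        mulL (M i 2) (D 2) + mulL (M i 3) (D 3)),
      Lp.coeFn_add (mulL (M i 0) (D 0) + mulL (M i 1) (D 1) + mulL (M i 2) (D 2))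
        (mulL (M i 3) (D 3)),
      Lp.coeFn_add (mulL (M i 0) (D 0) + mulL (M i 1) (D 1)) (mulL (M i 2) (D 2)),
      Lp.coeFn_add (mulL (M i 0) (D 0)) (mulL (M i 1) (D 1))]
      with x e d0 d1 d2 d3 ew m0 m1 m2 m3 a1 a2 a3 a4
    rw [a1, Pi.add_apply, a2, Pi.add_apply, a3, Pi.add_apply, a4, Pi.add_apply, m0, m1, m2, m3,
      d0, d1, d2, d3, ew, ← e]
    simp only [hMsys, Pi.add_apply, Matrix.mulVec, dotProduct, Fin.sum_univ_four, dx]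
    push_cast
    rfl
  have hLR : lamV s N R = lamV s N W' + (matAct M (fun i => derL (w i)) + Q) := by
    ext1 i
    rw [hwder]
    simp only [lamV, hR i, map_add, map_sum, Pi.add_apply, matAct, Q, ← Finset.sum_add_distrib]
    congr 1
    refine Finset.sum_congr rfl fun j _ => ?_
    rw [← comm_add_const (hmm i j) (c i j), comm_apply]
    simp only [M]
    abel
  have hsplit : bform T w (lamV s N W') =
      bform T w (lamV s N R) - bform S w (fun i => derL (w i)) - bform T w Q := by
    rw [hLR, bform_add_right, bform_add_right, bform_matAct hTm hMm hTM]
    ring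
  have hQ : ‖Q‖ ≤ 4 * (Kc * KM * (1 + Kw) * (a * φ)) := by
    refine (pi_norm_le_iff_of_nonneg (by positivity)).2 fun i => ?_
    refine (norm_sum_le _ _).trans ((Finset.sum_le_sum (g := fun _ =>
      Kc * KM * (1 + Kw) * (a * φ)) fun j _ => ?_).trans (le_of_eq (by simp)))
    have h1 := hKc N (m i j) _ (D j) ((1 + Kw) * φ) (hmH i j) (by positivity)
      (((hsE_derL_le (hE1 j) _).trans (by simpa using (hW j).hsE_le)).trans
        (ENNReal.ofReal_le_ofReal (by nlinarith [mul_nonneg hKw0 hφ0])))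
      (((wiener_derL_le (hE1 j) 0).trans (by simpa using hKw _ _ (hW j).hsE_le)).trans
        (ENNReal.ofReal_le_ofReal (by nlinarith)))
    refine h1.trans (le_of_eq ?_)
    ring
  have hwφ : ‖w‖ ≤ φ := (pi_norm_le_iff_of_nonneg hφ0).2 fun i => (hW i).norm_Lam_le hs0 N
  have b1 := (le_abs_self _).trans (abs_bform_le hTm hTbd w (lamV s N R))
  have b2 := (neg_abs_le _).trans' (neg_le_neg (abs_bform_le hTm hTbd w Q))
  have b3 := (le_abs_self _).trans (abs_bform_le hS'm hS'bd w w)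
  have b4 := bform_derL hSm hS'm hSsymm hSd hwE hwW
  have hw0 := norm_nonneg w
  have hr0 := norm_nonneg (lamV s N R)
  have k1 : KT * ‖w‖ * ‖Q‖ ≤ KT * ‖w‖ * (4 * (Kc * KM * (1 + Kw) * (a * φ))) := by gcongr
  have k2 : Kd * (KR * a) * ‖w‖ * ‖w‖ ≤ Kd * (KR * a) * ‖w‖ * φ := by gcongr
  rw [hsplit]
  have p1 : 0 ≤ (8 * (Kd * KR) + 16 * KT * (4 * (Kc * KM * (1 + Kw)))) * ‖w‖ *
      ‖lamV s N R‖ := by positivity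
  have p2 : 0 ≤ 16 * KT * ‖w‖ * (a * φ) := by positivity
  linarith

/-! ### A Gronwall estimate -/

theorem ofReal_integral_le_lintegral {α : Type*} [MeasurableSpace α] {μ : Measure α} {f : α → ℝ}
    (hf : Integrable f μ) : ENNReal.ofReal (∫ x, f x ∂μ) ≤ ∫⁻ x, ENNReal.ofReal (f x) ∂μ := by
  rw [integral_eq_lintegral_pos_part_sub_lintegral_neg_part hf]
  exact (ENNReal.ofReal_le_ofReal (sub_le_self _ ENNReal.toReal_nonneg)).trans
    ENNReal.ofReal_toReal_le

/-- The shift by `η²` keeps the square root away from its singularity, as the energy may vanish. -/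
theorem lipschitzOnWith_sqrt_add_sq {E : ℝ → ℝ} {S : Set ℝ} {L η : ℝ} (hη : 0 < η)
    (hE0 : ∀ t ∈ S, 0 ≤ E t)
    (hE : ∀ t ∈ S, ∀ τ ∈ S, |E τ - E t| ≤ L * |τ - t|) :
    LipschitzOnWith (L / η).toNNReal (fun t => √(E t + η ^ 2)) S := by
  refine LipschitzOnWith.of_dist_le' fun τ hτ t ht => ?_
  rw [Real.dist_eq, Real.dist_eq, div_mul_eq_mul_div, le_div_iff₀ hη]
  have h1 : 0 ≤ E τ + η ^ 2 := by have := hE0 τ hτ; positivity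
  have h2 : 0 ≤ E t + η ^ 2 := by have := hE0 t ht; positivity
  have h3 : η ≤ √(E τ + η ^ 2) := Real.le_sqrt_of_sq_le (by linarith [hE0 τ hτ])
  have h4 : η ≤ √(E τ + η ^ 2) + √(E t + η ^ 2) := h3.trans (le_add_of_nonneg_right (by positivity))
  refine le_trans ?_ (hE t ht τ hτ)
  calc |√(E τ + η ^ 2) - √(E t + η ^ 2)| * η
      ≤ |√(E τ + η ^ 2) - √(E t + η ^ 2)| * |√(E τ + η ^ 2) + √(E t + η ^ 2)| :=
        mul_le_mul_of_nonneg_left (h4.trans (le_abs_self _)) (abs_nonneg _)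
    _ = |E τ - E t| := by
        rw [← abs_mul]
        congr 1
        have := Real.sq_sqrt h1
        have := Real.sq_sqrt h2
        nlinarith

/-- For `y = √(E + η²)` the hypotheses give `y' ≤ μ y + (c / √κ) r` almost everywhere, and `e^{-μt}
y` is absolutely continuous, hence the integral of its derivative. The bound is inserted under a
lower integral, so `r` need be neither measurable nor integrable. -/
theorem sqrt_le_of_ae_deriv_le {E n : ℝ → ℝ} {r : ℝ → ℝ} {T L κ a c μ η : ℝ} (hκ : 0 < κ)
    (hη : 0 < η) (ha : 0 ≤ a) (hc : 0 ≤ c) (hr : ∀ t, 0 ≤ r t) (hn : ∀ t, 0 ≤ n t)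
    (hE : ∀ t ∈ Set.Icc 0 T, ∀ τ ∈ Set.Icc 0 T, |E τ - E t| ≤ L * |τ - t|)
    (hnE : ∀ t ∈ Set.Icc 0 T, κ * n t ^ 2 ≤ E t)
    (hE' : ∀ᵐ t ∂(volume.restrict (Set.Icc 0 T)), ∀ E', HasDerivAt E E' t →
      E' ≤ a * n t ^ 2 + 2 * c * n t * r t)
    (hμ : a ≤ 2 * μ * κ) {t : ℝ} (ht : t ∈ Set.Icc 0 T) :
    ENNReal.ofReal (√(E t + η ^ 2)) ≤ ENNReal.ofReal (Real.exp (μ * t) * (√(E 0 + η ^ 2))) +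
      ∫⁻ t' in Set.Icc 0 t, ENNReal.ofReal (Real.exp (μ * (t - t')) * (c / √κ * r t')) := by
  have hE0 : ∀ t ∈ Set.Icc 0 T, 0 ≤ E t := fun t ht => (by positivity : 0 ≤ κ * n t ^ 2).trans
    (hnE t ht)
  have hsub : Set.uIcc 0 t ⊆ Set.Icc 0 T := by
    rw [Set.uIcc_of_le ht.1]
    exact Set.Icc_subset_Icc_right ht.2
  set y : ℝ → ℝ := fun t => √(E t + η ^ 2) with hy
  set e : ℝ → ℝ := fun t => Real.exp (-μ * t) with he
  have hEac : AbsolutelyContinuousOnInterval E 0 t :=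
    LipschitzOnWith.absolutelyContinuousOnInterval (K := L.toNNReal)
      (LipschitzOnWith.of_dist_le' fun τ hτ t ht => by
        rw [Real.dist_eq, Real.dist_eq]; exact hE t (hsub ht) τ (hsub hτ))
  have hyac : AbsolutelyContinuousOnInterval y 0 t :=
    ((lipschitzOnWith_sqrt_add_sq hη hE0 hE).mono hsub).absolutelyContinuousOnInterval
  have heac : AbsolutelyContinuousOnInterval e 0 t := by
    refine ContDiffOn.absolutelyContinuousOnInterval ?_
    exact (Real.contDiff_exp.comp (contDiff_const.mul contDiff_id)).contDiffOn
  have hz := heac.mul hyac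
  have hint := hz.integral_deriv_eq_sub
  have hzi := hz.intervalIntegrable_deriv
  rw [intervalIntegral.integral_of_le ht.1] at hint
  have hzi' := (intervalIntegrable_iff_integrableOn_Ioc_of_le ht.1).1 hzi
  have hder : ∀ᵐ τ ∂(volume.restrict (Set.Ioc 0 t)),
      deriv (e * y) τ ≤ Real.exp (-μ * τ) * (c / √κ * r τ) := by
    have h1 : ∀ᵐ τ ∂(volume.restrict (Set.Ioc 0 t)), ∀ E', HasDerivAt E E' τ →
        E' ≤ a * n τ ^ 2 + 2 * c * n τ * r τ := by
      refine ae_restrict_of_ae_restrict_of_subset ?_ hE'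
      exact Set.Ioc_subset_Icc_self.trans (Set.Icc_subset_Icc_right ht.2)
    have h2 := (ae_restrict_iff' (measurableSet_Ioc (a := (0:ℝ)) (b := t))).2
      (hEac.ae_differentiableAt.mono fun τ h hτ =>
        h (by rw [Set.uIcc_of_le ht.1]; exact Set.Ioc_subset_Icc_self hτ))
    filter_upwards [h1, h2, ae_restrict_mem measurableSet_Ioc] with τ h1 h2 hτ
    have hτ' : τ ∈ Set.Icc 0 T := ⟨hτ.1.le, hτ.2.trans ht.2⟩
    have hpos : 0 < E τ + η ^ 2 := by have := hE0 τ hτ'; positivity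
    have hd := h2.hasDerivAt
    have hyd : HasDerivAt y (deriv E τ / (2 * √(E τ + η ^ 2))) τ :=
      (hd.add_const (η ^ 2)).sqrt hpos.ne'
    have hed : HasDerivAt e (Real.exp (-μ * τ) * -μ) τ := by
      simpa [he] using ((hasDerivAt_id τ).const_mul (-μ)).exp
    rw [(hed.mul hyd).deriv]
    have hb := h1 _ hd
    have hyp : 0 < y τ := Real.sqrt_pos.2 hpos
    have hny : n τ ≤ y τ / √κ := by
      rw [le_div_iff₀ (Real.sqrt_pos.2 hκ)]
      refine Real.le_sqrt_of_sq_le ?_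
      rw [mul_pow, Real.sq_sqrt hκ.le]
      nlinarith [hnE τ hτ', sq_nonneg η]
    have hκs := Real.sq_sqrt hκ.le
    have hκ0 := Real.sqrt_pos.2 hκ
    have key : deriv E τ / (2 * y τ) ≤ μ * y τ + c / √κ * r τ := by
      rw [div_le_iff₀ (by positivity)]
      have e1 : a * n τ ^ 2 ≤ 2 * μ * y τ ^ 2 := by
        calc a * n τ ^ 2 ≤ 2 * μ * κ * n τ ^ 2 := by gcongr
          _ ≤ 2 * μ * κ * (y τ / √κ) ^ 2 := by
              have := hn τ
              have : 0 ≤ 2 * μ * κ := ha.trans hμ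
              gcongr
          _ = _ := by rw [div_pow, hκs]; field_simp
      have e2 : 2 * c * n τ * r τ ≤ 2 * c * (y τ / √κ) * r τ := by
        have := hr τ
        gcongr
      calc _ ≤ _ := hb
        _ ≤ _ := add_le_add e1 e2
        _ = _ := by ring
    calc Real.exp (-μ * τ) * -μ * y τ + Real.exp (-μ * τ) * (deriv E τ / (2 * y τ))
        = Real.exp (-μ * τ) * (deriv E τ / (2 * y τ) - μ * y τ) := by ring
      _ ≤ _ := by
        refine mul_le_mul_of_nonneg_left ?_ (Real.exp_pos _).le
        linarith
  have hfin : ENNReal.ofReal (e t * y t) ≤ ENNReal.ofReal (y 0) +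
      ∫⁻ τ in Set.Icc 0 t, ENNReal.ofReal (Real.exp (-μ * τ) * (c / √κ * r τ)) := by
    have h0 : e t * y t = y 0 + ∫ x in Set.Ioc 0 t, deriv (e * y) x := by
      rw [hint]
      simp [he]
    rw [h0]
    refine ENNReal.ofReal_add_le.trans (add_le_add le_rfl ?_)
    refine (ofReal_integral_le_lintegral hzi').trans ?_
    refine (lintegral_mono_ae (hder.mono fun τ h => ENNReal.ofReal_le_ofReal h)).trans ?_
    exact lintegral_mono_set Set.Ioc_subset_Icc_self
  have hexp := Real.exp_pos (μ * t)
  calc ENNReal.ofReal (y t) = ENNReal.ofReal (Real.exp (μ * t)) * ENNReal.ofReal (e t * y t) := by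
        rw [← ENNReal.ofReal_mul hexp.le, ← mul_assoc, he, ← Real.exp_add]
        simp
    _ ≤ ENNReal.ofReal (Real.exp (μ * t)) * _ := mul_le_mul_right hfin _
    _ = _ := by
        rw [mul_add, ← ENNReal.ofReal_mul hexp.le, ← lintegral_const_mul' _ _ ENNReal.ofReal_ne_top]
        congr 1
        refine lintegral_congr fun τ => ?_
        rw [← ENNReal.ofReal_mul hexp.le, ← mul_assoc, ← Real.exp_add]
        congr 3
        ring_nf

/-! ### Time derivative of the energy. -/

theorem bform_smul_right (b : Fin 4 → Fin 4 → ℝ → ℝ) (c : ℝ) (u w : Fin 4 → L2) :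
    bform b u (c • w) = c * bform b u w := by
  simp only [bform, Finset.mul_sum]
  refine Finset.sum_congr rfl fun i _ => Finset.sum_congr rfl fun j _ => ?_
  have h : (c • w) j = (c : ℂ) • w j := rfl
  rw [h, map_smul, inner_smul_right, Complex.re_ofReal_mul]

theorem bform_sub_right (b : Fin 4 → Fin 4 → ℝ → ℝ) (u w w' : Fin 4 → L2) :
    bform b u (w - w') = bform b u w - bform b u w' := by
  rw [eq_sub_iff_add_eq, ← bform_add_right, sub_add_cancel]

theorem bform_self_sub {b : Fin 4 → Fin 4 → ℝ → ℝ} (hb : ∀ i j, IsBddMeas (b i j))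
    (hs : ∀ i j, b i j = b j i) (u v : Fin 4 → L2) :
    bform b u u - bform b v v = bform b (u + v) (u - v) := by
  rw [bform_comm hb hs (u + v), bform_add_right, bform_comm hb hs (u - v) u,
    bform_comm hb hs (u - v) v, bform_sub_right, bform_sub_right, bform_comm hb hs v u]
  ring

theorem continuous_bform (b : Fin 4 → Fin 4 → ℝ → ℝ) :
    Continuous fun p : (Fin 4 → L2) × (Fin 4 → L2) => bform b p.1 p.2 := by
  unfold bform
  fun_prop

theorem bform_sub_bform {b b' : Fin 4 → Fin 4 → ℝ → ℝ} (hb : ∀ i j, IsBddMeas (b i j))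
    (hb' : ∀ i j, IsBddMeas (b' i j)) (hs : ∀ i j, b i j = b j i) (u v : Fin 4 → L2) :
    bform b' u u - bform b v v =
      bform (fun i j x => b' i j x - b i j x) u u + bform b (u + v) (u - v) := by
  rw [← bform_sub_coeff hb' hb, ← bform_self_sub hb hs]
  ring

theorem abs_bform_sub_bform_le {b b' : Fin 4 → Fin 4 → ℝ → ℝ} {k K B d : ℝ}
    (hb : ∀ i j, IsBddMeas (b i j))
    (hb' : ∀ i j, IsBddMeas (b' i j)) (hs : ∀ i j, b i j = b j i) {u v : Fin 4 → L2}
    (hk : ∀ i j x, |b' i j x - b i j x| ≤ k) (hK : ∀ i j x, |b i j x| ≤ K)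
    (hu : ‖u‖ ≤ B) (hv : ‖v‖ ≤ B) (hd : ‖u - v‖ ≤ d) :
    |bform b' u u - bform b v v| ≤ 16 * (k * B * B) + 16 * (K * (B + B) * d) := by
  rw [bform_sub_bform hb hb' hs]
  refine (abs_add_le _ _).trans ?_
  have h1 := abs_bform_le (fun i j => (hb' i j).sub (hb i j)) hk u u
  have h2 := abs_bform_le hb hK (u + v) (u - v)
  have h3 : 0 ≤ k := (abs_nonneg _).trans (hk 0 0 0)
  have h4 : 0 ≤ K := (abs_nonneg _).trans (hK 0 0 0)
  have h5 := (norm_add_le u v).trans (add_le_add hu hv)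
  have h6 : 0 ≤ B := (norm_nonneg _).trans hu
  have h7 : k * ‖u‖ * ‖u‖ ≤ k * B * B := by gcongr
  have h8 : K * ‖u + v‖ * ‖u - v‖ ≤ K * (B + B) * d := by gcongr
  linarith

/-- The derivative is computed from slopes to the right of `t`. The coefficients need not be
differentiable in time; a bound on their difference quotients near `t` is enough. -/
theorem hasDerivAt_bform_le {b : ℝ → Fin 4 → Fin 4 → ℝ → ℝ} {w : ℝ → Fin 4 → L2}
    {D : Fin 4 → L2} {S : Set ℝ} {m t T E' : ℝ} (htT : t < T) (hIoo : Set.Ioo t T ⊆ S \ {t})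
    (hb : ∀ t ∈ S, ∀ i j, IsBddMeas (b t i j))
    (ht : t ∈ S) (hbs : ∀ i j, b t i j = b t j i)
    (hbd : ∀ᶠ τ in 𝓝[S \ {t}] t, ∀ i j x, |b τ i j x - b t i j x| ≤ m * |τ - t|)
    (hwc : Tendsto w (𝓝[S \ {t}] t) (𝓝 (w t)))
    (hwd : Tendsto (fun τ => (τ - t)⁻¹ • (w τ - w t)) (𝓝[S \ {t}] t) (𝓝 D))
    (hE' : HasDerivAt (fun t => bform (b t) (w t) (w t)) E' t) :
    E' ≤ 16 * (m * ‖w t‖ * ‖w t‖) + 2 * bform (b t) (w t) D := by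
  have hle : 𝓝[Set.Ioo t T] t ≤ 𝓝[S \ {t}] t := nhdsWithin_mono _ hIoo
  have : (𝓝[Set.Ioo t T] t).NeBot := by
    rw [nhdsWithin_Ioo_eq_nhdsGT htT]
    infer_instance
  have hwc' := hwc.mono_left hle
  have hs := (hE'.tendsto_slope.mono_left (nhdsWithin_mono t (s := Set.Ioo t T)
    fun τ hτ => hτ.1.ne'))
  have hg1 : Tendsto (fun τ => 16 * (m * ‖w τ‖ * ‖w τ‖)) (𝓝[Set.Ioo t T] t)
      (𝓝 (16 * (m * ‖w t‖ * ‖w t‖))) := ((hwc'.norm.const_mul m).mul hwc'.norm).const_mul 16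
  have hg2 := ((continuous_bform (b t)).tendsto (w t + w t, D)).comp
    ((hwc'.add_const (w t)).prodMk_nhds (hwd.mono_left hle))
  have hlim := le_of_tendsto_of_tendsto hs (hg1.add hg2) (by
    filter_upwards [self_mem_nhdsWithin, hle hbd] with τ hτ hbτ
    have hτt : 0 < τ - t := sub_pos.2 hτ.1
    have h1 := (le_abs_self _).trans (abs_bform_le
      (fun i j => (hb τ (hIoo hτ).1 i j).sub (hb t ht i j)) hbτ (w τ) (w τ))
    rw [slope_def_field, bform_sub_bform (hb t ht) (hb τ (hIoo hτ).1) hbs, Function.comp_apply,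
      bform_smul_right, add_div, div_eq_inv_mul, div_eq_inv_mul]
    refine add_le_add ?_ le_rfl
    rw [inv_mul_le_iff₀ hτt]
    rw [abs_of_pos hτt] at h1
    linarith)
  rw [bform_comm (hb t ht) hbs, bform_add_right, bform_comm (hb t ht) hbs] at hlim
  linarith

theorem tendsto_of_norm_sub_le {E : Type*} [NormedAddCommGroup E] {w : ℝ → E} {S : Set ℝ} {L t : ℝ}
    (h : ∀ τ ∈ S, ‖w τ - w t‖ ≤ L * |τ - t|) : Tendsto w (𝓝[S] t) (𝓝 (w t)) := by
  rw [tendsto_iff_norm_sub_tendsto_zero]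
  refine squeeze_zero' (Eventually.of_forall fun _ => norm_nonneg _)
    (g := fun τ => L * |τ - t|) ?_ ?_
  · filter_upwards [self_mem_nhdsWithin] with τ hτ
    exact h τ hτ
  · refine (Continuous.tendsto' ?_ t 0 (by simp)).mono_left nhdsWithin_le_nhds
    fun_prop

theorem energy_estimate {b : ℝ → Fin 4 → Fin 4 → ℝ → ℝ} {w w' : ℝ → Fin 4 → L2} {r : ℝ → ℝ}
    {T K Lb Lw Bw m κ C q μ η : ℝ} (hκ : 0 < κ) (hη : 0 < η) (hm : 0 ≤ m) (hC : 0 ≤ C) (hq : 0 ≤ q)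
    (hr : ∀ t, 0 ≤ r t)
    (hb : ∀ t ∈ Set.Icc 0 T, ∀ i j, IsBddMeas (b t i j))
    (hbs : ∀ t ∈ Set.Icc 0 T, ∀ i j, b t i j = b t j i)
    (hbK : ∀ t ∈ Set.Icc 0 T, ∀ i j x, |b t i j x| ≤ K)
    (hbL : ∀ t ∈ Set.Icc 0 T, ∀ τ ∈ Set.Icc 0 T, ∀ i j x, |b τ i j x - b t i j x| ≤ Lb * |τ - t|)
    (hbd : ∀ᵐ t ∂(volume.restrict (Set.Icc 0 T)), ∀ᶠ τ in 𝓝[Set.Icc 0 T \ {t}] t, ∀ i j x,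
      |b τ i j x - b t i j x| ≤ m * |τ - t|)
    (hwL : ∀ t ∈ Set.Icc 0 T, ∀ τ ∈ Set.Icc 0 T, ‖w τ - w t‖ ≤ Lw * |τ - t|)
    (hwB : ∀ t ∈ Set.Icc 0 T, ‖w t‖ ≤ Bw)
    (hwd : ∀ t ∈ Set.Icc 0 T, Tendsto (fun τ => (τ - t)⁻¹ • (w τ - w t))
      (𝓝[Set.Icc 0 T \ {t}] t) (𝓝 (w' t)))
    (hco : ∀ t ∈ Set.Icc 0 T, κ * ‖w t‖ ^ 2 ≤ bform (b t) (w t) (w t))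
    (hest : ∀ᵐ t ∂(volume.restrict (Set.Icc 0 T)),
      bform (b t) (w t) (w' t) ≤ C * ‖w t‖ * (q * ‖w t‖ + r t))
    (hμ : 16 * m + 2 * (C * q) ≤ 2 * μ * κ) {t : ℝ} (ht : t ∈ Set.Icc 0 T) :
    ENNReal.ofReal (√κ * ‖w t‖) ≤
      ENNReal.ofReal (Real.exp (μ * t) * (√(16 * K) * ‖w 0‖ + η)) +
      ∫⁻ t' in Set.Icc 0 t, ENNReal.ofReal (Real.exp (μ * (t - t')) * (C / √κ * r t')) := by
  set E : ℝ → ℝ := fun t => bform (b t) (w t) (w t) with hEdef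
  have h0T : (0 : ℝ) ∈ Set.Icc 0 T := ⟨le_rfl, ht.1.trans ht.2⟩
  have hK0 : 0 ≤ K := (abs_nonneg _).trans (hbK 0 h0T 0 0 0)
  have hBw0 : 0 ≤ Bw := (norm_nonneg _).trans (hwB 0 h0T)
  have hmain := sqrt_le_of_ae_deriv_le (E := E) (n := fun t => ‖w t‖) (r := r) (T := T)
    (L := 16 * (Lb * Bw * Bw) + 16 * (K * (Bw + Bw) * Lw)) (a := 16 * m + 2 * (C * q)) (c := C)
    (μ := μ) hκ hη (by positivity) hC hr (fun t => norm_nonneg _) ?_ hco ?_ hμ ht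
  · refine le_trans (ENNReal.ofReal_le_ofReal ?_) (hmain.trans (add_le_add
      (ENNReal.ofReal_le_ofReal (mul_le_mul_of_nonneg_left ?_ (Real.exp_pos _).le)) le_rfl))
    · refine Real.le_sqrt_of_sq_le ?_
      rw [mul_pow, Real.sq_sqrt hκ.le]
      nlinarith [hco t ht, sq_nonneg η]
    · refine Real.sqrt_le_iff.2 ⟨by positivity, ?_⟩
      have h1 := (le_abs_self _).trans (abs_bform_le (hb 0 h0T) (hbK 0 h0T) (w 0) (w 0))
      have h2 := Real.sq_sqrt (show 0 ≤ 16 * K by positivity)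
      have h3 : 0 ≤ √(16 * K) * ‖w 0‖ * η := by positivity
      calc E 0 + η ^ 2 ≤ 16 * K * ‖w 0‖ ^ 2 + η ^ 2 := by
            simp only [E]
            linarith
        _ = (√(16 * K)) ^ 2 * ‖w 0‖ ^ 2 + η ^ 2 := by rw [h2]
        _ ≤ _ := by nlinarith
  · intro t ht τ hτ
    refine (abs_bform_sub_bform_le (hb t ht) (hb τ hτ) (hbs t ht) (hbL t ht τ hτ) (hbK t ht)
      (hwB τ hτ) (hwB t ht) (hwL t ht τ hτ)).trans (le_of_eq ?_)
    ring
  -- Slopes are taken from the right, so the endpoint `T` is discarded.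
  · have hne : ∀ᵐ t ∂(volume.restrict (Set.Icc 0 T)), t ≠ T :=
      ae_restrict_of_ae (by simp [ae_iff, measure_singleton])
    filter_upwards [hbd, hest, hne, ae_restrict_mem measurableSet_Icc] with t hbd hest hne ht E' hE'
    have := hasDerivAt_bform_le (S := Set.Icc 0 T) (lt_of_le_of_ne ht.2 hne)
      (fun τ hτ => ⟨⟨ht.1.trans hτ.1.le, hτ.2.le⟩, hτ.1.ne'⟩) hb ht (hbs t ht) hbd
      ((tendsto_of_norm_sub_le (hwL t ht)).mono_left (nhdsWithin_mono _ Set.sdiff_subset))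
      (hwd t ht) hE'
    nlinarith

/-! ### The spaces `X^s` -/

/-- The weights `γ` are at least `P⁻¹`; since `P ≥ 1`, the loss `√P` is rounded up to `P`. -/
theorem hsNorm_le_xsNorm {P γ δ : ℝ} (ha : Adm P γ δ) (s : ℝ) (U : ℝ → Fin 4 → ℝ) (i : Fin 4) :
    hsNorm s (fun x => U x i) ≤ ENNReal.ofReal P * xsNorm γ s U := by
  have hP1 : (1 : ℝ≥0∞) ≤ ENNReal.ofReal P := by
    rw [← ENNReal.ofReal_one]
    exact ENNReal.ofReal_le_ofReal ha.one_le
  have hPγ : (1 : ℝ≥0∞) ≤ ENNReal.ofReal P * ENNReal.ofReal γ := by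
    rw [← ENNReal.ofReal_one, ← ENNReal.ofReal_mul ha.P_pos.le]
    refine ENNReal.ofReal_le_ofReal ?_
    rw [← mul_inv_cancel₀ ha.P_pos.ne']
    exact mul_le_mul_of_nonneg_left ha.le_γ ha.P_pos.le
  have hsq : xsNorm γ s U ^ 2 =
      ENNReal.ofReal γ * hsNorm s (fun x => U x 0) ^ 2 + hsNorm s (fun x => U x 1) ^ 2 +
        ENNReal.ofReal γ * hsNorm s (fun x => U x 2) ^ 2 + hsNorm s (fun x => U x 3) ^ 2 := by
    rw [xsNorm, ← ENNReal.rpow_natCast, ← ENNReal.rpow_mul]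
    norm_num
  have key : hsNorm s (fun x => U x i) ^ 2 ≤ (ENNReal.ofReal P * xsNorm γ s U) ^ 2 := by
    rw [mul_pow, sq (ENNReal.ofReal P), mul_assoc]
    have hγ : ∀ a : ℝ≥0∞, a ≤ ENNReal.ofReal P * (ENNReal.ofReal γ * a) := fun a => by
      rw [← mul_assoc]
      exact le_mul_of_one_le_left (zero_le) hPγ
    have h1 : ∀ a : ℝ≥0∞, a ≤ ENNReal.ofReal P * a := fun a =>
      le_mul_of_one_le_left (zero_le) hP1
    refine le_trans ?_ (h1 _)
    rw [hsq]
    fin_cases i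
    · refine (hγ _).trans (mul_le_mul_right ?_ _)
      exact (le_add_right le_rfl).trans ((le_add_right le_rfl).trans (le_add_right le_rfl))
    · refine (h1 _).trans (mul_le_mul_right ?_ _)
      exact (le_add_left le_rfl).trans ((le_add_right le_rfl).trans (le_add_right le_rfl))
    · refine (hγ _).trans (mul_le_mul_right ?_ _)
      exact (le_add_left le_rfl).trans (le_add_right le_rfl)
    · refine (h1 _).trans (mul_le_mul_right ?_ _)
      exact le_add_left le_rfl
  exact (ENNReal.pow_le_pow_left_iff two_ne_zero).1 key

theorem xsNorm_le {γ s : ℝ} (hγ : γ ≤ 1) {U : ℝ → Fin 4 → ℝ} {K : ℝ≥0∞}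
    (h : ∀ i, hsNorm s (fun x => U x i) ≤ K) : xsNorm γ s U ≤ 2 * K := by
  have hγ' : ENNReal.ofReal γ ≤ 1 := by
    rw [← ENNReal.ofReal_one]
    exact ENNReal.ofReal_le_ofReal hγ
  have h1 : ∀ i, hsNorm s (fun x => U x i) ^ 2 ≤ K ^ 2 := fun i => pow_le_pow_left' (h i) 2
  have h2 : ∀ i, ENNReal.ofReal γ * hsNorm s (fun x => U x i) ^ 2 ≤ K ^ 2 := fun i =>
    (mul_le_of_le_one_left (zero_le) hγ').trans (h1 i)
  have h3 : (2 * K) ^ 2 = K ^ 2 + K ^ 2 + K ^ 2 + K ^ 2 := by ring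
  have h4 : 2 * K = ((2 * K) ^ 2) ^ (1 / 2 : ℝ) := by
    rw [← ENNReal.rpow_natCast, ← ENNReal.rpow_mul]
    norm_num
  rw [h4, h3]
  exact ENNReal.rpow_le_rpow (add_le_add (add_le_add (add_le_add (h2 0) (h1 1)) (h2 2)) (h1 3))
    (by norm_num)

section

variable {P γ δ s σ : ℝ} {U U' : ℝ → Fin 4 → ℝ}

theorem memLp_of_xsNorm_lt_top (ha : Adm P γ δ) (h : xsNorm γ s U < ∞) (i : Fin 4) :
    MemLp (fun x => (U x i : ℂ)) 2 (volume : Measure ℝ) :=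
  memLp_of_hsNorm_lt_top ((hsNorm_le_xsNorm ha s U i).trans_lt
    (ENNReal.mul_lt_top ENNReal.ofReal_lt_top h))

theorem hsBdd_of_xsNorm_le (ha : Adm P γ δ) {a : ℝ} (ha0 : 0 ≤ a)
    (h : xsNorm γ s U ≤ ENNReal.ofReal a) (i : Fin 4) (hU : Continuous fun x => U x i) :
    HsBdd s (fun x => U x i) (P * a) :=
  ⟨hU, mul_nonneg ha.P_pos.le ha0, by
    rw [ENNReal.ofReal_mul ha.P_pos.le]
    exact (hsNorm_le_xsNorm ha s U i).trans (mul_le_mul_right h _)⟩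

theorem enorm_lamV_le_of_forall {N : ℕ} {K : ℝ≥0∞}
    (h : ∀ i, ‖Lam s N (toL2 fun x => U x i)‖ₑ ≤ K) : ‖lamV s N U‖ₑ ≤ K := by
  by_cases hK : K = ∞
  · simp [hK]
  lift K to ℝ≥0 using hK
  rw [← ofReal_norm, ENNReal.ofReal_le_coe]
  refine (pi_norm_le_iff_of_nonneg K.2).2 fun i => ?_
  have := h i
  rwa [← ofReal_norm, ENNReal.ofReal_le_coe] at this

theorem enorm_lamV_le (ha : Adm P γ δ) (hs : 0 ≤ s) (N : ℕ) (U : ℝ → Fin 4 → ℝ) :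
    ‖lamV s N U‖ₑ ≤ ENNReal.ofReal P * xsNorm γ s U :=
  enorm_lamV_le_of_forall fun i => (enorm_Lam_le hs N _).trans
    ((hsE_toL2_le s _).trans (hsNorm_le_xsNorm ha s U i))

/-- The truncated operator is bounded on `L²`, so convergence in `X^{s-1}` suffices for convergence
of `lamV s N`. The constant depends on `N`, which is harmless because it only serves for continuity
and differentiability in time. -/
theorem enorm_lamV_le_of_nonneg (ha : Adm P γ δ) (hσ : 0 ≤ σ) (N : ℕ) (U : ℝ → Fin 4 → ℝ) :
    ‖lamV s N U‖ₑ ≤ ENNReal.ofReal (‖Lam s N‖ * P) * xsNorm γ σ U := by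
  refine enorm_lamV_le_of_forall fun i => ?_
  rw [ENNReal.ofReal_mul (norm_nonneg _), mul_assoc]
  refine ((Lam s N).le_opENorm _).trans ?_
  rw [ofReal_norm]
  refine mul_le_mul_right ?_ _
  rw [enorm_eq_hsE_zero]
  exact (hsE_mono hσ _).trans ((hsE_toL2_le σ _).trans (hsNorm_le_xsNorm ha σ U i))

theorem norm_lamV_le (ha : Adm P γ δ) (hs : 0 ≤ s) (N : ℕ) {a : ℝ} (ha0 : 0 ≤ a)
    (h : xsNorm γ s U ≤ ENNReal.ofReal a) : ‖lamV s N U‖ ≤ P * a := by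
  have h1 := (enorm_lamV_le ha hs N U).trans (mul_le_mul_right h _)
  rw [← ENNReal.ofReal_mul ha.P_pos.le, ← ofReal_norm] at h1
  exact (ENNReal.ofReal_le_ofReal_iff (mul_nonneg ha.P_pos.le ha0)).1 h1

theorem lamV_smul (N : ℕ) (c : ℝ) (h : ∀ i, MemLp (fun x => (U x i : ℂ)) 2 (volume : Measure ℝ)) :
    lamV s N (c • U) = c • lamV s N U := by
  ext1 i
  exact (congrArg (Lam s N) (toL2_const_mul c (h i))).trans (map_smul _ _ _)

theorem toL2_sub {f g : ℝ → ℝ} (hf : MemLp (fun x => (f x : ℂ)) 2 (volume : Measure ℝ))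
    (hg : MemLp (fun x => (g x : ℂ)) 2 (volume : Measure ℝ)) :
    toL2 (fun x => f x - g x) = toL2 f - toL2 g := by
  have h1 := toL2_add hf (memLp_const_mul (-1) hg)
  rw [toL2_const_mul _ hg] at h1
  simpa [sub_eq_add_neg] using h1

theorem memLp_sub {f g : ℝ → ℝ} (hf : MemLp (fun x => (f x : ℂ)) 2 (volume : Measure ℝ))
    (hg : MemLp (fun x => (g x : ℂ)) 2 (volume : Measure ℝ)) :
    MemLp (fun x => ((f x - g x : ℝ) : ℂ)) 2 (volume : Measure ℝ) := by
  simpa [sub_eq_add_neg] using memLp_add hf (memLp_const_mul (-1) hg)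

theorem lamV_sub (N : ℕ) (h : ∀ i, MemLp (fun x => (U x i : ℂ)) 2 (volume : Measure ℝ))
    (h' : ∀ i, MemLp (fun x => (U' x i : ℂ)) 2 (volume : Measure ℝ)) :
    lamV s N (U - U') = lamV s N U - lamV s N U' := by
  ext1 i
  exact (congrArg (Lam s N) (toL2_sub (h i) (h' i))).trans (map_sub _ _ _)

end

section

variable {P γ δ s σ T : ℝ} {W : ℝ → ℝ → Fin 4 → ℝ}

theorem tendsto_lamV (ha : Adm P γ δ) (hσ : 0 ≤ σ) (N : ℕ) {l : Filter ℝ} {D : ℝ → Fin 4 → ℝ}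
    (hW : ∀ᶠ t in l, ∀ i, MemLp (fun x => (W t x i : ℂ)) 2 (volume : Measure ℝ))
    (hD : ∀ i, MemLp (fun x => (D x i : ℂ)) 2 (volume : Measure ℝ))
    (h : Tendsto (fun t => xsNorm γ σ (W t - D)) l (𝓝 0)) :
    Tendsto (fun t => lamV s N (W t)) l (𝓝 (lamV s N D)) := by
  rw [tendsto_iff_edist_tendsto_0]
  have h1 := ENNReal.Tendsto.const_mul (a := ENNReal.ofReal (‖Lam s N‖ * P)) h
    (Or.inr ENNReal.ofReal_ne_top)
  rw [mul_zero] at h1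
  refine tendsto_of_tendsto_of_tendsto_of_le_of_le' tendsto_const_nhds h1
    (Eventually.of_forall fun _ => zero_le) ?_
  filter_upwards [hW] with t ht
  rw [edist_eq_enorm_sub, ← lamV_sub N ht hD]
  exact enorm_lamV_le_of_nonneg ha hσ N _

theorem IsContinuousInXs.continuousOn_lamV (ha : Adm P γ δ) (hσ : 0 ≤ σ) (N : ℕ)
    (h : IsContinuousInXs γ σ T W) : ContinuousOn (fun t => lamV s N (W t)) (Set.Icc 0 T) :=
  fun t ht => tendsto_lamV ha hσ N
    (eventually_of_mem self_mem_nhdsWithin fun τ hτ => memLp_of_xsNorm_lt_top ha (h.1 τ hτ))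
    (memLp_of_xsNorm_lt_top ha (h.1 t ht)) (h.2 t ht)

theorem HasTimeDerivAt.tendsto_lamV (ha : Adm P γ δ) (hσ : 0 ≤ σ) (N : ℕ) {D : ℝ → Fin 4 → ℝ}
    {t : ℝ} (ht : t ∈ Set.Icc 0 T)
    (hW : ∀ t ∈ Set.Icc 0 T, ∀ i, MemLp (fun x => (W t x i : ℂ)) 2 (volume : Measure ℝ))
    (hD : ∀ i, MemLp (fun x => (D x i : ℂ)) 2 (volume : Measure ℝ))
    (h : HasTimeDerivAt γ σ T W D t) :
    Tendsto (fun τ => (τ - t)⁻¹ • (lamV s N (W τ) - lamV s N (W t))) (𝓝[Set.Icc 0 T \ {t}] t)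
      (𝓝 (lamV s N D)) := by
  have hm : ∀ τ ∈ Set.Icc 0 T \ {t}, ∀ i,
      MemLp (fun x => (((W τ - W t) x i : ℝ) : ℂ)) 2 (volume : Measure ℝ) := fun τ hτ i =>
    memLp_sub (hW τ hτ.1 i) (hW t ht i)
  refine (TwoLayer.tendsto_lamV (W := fun τ => (τ - t)⁻¹ • (W τ - W t)) ha hσ N ?_ hD h).congr' ?_
  · filter_upwards [self_mem_nhdsWithin] with τ hτ i
    exact memLp_const_mul _ (hm τ hτ i)
  · filter_upwards [self_mem_nhdsWithin] with τ hτ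
    rw [lamV_smul N _ (hm τ hτ), lamV_sub N (hW τ hτ.1) (hW t ht)]

theorem exists_norm_sub_le_of_tendsto_slope {E : Type*} [NormedAddCommGroup E] [NormedSpace ℝ E]
    {w w' : ℝ → E} (hw' : ContinuousOn w' (Set.Icc 0 T))
    (h : ∀ t ∈ Set.Icc 0 T, Tendsto (fun τ => (τ - t)⁻¹ • (w τ - w t))
      (𝓝[Set.Icc 0 T \ {t}] t) (𝓝 (w' t))) :
    ∃ L, ∀ t ∈ Set.Icc 0 T, ∀ τ ∈ Set.Icc 0 T, ‖w τ - w t‖ ≤ L * |τ - t| := by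
  obtain ⟨L, hL⟩ := isCompact_Icc.exists_bound_of_continuousOn hw'
  refine ⟨L, fun t ht τ hτ => ?_⟩
  exact (convex_Icc 0 T).norm_image_sub_le_of_norm_hasDerivWithin_le
    (fun x hx => hasDerivWithinAt_iff_tendsto_slope.2 (h x hx)) hL ht hτ

theorem norm_Lam_mono (hs : 0 ≤ s) {N N' : ℕ} (h : N ≤ N') (f : L2) :
    ‖Lam s N f‖ ≤ ‖Lam s N' f‖ := by
  rw [norm_Lam, norm_Lam]
  refine (norm_le_of_ae_le (C := 1) ?_).trans (one_mul _).le
  filter_upwards [coeFn_mulL (isBddMeas_lam hs N) (𝓕 f), coeFn_mulL (isBddMeas_lam hs N') (𝓕 f)]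
    with ξ h1 h2
  rw [h1, h2, one_mul, norm_mul, norm_mul, Complex.norm_real, Complex.norm_real,
    Real.norm_of_nonneg (lam_pos _ _ _).le, Real.norm_of_nonneg (lam_pos _ _ _).le]
  exact mul_le_mul_of_nonneg_right (lam_mono hs h ξ) (norm_nonneg _)

theorem eventually_hsE_le (hs : 0 ≤ s) {f : L2} (hf : hsE s f < ∞) {ε : ℝ} (hε : 0 < ε) :
    ∀ᶠ N in atTop, (hsE s f).toReal ≤ ‖Lam s N f‖ + ε := by
  suffices h : ∃ N, (hsE s f).toReal ≤ ‖Lam s N f‖ + ε by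
    obtain ⟨N, hN⟩ := h
    filter_upwards [eventually_ge_atTop N] with n hn
    exact hN.trans (add_le_add (norm_Lam_mono hs hn f) le_rfl)
  by_contra! h
  have h1 : hsE s f ≤ ENNReal.ofReal ((hsE s f).toReal - ε) := hsE_le_of_forall hs fun N => by
    rw [← ofReal_norm]
    exact ENNReal.ofReal_le_ofReal (by linarith [h N])
  have h2 := h 0
  have h3 := (ENNReal.le_ofReal_iff_toReal_le hf.ne (by linarith [norm_nonneg (Lam s 0 f)])).1 h1
  linarith

/-- Dini's argument: at a fixed time the truncated norms increase to the full one, and continuity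
into `X^s` makes this uniform near that time. Compactness of `[0,T]` gives one `N` for all times,
which closes the estimate up to `ε`. -/
theorem IsContinuousInXs.eventually_hsBdd (ha : Adm P γ δ) (hs : 0 ≤ s)
    (h : IsContinuousInXs γ s T W) (hc : ∀ t ∈ Set.Icc 0 T, Continuous (W t)) {ε : ℝ} (hε : 0 < ε) :
    ∀ᶠ N in atTop, ∀ t ∈ Set.Icc 0 T, ∀ i, HsBdd s (fun x => W t x i) (‖lamV s N (W t)‖ + ε) := by
  have hm := fun t ht => memLp_of_xsNorm_lt_top ha (h.1 t ht)
  suffices H : ∀ᶠ N in atTop, ∀ t ∈ Set.Icc 0 T, ∀ i n,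
      ‖Lam s n (toL2 fun x => W t x i)‖ ≤ ‖lamV s N (W t)‖ + ε by
    filter_upwards [H] with N hN t ht i
    exact .of_forall ((continuous_apply i).comp (hc t ht)) (by positivity) hs (hm t ht i)
      (hN t ht i)
  refine isCompact_Icc.induction_on (p := fun S => ∀ᶠ N in atTop, ∀ t ∈ S, ∀ i n,
      ‖Lam s n (toL2 fun x => W t x i)‖ ≤ ‖lamV s N (W t)‖ + ε) (by simp)
    (fun S S' hS h => h.mono fun N hN t ht => hN t (hS ht))
    (fun S S' h h' => by
      filter_upwards [h, h'] with N hN hN' t ht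
      exact ht.elim (hN t) (hN' t)) fun t ht => ?_
  have hf : ∀ i, hsE s (toL2 fun x => W t x i) < ∞ := fun i =>
    (hsE_toL2_le s _).trans_lt ((hsNorm_le_xsNorm ha s _ i).trans_lt
      (ENNReal.mul_lt_top ENNReal.ofReal_lt_top (h.1 t ht)))
  have hP := ha.P_pos
  -- Three errors of `ε / 3`: from `τ` to `t`, the truncation at `t`, and back to `τ`. The division
  -- by `P` compensates the passage to components.
  have hsmall : ∀ᶠ τ in 𝓝[Set.Icc 0 T] t, xsNorm γ s (W τ - W t) ≤ ENNReal.ofReal (ε / 3 / P) :=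
    (h.2 t ht).eventually (ge_mem_nhds (ENNReal.ofReal_pos.2 (by positivity)))
  refine ⟨_, inter_mem hsmall self_mem_nhdsWithin, ?_⟩
  filter_upwards [eventually_all.2 fun i => eventually_hsE_le hs (hf i) (by positivity : 0 < ε / 3)]
    with N hN τ hτ i n
  have hd : ∀ n, ‖lamV s n (W τ) - lamV s n (W t)‖ ≤ ε / 3 := fun n => by
    rw [← lamV_sub n (hm τ hτ.2) (hm t ht)]
    refine (norm_lamV_le ha hs n (by positivity) hτ.1).trans (le_of_eq ?_)
    field_simp
  have h1 := (norm_le_pi_norm _ i).trans (hd n)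
  have h2 := norm_sub_norm_le (lamV s n (W τ) i) (lamV s n (W t) i)
  have h3 : ‖lamV s n (W t) i‖ ≤ (hsE s (toL2 fun x => W t x i)).toReal := by
    rw [← ENNReal.ofReal_le_iff_le_toReal (hf i).ne, ofReal_norm]
    exact enorm_Lam_le hs n _
  have h4 := hN i
  have h5 := norm_le_pi_norm (lamV s N (W t)) i
  have h6 := norm_sub_norm_le (lamV s N (W t)) (lamV s N (W τ))
  rw [norm_sub_rev] at h6
  have h7 := hd N
  change ‖lamV s n (W τ) i‖ ≤ _
  change _ ≤ ‖lamV s N (W t) i‖ + _ at h4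
  rw [Pi.sub_apply] at h1
  linarith

end

/-! ### Time regularity of the coefficients -/

theorem exists_near_of_ae {T : ℝ} (hT : 0 < T) {p : ℝ → Prop}
    (hp : ∀ᵐ t ∂(volume.restrict (Set.Icc 0 T)), p t) {t ε : ℝ} (ht : t ∈ Set.Icc 0 T)
    (hε : 0 < ε) : ∃ τ ∈ Set.Icc 0 T, |τ - t| ≤ ε ∧ p τ := by
  have hlt : max 0 (t - ε) < min T (t + ε) :=
    max_lt (lt_min hT (by linarith [ht.1])) (lt_min (by linarith [ht.2]) (by linarith))
  have hsub : Set.Ioo (max 0 (t - ε)) (min T (t + ε)) ⊆ Set.Icc 0 T := fun τ hτ =>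
    ⟨(le_max_left _ _).trans hτ.1.le, hτ.2.le.trans (min_le_left _ _)⟩
  have h1 := ae_restrict_of_ae_restrict_of_subset hsub hp
  have : (ae (volume.restrict (Set.Ioo (max 0 (t - ε)) (min T (t + ε))))).NeBot := by
    rw [ae_neBot, Ne, Measure.restrict_eq_zero, Real.volume_Ioo, ENNReal.ofReal_eq_zero, not_le]
    exact sub_pos.2 hlt
  obtain ⟨τ, h2, h3⟩ := (h1.and (ae_restrict_mem measurableSet_Ioo)).exists
  refine ⟨τ, hsub h3, abs_le.2 ⟨?_, ?_⟩, h2⟩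
  · linarith [(le_max_right 0 (t - ε)).trans h3.1.le]
  · linarith [h3.2.le.trans (min_le_right T (t + ε))]

/-- The `X^s` bound on `V` holds for almost every time only, while the symmetrizer must be
controlled at every time; Lipschitz continuity transfers pointwise bounds. -/
theorem abs_le_of_ae_of_lipschitz {T B L : ℝ} (hT : 0 < T) {f : ℝ → ℝ}
    (hf : ∀ᵐ t ∂(volume.restrict (Set.Icc 0 T)), |f t| ≤ B)
    (hL : ∀ t ∈ Set.Icc 0 T, ∀ τ ∈ Set.Icc 0 T, |f τ - f t| ≤ L * |τ - t|)
    {t : ℝ} (ht : t ∈ Set.Icc 0 T) : |f t| ≤ B := by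
  have hL0 : 0 ≤ L := by
    have := (abs_nonneg _).trans (hL 0 ⟨le_rfl, hT.le⟩ T ⟨hT.le, le_rfl⟩)
    rw [sub_zero, abs_of_pos hT] at this
    exact nonneg_of_mul_nonneg_left this hT
  refine le_of_forall_pos_le_add fun ε hε => ?_
  obtain ⟨τ, hτ, h1, h2⟩ := exists_near_of_ae hT hf ht (show 0 < ε / (L + 1) by positivity)
  have h3 := hL τ hτ t ht
  rw [abs_sub_comm t τ] at h3
  have h4 : L * |τ - t| ≤ ε := by
    calc L * |τ - t| ≤ (L + 1) * (ε / (L + 1)) := by gcongr; linarith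
      _ = ε := by field_simp
  linarith [abs_sub_abs_le_abs_sub (f t) (f τ)]

section

variable {P γ δ σ T : ℝ} {V : ℝ → ℝ → Fin 4 → ℝ}

/-- Near `t` the difference quotient is within `M` of a derivative of norm at most `M`, whence `2
M`. The Lipschitz constant of `V` itself is not bounded by hypothesis and must not enter the final
constant. -/
theorem HasTimeDerivAt.eventually_hsBdd (ha : Adm P γ δ) (hσ : 0 ≤ σ) {D : ℝ → Fin 4 → ℝ}
    {t M : ℝ} (hM : 0 < M) (ht : t ∈ Set.Icc 0 T) (hc : ∀ t ∈ Set.Icc 0 T, Continuous (V t))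
    (hV : ∀ τ ∈ Set.Icc 0 T, xsNorm γ σ (V τ - V t) < ∞) (hD : xsNorm γ σ D ≤ ENNReal.ofReal M)
    (h : HasTimeDerivAt γ σ T V D t) :
    ∀ᶠ τ in 𝓝[Set.Icc 0 T \ {t}] t, ∀ i,
      HsBdd σ (fun x => V τ x i - V t x i) (2 * P * M * |τ - t|) := by
  have hP := ha.P_pos
  have hDm := memLp_of_xsNorm_lt_top ha (hD.trans_lt ENNReal.ofReal_lt_top)
  filter_upwards [h.eventually (ge_mem_nhds (ENNReal.ofReal_pos.2 hM)), self_mem_nhdsWithin]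
    with τ h1 hτ i
  have hm := memLp_of_xsNorm_lt_top ha (hV τ hτ.1)
  refine .of_forall (((continuous_apply i).comp (hc τ hτ.1)).sub
    ((continuous_apply i).comp (hc t ht))) (by positivity) hσ (hm i) fun N => ?_
  have hne : τ - t ≠ 0 := sub_ne_zero.2 hτ.2
  have e1 : lamV σ N ((τ - t)⁻¹ • (V τ - V t) - D) =
      (τ - t)⁻¹ • lamV σ N (V τ - V t) - lamV σ N D := by
    rw [lamV_sub (U := (τ - t)⁻¹ • (V τ - V t)) N (fun i => memLp_const_mul _ (hm i)) hDm,
      lamV_smul N _ hm]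
  have e2 : lamV σ N (V τ - V t) =
      (τ - t) • (lamV σ N ((τ - t)⁻¹ • (V τ - V t) - D) + lamV σ N D) := by
    rw [e1, sub_add_cancel, smul_smul, mul_inv_cancel₀ hne, one_smul]
  refine (norm_le_pi_norm (lamV σ N (V τ - V t)) i).trans ?_
  rw [e2, norm_smul, Real.norm_eq_abs, mul_comm]
  refine mul_le_mul_of_nonneg_right ((norm_add_le _ _).trans ?_) (abs_nonneg _)
  linarith [norm_lamV_le ha hσ N hM.le h1, norm_lamV_le ha hσ N hM.le hD]

end

/-! ### The energy estimate -/

/-- Passage from truncated norms to `X^s` norms. The same `ε` measures the truncation error and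
regularizes the square root; its contributions are gathered in a last term linear in `ε`. -/
theorem le_of_energy_estimate {n n₀ μ t S D q ε κ C P : ℝ} {r : ℝ → ℝ} {x x₀ : ℝ≥0∞} {ρ : ℝ → ℝ≥0∞}
    (hκ : 0 < κ) (hε : 0 < ε) (hS : 0 ≤ S) (hD : 0 ≤ D) (hq : 0 ≤ q) (hn : 0 ≤ n)
    (hn₀ : 0 ≤ n₀) (hμ : 0 ≤ μ) (ht : 0 ≤ t) (hr : ∀ t, 0 ≤ r t)
    (h : ENNReal.ofReal (√κ * n) ≤ ENNReal.ofReal (Real.exp (μ * t) * (S * n₀ + ε)) +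
      ∫⁻ t' in Set.Icc 0 t, ENNReal.ofReal (Real.exp (μ * (t - t')) * (D * (q * ε + r t'))))
    (hx : x ≤ 2 * ENNReal.ofReal (n + ε)) (hx₀ : ENNReal.ofReal n₀ ≤ ENNReal.ofReal P * x₀)
    (hρ : ∀ t, ENNReal.ofReal (r t) ≤ ENNReal.ofReal P * ρ t)
    (hCS : 2 / √κ * S * P ≤ C) (hCD : 2 / √κ * D * P ≤ C) :
    x ≤ ENNReal.ofReal C * x₀ * ENNReal.ofReal (Real.exp (μ * t)) + ENNReal.ofReal C *
      (∫⁻ t' in Set.Icc 0 t, ENNReal.ofReal (Real.exp (μ * (t - t'))) * ρ t') +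
      ENNReal.ofReal ((2 + 2 / √κ * (Real.exp (μ * t) + t * (Real.exp (μ * t) * D * q))) * ε) := by
  have hκ0 := Real.sqrt_pos.2 hκ
  set k := 2 / √κ with hk
  have hk0 : 0 < k := by positivity
  set e := Real.exp (μ * t)
  have he : 0 < e := Real.exp_pos _
  have hint : ∫⁻ t' in Set.Icc 0 t, ENNReal.ofReal (Real.exp (μ * (t - t')) * (D * (q * ε + r t')))
      ≤ ENNReal.ofReal (t * (e * D * q) * ε) + ENNReal.ofReal (D * P) *
        ∫⁻ t' in Set.Icc 0 t, ENNReal.ofReal (Real.exp (μ * (t - t'))) * ρ t' := by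
    have h1 : ∀ t' ∈ Set.Icc 0 t,
        ENNReal.ofReal (Real.exp (μ * (t - t')) * (D * (q * ε + r t'))) ≤
        ENNReal.ofReal (e * D * q * ε) +
          ENNReal.ofReal (D * P) * (ENNReal.ofReal (Real.exp (μ * (t - t'))) * ρ t') := by
      intro t' ht'
      have h2 : Real.exp (μ * (t - t')) ≤ e :=
        Real.exp_le_exp.2 (mul_le_mul_of_nonneg_left (by linarith [ht'.1]) hμ)
      have h3 := Real.exp_pos (μ * (t - t'))
      have h4 := hr t'
      calc ENNReal.ofReal (Real.exp (μ * (t - t')) * (D * (q * ε + r t')))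
          = ENNReal.ofReal (Real.exp (μ * (t - t')) * D * q * ε) +
            ENNReal.ofReal D * (ENNReal.ofReal (Real.exp (μ * (t - t'))) *
              ENNReal.ofReal (r t')) := by
            rw [← ENNReal.ofReal_mul h3.le, ← ENNReal.ofReal_mul hD,
              ← ENNReal.ofReal_add (by positivity) (by positivity)]
            congr 1
            ring
        _ ≤ ENNReal.ofReal (e * D * q * ε) + ENNReal.ofReal D *
            (ENNReal.ofReal (Real.exp (μ * (t - t'))) * (ENNReal.ofReal P * ρ t')) := by
            gcongr
            exact hρ t'
        _ = _ := by
            rw [ENNReal.ofReal_mul hD]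
            ring
    refine (setLIntegral_mono' measurableSet_Icc h1).trans ?_
    rw [lintegral_add_left measurable_const, lintegral_const_mul' _ _ ENNReal.ofReal_ne_top,
      setLIntegral_const, Real.volume_Icc, sub_zero, ← ENNReal.ofReal_mul (by positivity)]
    refine add_le_add (ENNReal.ofReal_le_ofReal (le_of_eq ?_)) le_rfl
    ring
  set I := ∫⁻ t' in Set.Icc 0 t, ENNReal.ofReal (Real.exp (μ * (t - t'))) * ρ t'
  have hx' : x ≤ ENNReal.ofReal (2 * ε) + ENNReal.ofReal k * ENNReal.ofReal (√κ * n) := by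
    refine hx.trans (le_of_eq ?_)
    rw [← ENNReal.ofReal_mul hk0.le, ← ENNReal.ofReal_add (by positivity) (by positivity),
      ← ENNReal.ofReal_ofNat 2, ← ENNReal.ofReal_mul (by norm_num)]
    congr 1
    rw [hk]
    field_simp
    ring
  calc x ≤ _ := hx'
    _ ≤ ENNReal.ofReal (2 * ε) + ENNReal.ofReal k * (ENNReal.ofReal (e * (S * n₀ + ε)) +
        (ENNReal.ofReal (t * (e * D * q) * ε) + ENNReal.ofReal (D * P) * I)) := by
        gcongr
        exact h.trans (add_le_add le_rfl hint)
    _ = ENNReal.ofReal (k * S) * ENNReal.ofReal n₀ * ENNReal.ofReal e +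
        ENNReal.ofReal (k * D * P) * I +
        ENNReal.ofReal ((2 + k * (e + t * (e * D * q))) * ε) := by
        have e1 : ENNReal.ofReal (e * (S * n₀ + ε)) =
            ENNReal.ofReal S * ENNReal.ofReal n₀ * ENNReal.ofReal e + ENNReal.ofReal (e * ε) := by
          rw [← ENNReal.ofReal_mul hS, ← ENNReal.ofReal_mul (by positivity),
            ← ENNReal.ofReal_add (by positivity) (by positivity)]
          congr 1
          ring
        have e2 : ENNReal.ofReal ((2 + k * (e + t * (e * D * q))) * ε) =
            ENNReal.ofReal (2 * ε) + ENNReal.ofReal k * (ENNReal.ofReal (e * ε) +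
              ENNReal.ofReal (t * (e * D * q) * ε)) := by
          rw [← ENNReal.ofReal_add (by positivity) (by positivity), ← ENNReal.ofReal_mul hk0.le,
            ← ENNReal.ofReal_add (by positivity) (by positivity)]
          congr 1
          ring
        rw [e1, e2, ENNReal.ofReal_mul hk0.le, mul_assoc k, ENNReal.ofReal_mul hk0.le]
        ring
    _ ≤ ENNReal.ofReal (k * S) * (ENNReal.ofReal P * x₀) * ENNReal.ofReal e +
        ENNReal.ofReal (k * D * P) * I +
        ENNReal.ofReal ((2 + k * (e + t * (e * D * q))) * ε) := by gcongr
    _ = ENNReal.ofReal (k * S * P) * x₀ * ENNReal.ofReal e +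
        ENNReal.ofReal (k * D * P) * I +
        ENNReal.ofReal ((2 + k * (e + t * (e * D * q))) * ε) := by
        rw [ENNReal.ofReal_mul (p := k * S) (by positivity)]
        ring
    _ ≤ _ := by gcongr

theorem exists_energy_estimate {s : ℝ} (hs : 3 / 2 < s) (P : ℝ) (hP : 0 < P) :
    ∃ C : ℝ, ∀ γ δ, Adm P γ δ → ∀ M T h₀ : ℝ, 0 < M → M ≤ P → 0 < T → P⁻¹ ≤ h₀ →
      ∀ V V' W R : ℝ → ℝ → Fin 4 → ℝ,
      (∀ t ∈ Set.Icc 0 T, Continuous (V t)) →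
      (∀ t ∈ Set.Icc 0 T, IsHyperbolic γ δ h₀ (fun x => chgF γ δ (V t x))) →
      HasBoundedTimeDeriv γ (s - 1) T V V' →
      (∀ᵐ t ∂(volume.restrict (Set.Icc 0 T)), xsNorm γ s (V t) ≤ ENNReal.ofReal M) →
      (∀ᵐ t ∂(volume.restrict (Set.Icc 0 T)), xsNorm γ (s - 1) (V' t) ≤ ENNReal.ofReal M) →
      IsStrongSolution γ δ s T V W R →
      ∀ C₀ : ℝ, C ≤ C₀ → ∀ t ∈ Set.Icc 0 T,
        xsNorm γ s (W t) ≤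
          ENNReal.ofReal C₀ * xsNorm γ s (W 0) * ENNReal.ofReal (Real.exp (C₀ * M * t)) +
          ENNReal.ofReal C₀ * ∫⁻ t' in Set.Icc 0 t,
            ENNReal.ofReal (Real.exp (C₀ * M * (t - t'))) * xsNorm γ s (R t') := by
  have hs0 : 0 ≤ s := by linarith
  have hs1 : 0 ≤ s - 1 := by linarith
  have hPi : 0 < P⁻¹ := inv_pos.2 hP
  obtain ⟨Kb, hKb0, hKb⟩ := exists_abs_le_of_hsBdd (p := s) (by linarith)
  obtain ⟨K1, hK10, hK1⟩ := exists_abs_le_of_hsBdd (p := s - 1) (by linarith)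
  obtain ⟨κ, hκ, hκT⟩ := exists_symT_coercive P (Kb * (P * P)) P⁻¹ hPi
  obtain ⟨KT, hKT0, hKT⟩ := (mTame_symT P).exists_lipschitz (Kb * (P * P)) P⁻¹ hPi
  obtain ⟨Ce, hCe0, hCe⟩ := exists_space_estimate hs P (P * P) P⁻¹ hPi
  set c := KT * (K1 * (2 * P))
  have hc0 : 0 ≤ c := by positivity
  have hκ0 := Real.sqrt_pos.2 hκ
  -- The three terms control the initial data, the source and the growth rate; being nonnegative,
  -- each is at most the sum.
  refine ⟨2 / √κ * √(16 * KT) * P + 2 / √κ * (Ce / √κ) * P + (16 * c + 2 * (Ce * P)) / (2 * κ), ?_⟩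
  intro γ δ ha M T h₀ hM hMP hT hh₀ V V' W R hVc hhyp hVt hVM hV'M hsol C₀ hC₀ t ht
  obtain ⟨hWc, hWX, W', hW'X, hWd, hpde⟩ := hsol
  have hA1 : 0 ≤ 2 / √κ * √(16 * KT) * P := by positivity
  have hA2 : 0 ≤ 2 / √κ * (Ce / √κ) * P := by positivity
  have hA3 : 0 ≤ (16 * c + 2 * (Ce * P)) / (2 * κ) := by positivity
  have hC₀0 : 0 ≤ C₀ := by linarith
  have hC₀κ : 16 * c + 2 * (Ce * P) ≤ C₀ * (2 * κ) :=
    (div_le_iff₀ (by positivity)).1 (by linarith)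
  obtain ⟨KL, hKL⟩ := hVt.lipschitz
  have hVdiff : ∀ t ∈ Set.Icc 0 T, ∀ τ ∈ Set.Icc 0 T, ∀ i x,
      |V τ x i - V t x i| ≤ K1 * (P * (KL * |τ - t|)) := fun t ht τ hτ i x => by
    have h1 : xsNorm γ (s - 1) (V τ - V t) ≤ ENNReal.ofReal (KL * |τ - t|) := by
      rw [ENNReal.ofReal_mul KL.coe_nonneg, ENNReal.ofReal_coe_nnreal]
      exact hKL t ht τ hτ
    exact hK1 _ _ (hsBdd_of_xsNorm_le ha (by positivity) h1 i
      (((continuous_apply i).comp (hVc τ hτ)).sub ((continuous_apply i).comp (hVc t ht)))) x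
  have hVH : ∀ᵐ t ∂(volume.restrict (Set.Icc 0 T)), ∀ i, HsBdd s (fun x => V t x i) (P * M) := by
    filter_upwards [hVM, ae_restrict_mem measurableSet_Icc] with t h1 ht i
    exact hsBdd_of_xsNorm_le ha hM.le h1 i ((continuous_apply i).comp (hVc t ht))
  -- Components have `H^s` norm at most `P M ≤ P * P`. The bound then depends on `P` alone and may
  -- be used in constants fixed before `M`.
  have hVB : ∀ t ∈ Set.Icc 0 T, ∀ x i, |V t x i| ≤ Kb * (P * P) := fun t ht x i => by
    refine abs_le_of_ae_of_lipschitz (f := fun t => V t x i) (L := K1 * (P * KL)) hT ?_ ?_ ht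
    · filter_upwards [hVH] with t h1
      exact (hKb _ _ (h1 i) x).trans (by gcongr)
    · intro t ht τ hτ
      exact (hVdiff t ht τ hτ i x).trans (le_of_eq (by ring))
  have hd1 : ∀ t ∈ Set.Icc 0 T, ∀ x, P⁻¹ ≤ depth₁ γ δ (V t x) := fun t ht x =>
    hh₀.trans (hhyp t ht x).1
  have hd2 : ∀ t ∈ Set.Icc 0 T, ∀ x, P⁻¹ ≤ depth₂ δ (V t x) -
      |chgF γ δ (V t x) 3 - chgF γ δ (V t x) 2| ^ 2 / (γ + δ) := fun t ht x =>
    hh₀.trans (hhyp t ht x).2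
  have hds : ∀ t ∈ Set.Icc 0 T, ∀ x, P⁻¹ ≤ depth₁ γ δ (V t x) + depth₂ δ (V t x) :=
    fun t ht x => by
      have h1 : 0 ≤ |chgF γ δ (V t x) 3 - chgF γ δ (V t x) 2| ^ 2 / (γ + δ) := by
        have := ha.γ_pos
        have := ha.δ_pos
        positivity
      linarith [hd1 t ht x, hd2 t ht x]
  set b : ℝ → Fin 4 → Fin 4 → ℝ → ℝ := fun t i j x => symT γ δ (V t x) i j
  have hbK : ∀ t ∈ Set.Icc 0 T, ∀ i j x, |b t i j x| ≤ KT := fun t ht i j x =>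
    (hKT γ δ ha _ _ (hVB t ht x) (hVB t ht x) (hds t ht x) (hds t ht x) i j).1
  have hbV : ∀ t ∈ Set.Icc 0 T, ∀ τ ∈ Set.Icc 0 T, ∀ d, (∀ i x, |V τ x i - V t x i| ≤ d) →
      ∀ i j x, |b τ i j x - b t i j x| ≤ KT * d := fun t ht τ hτ d hd i j x =>
    (hKT γ δ ha _ _ (hVB τ hτ x) (hVB t ht x) (hds τ hτ x) (hds t ht x) i j).2 d fun i => hd i x
  have hbc : ∀ t ∈ Set.Icc 0 T, ∀ i j, Continuous (b t i j) := fun t ht i j => by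
    refine continuous_iff_continuousAt.2 fun x => tendsto_iff_dist_tendsto_zero.2 ?_
    have h1 := ((tendsto_iff_dist_tendsto_zero.1 (hVc t ht).continuousAt).const_mul KT :
      Tendsto (fun y => KT * dist (V t y) (V t x)) (𝓝 x) _)
    rw [mul_zero] at h1
    refine squeeze_zero (fun _ => dist_nonneg) (fun y => ?_) h1
    exact (hKT γ δ ha _ _ (hVB t ht y) (hVB t ht x) (hds t ht y) (hds t ht x) i j).2 _
      fun i => dist_le_pi_dist (V t y) (V t x) i
  have hb : ∀ t ∈ Set.Icc 0 T, ∀ i j, IsBddMeas (b t i j) := fun t ht i j =>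
    .of_continuous (hbc t ht i j) (hbK t ht i j)
  have hbs : ∀ t ∈ Set.Icc 0 T, ∀ i j, b t i j = b t j i := fun t ht i j => funext fun x =>
    congrFun (congrFun (symT_isSymm γ δ (V t x)) j) i
  have hWm := fun t ht => memLp_of_xsNorm_lt_top ha (hWX.1 t ht)
  have hW'm := fun t ht => memLp_of_xsNorm_lt_top ha (hW'X.1 t ht)
  have hfin : ∀ ε : ℝ, 0 < ε → xsNorm γ s (W t) ≤
      ENNReal.ofReal C₀ * xsNorm γ s (W 0) * ENNReal.ofReal (Real.exp (C₀ * M * t)) +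
      ENNReal.ofReal C₀ * (∫⁻ t' in Set.Icc 0 t,
        ENNReal.ofReal (Real.exp (C₀ * M * (t - t'))) * xsNorm γ s (R t')) +
      ENNReal.ofReal ((2 + 2 / √κ * (Real.exp (C₀ * M * t) +
        t * (Real.exp (C₀ * M * t) * (Ce / √κ) * (P * M)))) * ε) := by
    intro ε hε
    obtain ⟨N, hN⟩ := (hWX.eventually_hsBdd ha hs0 hWc hε).exists
    have hslope := fun t ht => (hWd t ht).tendsto_lamV (s := s) ha hs1 N ht hWm (hW'm t ht)
    obtain ⟨Lw, hLw⟩ := exists_norm_sub_le_of_tendsto_slope (T := T)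
      (w := fun t => lamV s N (W t)) (hW'X.continuousOn_lamV (s := s) ha hs1 N) hslope
    obtain ⟨Bw, hBw⟩ := isCompact_Icc.exists_bound_of_continuousOn
      (hWX.continuousOn_lamV (s := s) ha hs0 N)
    -- The full norm is at most `‖w‖ + ε`, so `P M ε` joins the source. Both `m = c M` and `q = P M`
    -- are proportional to `M`, which allows the rate `μ = C₀ M`.
    have hen := energy_estimate (b := b) (w := fun t => lamV s N (W t))
      (w' := fun t => lamV s N (W' t)) (r := fun t => P * M * ε + ‖lamV s N (R t)‖)
      (T := T) (K := KT) (Lb := KT * (K1 * (P * KL))) (Lw := Lw) (Bw := Bw) (m := c * M) (κ := κ)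
      (C := Ce) (q := P * M) (μ := C₀ * M) (η := ε) hκ hε (by positivity) hCe0 (by positivity)
      (fun t => by positivity) hb hbs hbK
      (fun t ht τ hτ i j x => (hbV t ht τ hτ _ (hVdiff t ht τ hτ) i j x).trans
        (le_of_eq (by ring))) ?_ hLw hBw hslope ?_ ?_ (by nlinarith) ht
    · refine le_of_energy_estimate (n := ‖lamV s N (W t)‖) (n₀ := ‖lamV s N (W 0)‖)
        (r := fun t => ‖lamV s N (R t)‖) (P := P) hκ hε (Real.sqrt_nonneg (16 * KT))
        (by positivity) (by positivity)
        (norm_nonneg _) (norm_nonneg _) (by positivity) ht.1 (fun _ => norm_nonneg _) hen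
        (xsNorm_le ha.γ_lt.le fun i => (hN t ht i).le) ?_ (fun t => ?_) (by linarith) (by linarith)
      · rw [ofReal_norm]
        exact enorm_lamV_le ha hs0 N _
      · rw [ofReal_norm]
        exact enorm_lamV_le ha hs0 N _
    · filter_upwards [hVt.hasDeriv, hV'M, ae_restrict_mem measurableSet_Icc] with t h1 h2 ht
      have h3 := h1.eventually_hsBdd ha hs1 hM ht hVc (fun τ hτ => (hKL t ht τ hτ).trans_lt
        (ENNReal.mul_lt_top ENNReal.coe_lt_top ENNReal.ofReal_lt_top)) h2
      filter_upwards [h3, self_mem_nhdsWithin] with τ h4 hτ i j x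
      refine (hbV t ht τ hτ.1 _ (fun i x => hK1 _ _ (h4 i) x) i j x).trans (le_of_eq ?_)
      simp only [c]
      ring
    · intro t ht
      refine bform_coercive (hb t ht) hκ.le (fun x v => ?_) _
      refine (hκT γ δ ha (V t x) (hVB t ht x) (hd1 t ht x) (hd2 t ht x) v).trans (le_of_eq ?_)
      simp only [dotProduct, Matrix.mulVec, Finset.mul_sum, b]
      refine Finset.sum_congr rfl fun i _ => Finset.sum_congr rfl fun j _ => ?_
      ring
    · filter_upwards [hVH, ae_restrict_mem measurableSet_Icc] with t h1 ht
      refine (hCe γ δ ha (V t) (W t) (W' t) (R t) (P * M) _ h1 (by gcongr) (hds t ht) (hN t ht)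
        (hW'm t ht) (hpde t ht) N).trans (le_of_eq ?_)
      ring
  -- The integer `N` no longer appears, so `ε` can be sent to `0`.
  refine ENNReal.le_of_forall_pos_le_add fun ε hε _ => ?_
  set G := 2 + 2 / √κ * (Real.exp (C₀ * M * t) +
        t * (Real.exp (C₀ * M * t) * (Ce / √κ) * (P * M)))
  have hG : 0 < G := by
    have := ht.1
    positivity
  refine (hfin (ε / G) (by positivity)).trans (le_of_eq ?_)
  rw [mul_div_cancel₀ _ hG.ne', ENNReal.ofReal_coe_nnreal]

end TwoLayer

end

/-! ### The theorem: a monotone choice of the constant. -/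

theorem lemma3p6 (s₀ s : ℝ) (hs₀ : 1 / 2 < s₀) (hs : s₀ + 1 ≤ s) :
    ∃ C : (Fin 5 → ℝ) → ℝ≥0, Monotone C ∧
      ∀ δmin δmax γmin M T h₀ : ℝ,
        0 < δmin → 0 < γmin → 0 < M → 0 < T → 0 < h₀ →
      ∀ δ γ : ℝ, δmin ≤ δ → δ ≤ δmax → γmin ≤ γ → γ < 1 →
      ∀ V V' W R : ℝ → ℝ → Fin 4 → ℝ,
        (∀ t ∈ Set.Icc 0 T, Continuous (V t)) →
        (∀ t ∈ Set.Icc 0 T, TwoLayer.IsHyperbolic γ δ h₀ (fun x => TwoLayer.chgF γ δ (V t x))) →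
        TwoLayer.HasBoundedTimeDeriv γ (s - 1) T V V' →
        TwoLayer.linftyXsNorm γ s T V + TwoLayer.linftyXsNorm γ (s - 1) T V' ≤ ENNReal.ofReal M →
        TwoLayer.IsStrongSolution γ δ s T V W R →
        ∀ C₀ : ℝ≥0, C₀ = C ![M, h₀⁻¹, δmin⁻¹, δmax, γmin⁻¹] →
        ∀ t ∈ Set.Icc 0 T,
          TwoLayer.xsNorm γ s (W t) ≤
            C₀ * TwoLayer.xsNorm γ s (W 0) * ENNReal.ofReal (Real.exp (C₀ * M * t)) +
            C₀ * ∫⁻ t' in Set.Icc 0 t,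
              ENNReal.ofReal (Real.exp (C₀ * M * (t - t'))) * TwoLayer.xsNorm γ s (R t') := by
  have hs' : 3 / 2 < s := by linarith
  choose c hc using fun k : ℕ => TwoLayer.exists_energy_estimate hs' (k + 1 : ℝ) (by positivity)
  -- `n p + 1` is a monotone function of the parameters that dominates all five, hence an admissible
  -- `P`.
  set n : (Fin 5 → ℝ) → ℕ := fun p => ⌈∑ i, max (p i) 0⌉₊ with hn
  have hn_mono : Monotone n := fun p q hpq =>
    Nat.ceil_mono (Finset.sum_le_sum fun i _ => max_le_max (hpq i) le_rfl)
  have hn_le : ∀ p i, p i ≤ (n p + 1 : ℝ) := fun p i => by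
    have h1 : max (p i) 0 ≤ ∑ i, max (p i) 0 :=
      Finset.single_le_sum (f := fun i => max (p i) 0) (fun _ _ => le_max_right _ _)
        (Finset.mem_univ i)
    linarith [le_max_left (p i) 0, Nat.le_ceil (∑ i, max (p i) 0)]
  -- The constants `c k` need not increase with `k`. Partial sums of their positive parts do, and
  -- the one up to `k = n p` is at least `c (n p)`; the energy estimate allows any larger constant.
  refine ⟨fun p => ∑ k ∈ Finset.range (n p + 1), (c k).toNNReal, fun p q hpq =>
    Finset.sum_le_sum_of_subset (Finset.range_mono (Nat.succ_le_succ (hn_mono hpq))), ?_⟩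
  intro δmin δmax γmin M T h₀ hδmin hγmin hM hT hh₀ δ γ hδ hδ' hγ hγ1 V V' W R hVc hhyp hVt hVM hsol
    C₀ hC₀ t ht
  set p : Fin 5 → ℝ := ![M, h₀⁻¹, δmin⁻¹, δmax, γmin⁻¹]
  have hP : (0 : ℝ) < n p + 1 := by positivity
  have hinv : ∀ {x y : ℝ}, 0 < x → x ≤ y → x⁻¹ ≤ (n p + 1 : ℝ) → (n p + 1 : ℝ)⁻¹ ≤ y :=
    fun hx hxy h => (inv_le_of_inv_le₀ hx h).trans hxy
  have ha : TwoLayer.Adm (n p + 1 : ℝ) γ δ :=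
    ⟨by simp, hinv hγmin hγ (hn_le p 4), hγ1, hinv hδmin hδ (hn_le p 2), hδ'.trans (hn_le p 3)⟩
  have hle : c (n p) ≤ (C₀ : ℝ) := by
    refine (Real.le_coe_toNNReal _).trans (NNReal.coe_le_coe.2 ?_)
    rw [hC₀]
    exact Finset.single_le_sum (f := fun k => (c k).toNNReal) (fun _ _ => zero_le)
      (Finset.mem_range.2 (Nat.lt_succ_self _))
  have h1 : ∀ᵐ t ∂(volume.restrict (Set.Icc 0 T)),
      TwoLayer.xsNorm γ s (V t) ≤ ENNReal.ofReal M :=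
    (ENNReal.ae_le_essSup _).mono fun t h => h.trans ((le_add_right le_rfl).trans hVM)
  have h2 : ∀ᵐ t ∂(volume.restrict (Set.Icc 0 T)),
      TwoLayer.xsNorm γ (s - 1) (V' t) ≤ ENNReal.ofReal M :=
    (ENNReal.ae_le_essSup _).mono fun t h => h.trans ((le_add_left le_rfl).trans hVM)
  have := hc (n p) γ δ ha M T h₀ hM (hn_le p 0) hT (hinv hh₀ le_rfl (hn_le p 1)) V V' W R hVc hhyp
    hVt h1 h2 hsol C₀ hle t ht
  rwa [ENNReal.ofReal_coe_nnreal] at this
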